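/- **Theorem.** Let $H,U_1,U_2$ be real Hilbert spaces, let $A:\mathcal D(A)\subset H\to H$ be a positive self-adjoint operator with a compact inverse in $H$, let $V=\mathcal D(A^{1/2})$ with $(u,v)_V=(A^{1/2}u,A^{1/2}v)_H$, and let $V'$ be the dual of $V$ ($V\subset H\subset V'$). Let $0=t_0<t_1<t_2<\cdots$, $I_n=[t_n,t_{n+1})$, $T_n=t_{n+1}-t_n$, and let $\tau>0$ satisfy $\tau\le T_{2n}$ for all $n\in\mathbb N$. Let $B_1(t)\in\mathcal L(U_1,V')$ and $B_2(t)\in\mathcal L(U_2,H)$, $t\ge 0$, be such that for every $n\in\mathbb N$: * $B_2(t)=0$ for $t\in I_{2n}$ and $B_1(t)=0$ for $t\in I_{2n+1}$; * the restriction of $B_2$ to $I_{2n+1}$ extends to an element of $C([t_{2n+1},t_{2n+2}];\mathcal L(U_2,H))$; * either the restriction of $B_1$ to $I_{2n}$ extends to an element of $C^1([t_{2n},t_{2n+1}];\mathcal L(U_1,H))$, or $B_1(t)=\sqrt{b_1(t)}\,C_n$ for $t\in I_{2n}$, where $C_n\in\mathcal L(U_1,V')$ and $b_1\in W^{2,\infty}(t_{2n},t_{2n+1})$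 (continuous representative) satisfies $b_1(t)>0$ for all $t\in I_{2n}$. Then for all $u_0\in V$ and $u_1\in H$ the problem $$u_{tt}(t)+Au(t)+B_1(t)B_1^*(t)u_t(t)+B_2(t)B_2^*(t)u_t(t-\tau)=0\quad(t>0),\qquad u(0)=u_0,\quad u_t(0)=u_1,$$ has a unique solution $u\in C([0,\infty);V)\cap C^1([0,\infty);H)$. Here a solution is a function of this class that takes the initial values and satisfies the equation on each interval $(t_n,t_{n+1})$ in the sense of $V'$-valued distributions, where $B_1B_1^*u_t$ is the distribution $$\langle B_1B_1^*u_t,\varphi v\rangle=-\int_{t_n}^{t_{n+1}}\frac{\partial}{\partial r}\Big[\varphi(r)\,\langle B_1(r)B_1(r)^*u(s),v\rangle_{V',V}\Big]_{r=s}\,ds ,\qquad \varphi\in C_c^\infty(t_n,t_{n+1}),\ v\in V,$$ which equals $\int\varphi\,\langle B_1B_1^*u_t,v\rangle\,ds$ whenever $u\in C^1((t_n,t_{n+1});V)$ or $B_1$ takes values in $\mathcal L(U_1,H)$. -/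

import Mathlib

open Set MeasureTheory
open scoped ContDiff InnerProductSpace

noncomputable section

namespace IntermittentDelay

/-! ### The operator `A` and the spaces `V = D(A^{1/2})`, `V'` -/

/-- A positive self-adjoint (in general unbounded) operator `A : D(A) ⊆ H → H` that has a compact
inverse defined on all of `H`. -/
structure PositiveOperator (H : Type*) [NormedAddCommGroup H] [InnerProductSpace ℝ H]
    [CompleteSpace H] where
  op : H →ₗ.[ℝ] H
  selfAdjoint : IsSelfAdjoint op
  nonneg : ∀ x : op.domain, 0 ≤ ⟪op x, (x : H)⟫_ℝ
  compactInverse : ∃ T : H →L[ℝ] H, IsCompactOperator T ∧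
    (∀ h : H, ∃ x : op.domain, (x : H) = T h ∧ op x = h) ∧ ∀ x : op.domain, T (op x) = (x : H)

section Operator

variable {H : Type*} [NormedAddCommGroup H] [InnerProductSpace ℝ H] [CompleteSpace H]

/-- The graph of the square root of `A`, through the spectral resolution of `A` (which has a
complete system of eigenvectors): `A^{1/2} x = y` iff, for every eigenpair `A e = l e`, the
`e`-component of `y` is `√l` times that of `x`.  In particular `x` is in the domain iff
`∑ l ⟪x, e⟫ ^ 2` converges, the sum being over an orthonormal basis of eigenvectors. -/
def sqrtGraph (A : PositiveOperator H) : Submodule ℝ (H × H) where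
  carrier := {p | ∀ (e : A.op.domain) (l : ℝ), A.op e = l • (e : H) →
    ⟪p.2, (e : H)⟫_ℝ = √l * ⟪p.1, (e : H)⟫_ℝ}
  zero_mem' := by
    intro e l _
    simp
  add_mem' := by
    intro p q hp hq e l he
    simp only [Prod.fst_add, Prod.snd_add, inner_add_left]
    rw [hp e l he, hq e l he]
    ring
  smul_mem' := by
    intro c p hp e l he
    simp only [Prod.smul_fst, Prod.smul_snd, real_inner_smul_left]
    rw [hp e l he]
    ring

/-- The operator `A^{1/2}`, with its domain. -/
def sqrtOp (A : PositiveOperator H) : H →ₗ.[ℝ] H := (sqrtGraph A).toLinearPMap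

/-- The eigenvectors of `A` that belong to positive eigenvalues are complete in `H`. -/
theorem eq_zero_of_forall_eigenvector (A : PositiveOperator H) (x : H)
    (hx : ∀ (e : A.op.domain) (l : ℝ), 0 < l → A.op e = l • (e : H) → ⟪x, (e : H)⟫_ℝ = 0) :
    x = 0 := by
  obtain ⟨T, hTc, hT1, hT2⟩ := A.compactInverse
  have hsym : T.IsSymmetric := by
    intro a b
    obtain ⟨a', ha, ha'⟩ := hT1 a
    obtain ⟨b', hb, hb'⟩ := hT1 b
    have h := LinearPMap.adjoint_isFormalAdjoint A.selfAdjoint.dense_domain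
    rw [LinearPMap.isSelfAdjoint_def.mp A.selfAdjoint] at h
    have h2 := h a' b'
    rw [ha', hb', ha, hb] at h2
    exact h2.symm
  have hmem : x ∈ (⨆ μ, Module.End.eigenspace (T : Module.End ℝ H) μ)ᗮ := by
    rw [Submodule.mem_orthogonal']
    intro y hy
    induction hy using Submodule.iSup_induction' with
    | mem μ y hy =>
      rw [Module.End.mem_eigenspace_iff] at hy
      have hy' : T y = μ • y := hy
      obtain ⟨y', hy1, hy2⟩ := hT1 y
      rcases eq_or_ne μ 0 with h0 | h0
      · rw [h0, zero_smul] at hy'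
        have hz : y' = 0 := Subtype.ext (by rw [hy1, hy']; rfl)
        rw [← hy2, hz, LinearPMap.map_zero, inner_zero_right]
      · rcases eq_or_ne y 0 with hy0 | hy0
        · rw [hy0, inner_zero_right]
        have hnn := A.nonneg y'
        rw [hy2, hy1, hy', real_inner_smul_right] at hnn
        have hyy : 0 < ⟪y, y⟫_ℝ := real_inner_self_pos.mpr hy0
        have hμ : 0 < μ := lt_of_le_of_ne (nonneg_of_mul_nonneg_left hnn hyy) h0.symm
        have hxe := hx y' μ⁻¹ (inv_pos.mpr hμ)
          (by rw [hy2, hy1, hy', smul_smul, inv_mul_cancel₀ h0, one_smul])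
        rw [hy1, hy', real_inner_smul_right] at hxe
        exact (mul_eq_zero.mp hxe).resolve_left h0
    | zero => simp
    | add y z _ _ h1 h2 => rw [inner_add_right, h1, h2, add_zero]
  rw [ContinuousLinearMap.orthogonalComplement_iSup_eigenspaces_eq_bot hTc hsym] at hmem
  simpa using hmem

theorem sqrtGraph_snd_eq_zero (A : PositiveOperator H) (p : H × H) (hp : p ∈ sqrtGraph A)
    (h : p.1 = 0) : p.2 = 0 := by
  refine eq_zero_of_forall_eigenvector A _ fun e l _ he => ?_
  rw [hp e l he, h, inner_zero_left, mul_zero]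

theorem graph_sqrtOp (A : PositiveOperator H) : (sqrtOp A).graph = sqrtGraph A :=
  Submodule.toLinearPMap_graph_eq _ (sqrtGraph_snd_eq_zero A)

theorem sqrtOp_injective (A : PositiveOperator H) (x : (sqrtOp A).domain)
    (hx : sqrtOp A x = 0) : x = 0 := by
  have hg : ((x : H), sqrtOp A x) ∈ sqrtGraph A := by
    rw [← graph_sqrtOp]
    exact LinearPMap.mem_graph _ x
  refine Subtype.ext (eq_zero_of_forall_eigenvector A _ fun e l hl he => ?_)
  have h := hg e l he
  simp only [hx, inner_zero_left] at h
  exact (mul_eq_zero.mp h.symm).resolve_left (Real.sqrt_pos.mpr hl).ne'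

/-- The space `V = D(A^{1/2})`.  It is a new type because it carries the inner product
`(u, v)_V = (A^{1/2} u, A^{1/2} v)_H` and not that of `H`. -/
def EnergySpace (A : PositiveOperator H) : Type _ := (sqrtOp A).domain

namespace EnergySpace

variable {A : PositiveOperator H}

instance : AddCommGroup (EnergySpace A) := inferInstanceAs (AddCommGroup (sqrtOp A).domain)

instance : Module ℝ (EnergySpace A) := inferInstanceAs (Module ℝ (sqrtOp A).domain)

/-- The embedding of `V` into `H`. -/
def toH : EnergySpace A →ₗ[ℝ] H := (sqrtOp A).domain.subtype

/-- `A^{1/2}` as a linear map on `V`. -/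
def root : EnergySpace A →ₗ[ℝ] H := (sqrtOp A).toFun

/-- The inner product `(u, v)_V = (A^{1/2} u, A^{1/2} v)_H`. -/
@[reducible] def core : InnerProductSpace.Core ℝ (EnergySpace A) where
  inner u v := ⟪root u, root v⟫_ℝ
  conj_inner_symm u v := by simp [real_inner_comm]
  re_inner_nonneg u := by simp
  add_left u v w := by simp [inner_add_left]
  smul_left u v r := by simp [real_inner_smul_left]
  definite u h := sqrtOp_injective A u (inner_self_eq_zero.mp h)

instance : NormedAddCommGroup (EnergySpace A) := core.toNormedAddCommGroup

instance : InnerProductSpace ℝ (EnergySpace A) := InnerProductSpace.ofCore core.toCore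

theorem inner_def (u v : EnergySpace A) : ⟪u, v⟫_ℝ = ⟪root u, root v⟫_ℝ := rfl

end EnergySpace

end Operator

/-! ### Test functions and Sobolev regularity on an interval -/

/-- `φ` is a test function on the open interval `(a, b)`, i.e. `φ ∈ C_c^∞(a, b)`. -/
def IsTestFunction (φ : ℝ → ℝ) (a b : ℝ) : Prop :=
  ContDiff ℝ ∞ φ ∧ HasCompactSupport φ ∧ tsupport φ ⊆ Ioo a b

/-- `g` is the weak derivative of `f` on `(a, b)`. -/
def HasWeakDeriv (f g : ℝ → ℝ) (a b : ℝ) : Prop :=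
  ∀ φ : ℝ → ℝ, IsTestFunction φ a b →
    ∫ s in Ioo a b, f s * deriv φ s = -∫ s in Ioo a b, g s * φ s

/-- `f ∈ W^{2,∞}(a, b)`. -/
def MemW2Infty (f : ℝ → ℝ) (a b : ℝ) : Prop :=
  ∃ f' f'' : ℝ → ℝ, MemLp f ⊤ (volume.restrict (Ioo a b)) ∧
    MemLp f' ⊤ (volume.restrict (Ioo a b)) ∧ MemLp f'' ⊤ (volume.restrict (Ioo a b)) ∧
    HasWeakDeriv f f' a b ∧ HasWeakDeriv f' f'' a b

/-! ### The problem with intermittent delay -/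

section Problem

variable {H U₁ U₂ : Type*} [NormedAddCommGroup H] [InnerProductSpace ℝ H] [CompleteSpace H]
  [NormedAddCommGroup U₁] [InnerProductSpace ℝ U₁] [CompleteSpace U₁]
  [NormedAddCommGroup U₂] [InnerProductSpace ℝ U₂] [CompleteSpace U₂]
  {A : PositiveOperator H}

/-- The adjoint `B* : V → U₁` of `B ∈ L(U₁, V')` : `(B* v, x)_{U₁} = ⟨B x, v⟩`. -/
def dualAdjoint (B : U₁ →L[ℝ] StrongDual ℝ (EnergySpace A)) (v : EnergySpace A) : U₁ :=
  (InnerProductSpace.toDual ℝ U₁).symm (B.flip v)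

theorem inner_dualAdjoint (B : U₁ →L[ℝ] StrongDual ℝ (EnergySpace A)) (v : EnergySpace A)
    (x : U₁) : ⟪dualAdjoint B v, x⟫_ℝ = B x v := by
  simp [dualAdjoint, InnerProductSpace.toDual_symm_apply]

/-- On `[a, b)` the undelayed damping operator is of class `C¹` up to the end points, with values
in `L(U₁, H)` (and `H ⊆ V'` through the inner product of `H`). -/
def IsBoundedDamping (B₁ : ℝ → U₁ →L[ℝ] StrongDual ℝ (EnergySpace A)) (a b : ℝ) : Prop :=
  ∃ F : ℝ → U₁ →L[ℝ] H, ContDiffOn ℝ 1 F (Icc a b) ∧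
    ∀ s ∈ Ico a b, ∀ x v, B₁ s x v = ⟪F s x, EnergySpace.toH v⟫_ℝ

/-- On `[a, b)` the undelayed damping operator is `√(β s) C` with a fixed `C ∈ L(U₁, V')` and a
positive `β ∈ W^{2,∞}(a, b)` (as usual, its continuous representative). -/
def IsUnboundedDamping (B₁ : ℝ → U₁ →L[ℝ] StrongDual ℝ (EnergySpace A)) (a b : ℝ) : Prop :=
  ∃ (β : ℝ → ℝ) (C : U₁ →L[ℝ] StrongDual ℝ (EnergySpace A)),
    MemW2Infty β a b ∧ ContinuousOn β (Ico a b) ∧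
    ∀ s ∈ Ico a b, 0 < β s ∧ B₁ s = √(β s) • C

/-- The standing assumptions.  The half-line is cut by `0 = t 0 < t 1 < ...`; `B₂` vanishes on
`[t (2n), t (2n+1))` and `B₁` vanishes on `[t (2n+1), t (2n+2))`; on the latter interval `B₂` is
norm-continuous up to the end points; on the former `B₁` is of one of the two types above; and the
delay is at most the length of each interval `[t (2n), t (2n+1))`. -/
structure IntermittentStructure (B₁ : ℝ → U₁ →L[ℝ] StrongDual ℝ (EnergySpace A))
    (B₂ : ℝ → U₂ →L[ℝ] H) (τ : ℝ) (t : ℕ → ℝ) : Prop where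
  zero : t 0 = 0
  strictMono : StrictMono t
  delay_pos : 0 < τ
  delay_le : ∀ n, τ ≤ t (2 * n + 1) - t (2 * n)
  B₂_eq_zero : ∀ n, ∀ s ∈ Ico (t (2 * n)) (t (2 * n + 1)), B₂ s = 0
  B₁_eq_zero : ∀ n, ∀ s ∈ Ico (t (2 * n + 1)) (t (2 * n + 2)), B₁ s = 0
  B₂_continuous : ∀ n, ∃ F : ℝ → U₂ →L[ℝ] H,
    ContinuousOn F (Icc (t (2 * n + 1)) (t (2 * n + 2))) ∧
    EqOn B₂ F (Ico (t (2 * n + 1)) (t (2 * n + 2)))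
  B₁_regular : ∀ n, IsBoundedDamping B₁ (t (2 * n)) (t (2 * n + 1)) ∨
    IsUnboundedDamping B₁ (t (2 * n)) (t (2 * n + 1))

/-- The velocity `u_t`, as an `H`-valued function on `[0, ∞)`. -/
def velocity (u : ℝ → EnergySpace A) (s : ℝ) : H :=
  derivWithin (fun r => EnergySpace.toH (u r)) (Ici 0) s

/-- The value at the test object `φ v` of the `V'`-valued distribution `B₁ B₁* u_t` on `(a, b)`.
As `u_t` need not have values in `V`, it is defined by transposition,
`⟨B₁ B₁* u_t, φ v⟩ = -∫ ⟨∂_r [φ(r) B₁(r) B₁(r)* v]_{r = s}, u(s)⟩ ds`,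
the derivative being that of `r ↦ φ(r) ⟨B₁(r) B₁(r)* u(s), v⟩` with `u(s)` frozen.  For
`u ∈ C¹([a, b]; V)`, or when `B₁` has values in `L(U₁, H)`, an integration by parts turns it into
`∫ φ(s) ⟨B₁(s) B₁(s)* u_t(s), v⟩ ds`. -/
def dampingPairing (B₁ : ℝ → U₁ →L[ℝ] StrongDual ℝ (EnergySpace A)) (u : ℝ → EnergySpace A)
    (v : EnergySpace A) (φ : ℝ → ℝ) (a b : ℝ) : ℝ :=
  -∫ s in Ioo a b, deriv (fun r => φ r * B₁ r (dualAdjoint (B₁ r) (u s)) v) s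

/-- `u` solves `u_tt + A u + B₁ B₁* u_t + B₂ B₂* u_t(· - τ) = 0` on `(a, b)` in the sense of
`V'`-valued distributions. -/
def SolvesOn (B₁ : ℝ → U₁ →L[ℝ] StrongDual ℝ (EnergySpace A)) (B₂ : ℝ → U₂ →L[ℝ] H) (τ : ℝ)
    (u : ℝ → EnergySpace A) (a b : ℝ) : Prop :=
  ∀ (v : EnergySpace A) (φ : ℝ → ℝ), IsTestFunction φ a b →
    -(∫ s in Ioo a b, ⟪velocity u s, EnergySpace.toH v⟫_ℝ * deriv φ s)
      + (∫ s in Ioo a b, ⟪u s, v⟫_ℝ * φ s)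
      + dampingPairing B₁ u v φ a b
      + (∫ s in Ioo a b,
          ⟪B₂ s ((B₂ s).adjoint (velocity u (s - τ))), EnergySpace.toH v⟫_ℝ * φ s) = 0

/-- `u ∈ C([0, ∞); V) ∩ C¹([0, ∞); H)` is a solution of the Cauchy problem with data `(u₀, u₁)`: it
has these initial values and solves the equation on each of the intervals `(t n, t (n+1))`.  (At the
points `t n`, where the operators may jump, `u` and `u_t` are continuous.) -/
structure IsSolution (B₁ : ℝ → U₁ →L[ℝ] StrongDual ℝ (EnergySpace A)) (B₂ : ℝ → U₂ →L[ℝ] H)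
    (τ : ℝ) (t : ℕ → ℝ) (u₀ : EnergySpace A) (u₁ : H) (u : ℝ → EnergySpace A) : Prop where
  continuousOn : ContinuousOn u (Ici 0)
  contDiffOn : ContDiffOn ℝ 1 (fun s => EnergySpace.toH (u s)) (Ici 0)
  initial : u 0 = u₀
  initial_velocity : velocity u 0 = u₁
  equation : ∀ n, SolvesOn B₁ B₂ τ u (t n) (t (n + 1))

end Problem

end IntermittentDelay

end

/-! On each interval `(t n, t (n+1))` the problem is an instance of one abstract equation `u'' + A u
+ b(t) L*L u' + D(t) u' = f`, recorded in `DampedWave`. Bounded `C¹` damping goes into `D` (with `L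
= 0`, `b = 1`), unbounded damping is `b L*L` with `L = C*`, and the delayed feedback is a source
`f`. By the method of steps `f` is known before it is needed. Where the feedback acts, its delayed
argument is nonnegative, because the preceding even interval is at least `τ` long.

Existence for `b > 0` follows the Hille–Yosida scheme with a time-dependent generator. The generator
is replaced by its Yosida approximation with parameter `μ`, which gives a linear differential
equation with bounded continuous coefficients. Energy estimates are uniform in `μ`. For data in the
domain of the generator and a `C¹` source, the energy of the time derivative is bounded as well
(`exists_bound_generator`): the variable coefficient costs `b'² / (2b) ‖L u'‖²`, which is harmless
where `b` is bounded below. Then the approximations are Cauchy as `μ → 0`, and density removes the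
regularity of the data (`cauchy`).

The delicate point is that `b` may vanish at the right end `d`, where `b'² / b` is no longer
controlled by regularity from the left alone. A Glaeser-type inequality for `W^{2,∞}` functions
gives `b'² ≤ K b + 4 b² / (d - t)²` (`exists_deriv_sq_le`). Its last term is paid for by the energy
dissipated by the damping, so `(d - t₀)² ‖U'(t₀)‖²`, with `U = (u, u')`, is bounded up to a constant
by the energy lost between `s` and `t₀` plus a term vanishing as `t₀ → d` (`energy_deriv_le`).
Hardly any energy is lost late, so `(d - t₀) ‖U'(t₀)‖` can be made small. A duality argument turns
this into smallness of `U(t) - U(t₀)` on `[t₀, d)` (`dist_sq_le`), and the solution has a limit in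
`V × H` at `d`.

Uniqueness cannot use the velocity as test vector, since `L u'` has no meaning for weak solutions.
The equation is kept in integrated form: the momentum `u' + b L*L u + D u` is a primitive of a force
involving only `u`. Testing the difference of two solutions with `u(t)` itself closes a Gronwall
estimate (`IsWeak.eq_zero`). This integrated form is equivalent to the stated distributional
equation by the du Bois-Reymond lemma (`solvesOn_iff`). The solution is then assembled interval by
interval. -/

namespace IntermittentDelay

/-! ### Differential inequalities and linear differential equations. -/

section Gronwall

theorem antitoneOn_Icc_of_hasDerivAt_nonpos {y y' : ℝ → ℝ} {c d : ℝ}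
    (hy : ∀ t ∈ Icc c d, HasDerivAt y (y' t) t) (h : ∀ t ∈ Icc c d, y' t ≤ 0) :
    AntitoneOn y (Icc c d) := by
  refine antitoneOn_of_deriv_nonpos (convex_Icc c d)
    (fun t ht => (hy t ht).continuousAt.continuousWithinAt)
    (fun t ht => (hy t (interior_subset ht)).differentiableAt.differentiableWithinAt)
    fun t ht => ?_
  rw [(hy t (interior_subset ht)).deriv]
  exact h t (interior_subset ht)

/-- Gronwall: multiplication by `exp (-K (t - c))` removes the linear term. This weight is at most
one, so `ε` may be integrated without it. -/
theorem le_exp_mul_of_hasDerivAt {y y' : ℝ → ℝ} {c d K ε : ℝ} (hK : 0 ≤ K) (hε : 0 ≤ ε)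
    (hy : ∀ t ∈ Icc c d, HasDerivAt y (y' t) t) (h : ∀ t ∈ Icc c d, y' t ≤ K * y t + ε) :
    ∀ t ∈ Icc c d, y t ≤ Real.exp (K * (t - c)) * (y c + ε * (t - c)) := by
  intro t ht
  have hc : c ∈ Icc c d := ⟨le_rfl, ht.1.trans ht.2⟩
  have hd : ∀ s ∈ Icc c d, HasDerivAt (fun s => Real.exp (-(K * (s - c))) * y s - ε * (s - c))
      (Real.exp (-(K * (s - c))) * (y' s - K * y s) - ε) s := by
    intro s hs
    have h1 : HasDerivAt (fun s : ℝ => -(K * (s - c))) (-(K * 1)) s :=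
      (((hasDerivAt_id s).sub_const c).const_mul K).neg
    have h2 := (h1.exp.mul (hy s hs)).sub (((hasDerivAt_id s).sub_const c).const_mul ε)
    refine h2.congr_deriv ?_
    ring
  have hanti := antitoneOn_Icc_of_hasDerivAt_nonpos hd (fun s hs => by
    have h1 : Real.exp (-(K * (s - c))) ≤ 1 :=
      Real.exp_le_one_iff.mpr (by nlinarith [hs.1])
    have h2 : y' s - K * y s ≤ ε := by linarith [h s hs]
    nlinarith [Real.exp_pos (-(K * (s - c)))])
  have h3 := hanti hc ht ht.1
  simp only [sub_self, mul_zero, neg_zero, Real.exp_zero, one_mul, sub_zero] at h3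
  have h4 : y t = Real.exp (K * (t - c)) * (Real.exp (-(K * (t - c))) * y t) := by
    rw [← mul_assoc, ← Real.exp_add]; simp
  rw [h4]
  exact mul_le_mul_of_nonneg_left (by linarith) (Real.exp_pos _).le

end Gronwall

section LinearODE

variable {E : Type*} [NormedAddCommGroup E] [NormedSpace ℝ E] [CompleteSpace E]

/-- A linear differential equation with continuous coefficients has a solution on every compact
interval. -/
theorem exists_linear_ode {a : ℝ → E →L[ℝ] E} {F : ℝ → E} (ha : Continuous a) (hF : Continuous F)
    {c d : ℝ} (hcd : c ≤ d) (x₀ : E) :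
    ∃ x : ℝ → E, x c = x₀ ∧ ∀ t ∈ Icc c d, HasDerivAt x (a t (x t) + F t) t := by
  obtain ⟨A, hA⟩ := (isCompact_Icc (a := c) (b := d)).exists_bound_of_continuousOn ha.continuousOn
  set M : ℝ := max A 1 with hM
  have hM1 : 1 ≤ M := le_max_right _ _
  have haM : ∀ t ∈ Icc c d, ‖a t‖ ≤ M := fun t ht => (hA t ht).trans (le_max_left _ _)
  have : Nonempty (Icc c d) := ⟨⟨c, le_rfl, hcd⟩⟩
  let ext : C(Icc c d, E) → ℝ → E := fun y s => y (projIcc c d hcd s)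
  have hext : ∀ y, Continuous (ext y) := fun y => y.continuous.comp continuous_projIcc
  let g : C(Icc c d, E) → ℝ → E := fun y s =>
    a s (ext y s) + Real.exp (-(2 * M * (s - c))) • F s
  have hg : ∀ y, Continuous (g y) := fun y =>
    (ha.clm_apply (hext y)).add (Continuous.smul (by fun_prop) hF)
  -- The unknown is `y t = exp (-2M (t - c)) x t`. In this weighted variable the Picard map
  -- contracts by the factor `1/2`, however long the interval is.
  let G : C(Icc c d, E) → ℝ → E := fun y t =>
    Real.exp (-(2 * M * (t - c))) • (x₀ + ∫ s in c..t, Real.exp (2 * M * (s - c)) • g y s)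
  have hgi : ∀ y, Continuous fun s => Real.exp (2 * M * (s - c)) • g y s := fun y =>
    Continuous.smul (by fun_prop) (hg y)
  have hG : ∀ y, Continuous (G y) := fun y => by
    refine Continuous.smul (by fun_prop) (continuous_const.add ?_)
    exact intervalIntegral.continuous_primitive (fun _ _ => (hgi y).intervalIntegrable _ _) _
  let Φ : C(Icc c d, E) → C(Icc c d, E) := fun y => ⟨fun t => G y t, (hG y).comp continuous_subtype_val⟩
  have hΦ : ContractingWith (1 / 2) Φ := by
    refine ⟨by rw [← NNReal.coe_lt_coe]; norm_num, LipschitzWith.of_dist_le_mul fun y z => ?_⟩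
    rw [ContinuousMap.dist_le (by positivity)]
    rintro ⟨t, ht⟩
    change dist (G y t) (G z t) ≤ _
    have hsub : G y t - G z t = Real.exp (-(2 * M * (t - c))) •
        ∫ s in c..t, Real.exp (2 * M * (s - c)) • a s (ext y s - ext z s) := by
      simp only [G]
      rw [← smul_sub, add_sub_add_left_eq_sub, ← intervalIntegral.integral_sub
        ((hgi y).intervalIntegrable _ _) ((hgi z).intervalIntegrable _ _)]
      congr 2
      ext s
      simp only [g]
      rw [← smul_sub, add_sub_add_right_eq_sub, map_sub]
    rw [dist_eq_norm, hsub, norm_smul, Real.norm_eq_abs, abs_of_pos (Real.exp_pos _)]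
    have hint : ‖∫ s in c..t, Real.exp (2 * M * (s - c)) • a s (ext y s - ext z s)‖ ≤
        ∫ s in c..t, Real.exp (2 * M * (s - c)) * (M * dist y z) := by
      refine intervalIntegral.norm_integral_le_of_norm_le ht.1 ?_ ?_
      · refine Filter.Eventually.of_forall fun s hs => ?_
        rw [norm_smul, Real.norm_eq_abs, abs_of_pos (Real.exp_pos _)]
        refine mul_le_mul_of_nonneg_left ?_ (Real.exp_pos _).le
        refine (ContinuousLinearMap.le_opNorm _ _).trans ?_
        refine mul_le_mul (haM s ⟨hs.1.le, hs.2.trans ht.2⟩) ?_ (norm_nonneg _) (by linarith)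
        rw [← dist_eq_norm]
        exact ContinuousMap.dist_apply_le_dist _
      · exact Continuous.intervalIntegrable (by fun_prop) _ _
    have hval : ∫ s in c..t, Real.exp (2 * M * (s - c)) * (M * dist y z) =
        (Real.exp (2 * M * (t - c)) - 1) * (dist y z / 2) := by
      have hder : ∀ s ∈ uIcc c t, HasDerivAt (fun s => Real.exp (2 * M * (s - c)) * (dist y z / 2))
          (Real.exp (2 * M * (s - c)) * (M * dist y z)) s := by
        intro s _
        have h1 : HasDerivAt (fun s : ℝ => 2 * M * (s - c)) (2 * M * 1) s :=
          ((hasDerivAt_id s).sub_const c).const_mul _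
        refine (h1.exp.mul_const _).congr_deriv ?_
        ring
      rw [intervalIntegral.integral_eq_sub_of_hasDerivAt hder
        (Continuous.intervalIntegrable (by fun_prop) _ _)]
      simp
      ring
    have hexp : Real.exp (-(2 * M * (t - c))) * Real.exp (2 * M * (t - c)) = 1 := by
      rw [← Real.exp_add]; simp
    calc Real.exp (-(2 * M * (t - c))) * _
        ≤ Real.exp (-(2 * M * (t - c))) * ((Real.exp (2 * M * (t - c)) - 1) * (dist y z / 2)) := by
          rw [← hval]
          exact mul_le_mul_of_nonneg_left hint (Real.exp_pos _).le
      _ = (1 - Real.exp (-(2 * M * (t - c)))) * (dist y z / 2) := by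
          rw [← mul_assoc, mul_sub, hexp, mul_one]
      _ ≤ 1 * (dist y z / 2) := by
          refine mul_le_mul_of_nonneg_right ?_ (by positivity)
          linarith [Real.exp_pos (-(2 * M * (t - c)))]
      _ = _ := by push_cast; ring
  obtain ⟨y, hy⟩ : ∃ y, Φ y = y := ⟨_, hΦ.fixedPoint_isFixedPt⟩
  have hyt : ∀ t ∈ Icc c d, ext y t = G y t := by
    intro t ht
    have h1 : ext y t = y ⟨t, ht⟩ := by simp only [ext]; rw [projIcc_of_mem hcd ht]
    rw [h1]
    conv_lhs => rw [← hy]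
    rfl
  -- Since `ext` freezes `y` beyond the end points, this formula makes sense on the whole line and
  -- the derivatives at `c` and `d` are two-sided.
  refine ⟨fun t => x₀ + ∫ s in c..t, Real.exp (2 * M * (s - c)) • g y s, by simp, fun t ht => ?_⟩
  have h1 : HasDerivAt (fun t => x₀ + ∫ s in c..t, Real.exp (2 * M * (s - c)) • g y s)
      (Real.exp (2 * M * (t - c)) • g y t) t :=
    (intervalIntegral.integral_hasDerivAt_right ((hgi y).intervalIntegrable _ _)
      ((hgi y).stronglyMeasurableAtFilter _ _) (hgi y).continuousAt).const_add _
  refine h1.congr_deriv ?_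
  have hexp : Real.exp (2 * M * (t - c)) * Real.exp (-(2 * M * (t - c))) = 1 := by
    rw [← Real.exp_add]; simp
  simp only [g]
  rw [smul_add, smul_smul, hexp, one_smul, ← map_smul, hyt t ht]
  simp only [G]
  rw [smul_smul, hexp, one_smul]

end LinearODE

end IntermittentDelay

/-! ### The abstract damped wave equation and its Yosida regularization. -/

namespace IntermittentDelay

/-- The data of an abstract wave equation `u'' + A u + b(t) L* L u' + D(t) u' = f`, where
`V ⊆ H ⊆ V'` is a Hilbert triple and `A : V → V'` is the Riesz isomorphism. -/
structure DampedWave (V H U : Type*) [NormedAddCommGroup V] [InnerProductSpace ℝ V]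
    [NormedAddCommGroup H] [InnerProductSpace ℝ H]
    [NormedAddCommGroup U] [InnerProductSpace ℝ U] where
  emb : V →L[ℝ] H
  obs : V →L[ℝ] U
  coeff : ℝ → ℝ
  coeff' : ℝ → ℝ
  pert : ℝ → H →L[ℝ] H
  pert' : ℝ → H →L[ℝ] H
  emb_injective : Function.Injective emb
  emb_dense : DenseRange emb
  coeff_continuous : Continuous coeff
  coeff_nonneg : ∀ t, 0 ≤ coeff t
  coeff_hasDerivAt : ∀ t, 0 < coeff t → HasDerivAt coeff (coeff' t) t
  coeff'_continuous : Continuous coeff'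
  pert_hasDerivAt : ∀ t, HasDerivAt pert (pert' t) t
  pert'_continuous : Continuous pert'

namespace DampedWave

set_option linter.unusedSectionVars false

variable {V H U : Type*} [NormedAddCommGroup V] [InnerProductSpace ℝ V] [CompleteSpace V]
  [NormedAddCommGroup H] [InnerProductSpace ℝ H] [CompleteSpace H]
  [NormedAddCommGroup U] [InnerProductSpace ℝ U] [CompleteSpace U]
  (W : DampedWave V H U)

theorem pert_continuous : Continuous W.pert :=
  continuous_iff_continuousAt.mpr fun t => (W.pert_hasDerivAt t).continuousAt

/-- The operator `ι* ι + μ² + μ b L* L` of `V`, which has to be inverted for the resolvent. -/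
noncomputable def shifted (μ b : ℝ) : V →L[ℝ] V :=
  W.emb.adjoint ∘L W.emb + μ ^ 2 • (1 : V →L[ℝ] V) + (μ * b) • (W.obs.adjoint ∘L W.obs)

theorem inner_shifted (μ b : ℝ) (w z : V) : ⟪W.shifted μ b w, z⟫_ℝ =
    ⟪W.emb w, W.emb z⟫_ℝ + μ ^ 2 * ⟪w, z⟫_ℝ + μ * b * ⟪W.obs w, W.obs z⟫_ℝ := by
  simp [shifted, inner_add_left, real_inner_smul_left, ContinuousLinearMap.adjoint_inner_left]

/-- Lax–Milgram: the form dominates `μ² ‖w‖²`, the other two terms being nonnegative. -/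
theorem isUnit_shifted {μ b : ℝ} (hμ : 0 < μ) (hb : 0 ≤ b) : IsUnit (W.shifted μ b) := by
  refine ContinuousLinearMap.isUnit_of_forall_le_norm_inner_map _ (c := (μ ^ 2).toNNReal)
    (Real.toNNReal_pos.mpr (by positivity)) fun w => ?_
  rw [inner_shifted, Real.norm_eq_abs, Real.coe_toNNReal _ (sq_nonneg μ)]
  refine le_trans ?_ (le_abs_self _)
  simp only [real_inner_self_eq_norm_sq]
  have h1 : 0 ≤ μ * b * ‖W.obs w‖ ^ 2 := by positivity
  nlinarith [sq_nonneg ‖W.emb w‖]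

theorem hasDerivAt_shifted (μ : ℝ) {b : ℝ → ℝ} {b' t : ℝ} (hb : HasDerivAt b b' t) :
    HasDerivAt (fun s => W.shifted μ (b s)) ((μ * b') • (W.obs.adjoint ∘L W.obs)) t :=
  ((hb.const_mul μ).smul_const _).const_add _

theorem continuous_shifted (μ : ℝ) : Continuous fun b => W.shifted μ b := by
  unfold shifted
  fun_prop

/-- The velocity component of the resolvent of the generator at time `t`. -/
noncomputable def vhat (μ t : ℝ) : V × H →L[ℝ] V :=
  Ring.inverse (W.shifted μ (W.coeff t)) ∘L
    (W.emb.adjoint ∘L ContinuousLinearMap.snd ℝ V H - μ • ContinuousLinearMap.fst ℝ V H)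

theorem shifted_vhat {μ : ℝ} (hμ : 0 < μ) (t : ℝ) (p : V × H) :
    W.shifted μ (W.coeff t) (W.vhat μ t p) = W.emb.adjoint p.2 - μ • p.1 := by
  have h := Ring.mul_inverse_cancel _ (W.isUnit_shifted hμ (W.coeff_nonneg t))
  have h2 := congrArg (fun f : V →L[ℝ] V => f (W.emb.adjoint p.2 - μ • p.1)) h
  simpa [vhat] using h2

theorem inner_vhat {μ : ℝ} (hμ : 0 < μ) (t : ℝ) (p : V × H) (z : V) :
    ⟪W.emb (W.vhat μ t p), W.emb z⟫_ℝ + μ ^ 2 * ⟪W.vhat μ t p, z⟫_ℝ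
      + μ * W.coeff t * ⟪W.obs (W.vhat μ t p), W.obs z⟫_ℝ = ⟪p.2, W.emb z⟫_ℝ - μ * ⟪p.1, z⟫_ℝ := by
  rw [← inner_shifted, W.shifted_vhat hμ, inner_sub_left, real_inner_smul_left,
    ContinuousLinearMap.adjoint_inner_left]

theorem continuous_vhat {μ : ℝ} (hμ : 0 < μ) : Continuous (W.vhat μ) := by
  have h : Continuous fun t => Ring.inverse (W.shifted μ (W.coeff t)) := by
    refine continuous_iff_continuousAt.mpr fun t => ?_
    obtain ⟨x, hx⟩ := W.isUnit_shifted hμ (W.coeff_nonneg t)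
    have h1 := NormedRing.inverse_continuousAt x
    rw [hx] at h1
    exact ContinuousAt.comp (f := fun t => W.shifted μ (W.coeff t)) h1
      ((W.continuous_shifted μ).comp W.coeff_continuous).continuousAt
  exact h.clm_comp continuous_const

/-- The acceleration component `q` of the Yosida approximation of the generator. -/
noncomputable def accel (μ t : ℝ) (p : V × H) : H := μ⁻¹ • (W.emb (W.vhat μ t p) - p.2)

theorem emb_vhat {μ : ℝ} (hμ : 0 < μ) (t : ℝ) (p : V × H) :
    W.emb (W.vhat μ t p) = p.2 + μ • W.accel μ t p := by
  rw [accel, smul_smul, mul_inv_cancel₀ hμ.ne', one_smul, add_sub_cancel]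

/-- Together with `emb_vhat` this identifies `(vhat, accel)` as the generator applied to the
resolvent `(p.1 + μ w, p.2 + μ q)`: the operator `A` is the Riesz isomorphism, so `q = -A (p.1 + μ
w) - b L*L w` holds in `V'`. -/
theorem inner_accel {μ : ℝ} (hμ : 0 < μ) (t : ℝ) (p : V × H) (z : V) :
    ⟪W.accel μ t p, W.emb z⟫_ℝ = -⟪p.1 + μ • W.vhat μ t p, z⟫_ℝ
      - W.coeff t * ⟪W.obs (W.vhat μ t p), W.obs z⟫_ℝ := by
  have h := W.inner_vhat hμ t p z
  rw [accel, real_inner_smul_left, inner_sub_left, inner_add_left, real_inner_smul_left]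
  field_simp
  linarith

/-- Dissipativity of the Yosida approximation. -/
theorem inner_generator {μ : ℝ} (hμ : 0 < μ) (t : ℝ) (p : V × H) :
    ⟪p.1, W.vhat μ t p⟫_ℝ + ⟪p.2, W.accel μ t p⟫_ℝ = -(μ * ‖W.vhat μ t p‖ ^ 2)
      - W.coeff t * ‖W.obs (W.vhat μ t p)‖ ^ 2 - μ * ‖W.accel μ t p‖ ^ 2 := by
  have h := W.inner_accel hμ t p (W.vhat μ t p)
  rw [W.emb_vhat hμ, inner_add_right, inner_add_left, real_inner_smul_left,
    real_inner_smul_right] at h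
  simp only [real_inner_self_eq_norm_sq] at h
  rw [real_inner_comm (W.accel μ t p)]
  linarith

/-- `(u, v)` solves the regularized problem with parameter `μ` and source `f` on `[c, d]`. -/
structure IsApprox (μ : ℝ) (f : ℝ → H) (c d : ℝ) (u : ℝ → V) (v : ℝ → H) : Prop where
  fst : ∀ t ∈ Icc c d, HasDerivAt u (W.vhat μ t (u t, v t)) t
  snd : ∀ t ∈ Icc c d, HasDerivAt v (W.accel μ t (u t, v t) - W.pert t (v t) + f t) t

theorem exists_isApprox {μ : ℝ} (hμ : 0 < μ) {f : ℝ → H} (hf : Continuous f) {c d : ℝ}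
    (hcd : c ≤ d) (u₀ : V) (v₀ : H) :
    ∃ u v, W.IsApprox μ f c d u v ∧ u c = u₀ ∧ v c = v₀ := by
  let a : ℝ → V × H →L[ℝ] V × H := fun t =>
    (W.vhat μ t).prod (μ⁻¹ • (W.emb ∘L W.vhat μ t - ContinuousLinearMap.snd ℝ V H)
      - W.pert t ∘L ContinuousLinearMap.snd ℝ V H)
  have ha : Continuous a := by
    have h1 := W.continuous_vhat hμ
    have h2 := W.pert_continuous
    have h3 : Continuous fun t => μ⁻¹ • (W.emb ∘L W.vhat μ t - ContinuousLinearMap.snd ℝ V H)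
      - W.pert t ∘L ContinuousLinearMap.snd ℝ V H :=
      (((continuous_const.clm_comp h1).sub continuous_const).const_smul μ⁻¹).sub
        (h2.clm_comp continuous_const)
    exact (ContinuousLinearMap.prodₗᵢ ℝ).continuous.comp (h1.prodMk h3)
  obtain ⟨x, hx0, hx⟩ := exists_linear_ode ha
    (F := fun t => ((0 : V), f t)) (continuous_const.prodMk hf) hcd (u₀, v₀)
  refine ⟨fun t => (x t).1, fun t => (x t).2, ⟨fun t ht => ?_, fun t ht => ?_⟩, by simp [hx0],
    by simp [hx0]⟩
  · exact ((ContinuousLinearMap.fst ℝ V H).hasFDerivAt.comp_hasDerivAt t (hx t ht)).congr_deriv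
      (by simp [a])
  · exact ((ContinuousLinearMap.snd ℝ V H).hasFDerivAt.comp_hasDerivAt t (hx t ht)).congr_deriv
      (by simp [a, accel])

namespace IsApprox

variable {W} {μ c d : ℝ} {f f₁ f₂ : ℝ → H} {u u₁ u₂ : ℝ → V} {v v₁ v₂ : ℝ → H}

theorem mono {c' d' : ℝ} (h : W.IsApprox μ f c d u v) (hc : c ≤ c') (hd : d' ≤ d) :
    W.IsApprox μ f c' d' u v :=
  ⟨fun t ht => h.fst t ⟨hc.trans ht.1, ht.2.trans hd⟩,
    fun t ht => h.snd t ⟨hc.trans ht.1, ht.2.trans hd⟩⟩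

theorem sub (h₁ : W.IsApprox μ f₁ c d u₁ v₁) (h₂ : W.IsApprox μ f₂ c d u₂ v₂) :
    W.IsApprox μ (f₁ - f₂) c d (u₁ - u₂) (v₁ - v₂) := by
  have hv : ∀ t, W.vhat μ t ((u₁ - u₂) t, (v₁ - v₂) t) =
      W.vhat μ t (u₁ t, v₁ t) - W.vhat μ t (u₂ t, v₂ t) := fun t => by
    rw [← map_sub]; rfl
  refine ⟨fun t ht => ?_, fun t ht => ?_⟩
  · rw [hv]
    exact (h₁.fst t ht).sub (h₂.fst t ht)
  · refine ((h₁.snd t ht).sub (h₂.snd t ht)).congr_deriv ?_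
    rw [accel, accel, accel, hv]
    simp only [Pi.sub_apply, map_sub]
    module

/-- Derivative of the energy. -/
theorem hasDerivAt_energy (hμ : 0 < μ) (h : W.IsApprox μ f c d u v) {t : ℝ} (ht : t ∈ Icc c d) :
    HasDerivAt (fun t => ‖u t‖ ^ 2 + ‖v t‖ ^ 2)
      (2 * (-(μ * ‖W.vhat μ t (u t, v t)‖ ^ 2)
        - W.coeff t * ‖W.obs (W.vhat μ t (u t, v t))‖ ^ 2 - μ * ‖W.accel μ t (u t, v t)‖ ^ 2
        - ⟪v t, W.pert t (v t)⟫_ℝ + ⟪v t, f t⟫_ℝ)) t := by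
  refine ((h.fst t ht).norm_sq.add (h.snd t ht).norm_sq).congr_deriv ?_
  have h1 := W.inner_generator hμ t (u t, v t)
  simp only at h1
  rw [inner_add_right, inner_sub_right]
  linarith

/-- The energy estimate, uniform in `μ`. -/
theorem energy_le (hμ : 0 < μ) (h : W.IsApprox μ f c d u v) {K ε : ℝ} (hK : 0 ≤ K)
    (hD : ∀ t ∈ Icc c d, ‖W.pert t‖ ≤ K) (hε : ∀ t ∈ Icc c d, ‖f t‖ ≤ ε) :
    ∀ t ∈ Icc c d, ‖u t‖ ^ 2 + ‖v t‖ ^ 2 ≤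
      Real.exp ((2 * K + 1) * (t - c)) * (‖u c‖ ^ 2 + ‖v c‖ ^ 2 + ε ^ 2 * (t - c)) := by
  refine le_exp_mul_of_hasDerivAt (by positivity) (by positivity)
    (fun t ht => h.hasDerivAt_energy hμ ht) fun t ht => ?_
  have h1 : 0 ≤ μ * ‖W.vhat μ t (u t, v t)‖ ^ 2 := by positivity
  have h2 : 0 ≤ W.coeff t * ‖W.obs (W.vhat μ t (u t, v t))‖ ^ 2 :=
    mul_nonneg (W.coeff_nonneg t) (sq_nonneg _)
  have h3 : 0 ≤ μ * ‖W.accel μ t (u t, v t)‖ ^ 2 := by positivity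
  have h4 : -⟪v t, W.pert t (v t)⟫_ℝ ≤ K * ‖v t‖ ^ 2 := by
    refine (neg_le_abs _).trans ((abs_real_inner_le_norm _ _).trans ?_)
    have := ((W.pert t).le_opNorm (v t)).trans
      (mul_le_mul_of_nonneg_right (hD t ht) (norm_nonneg (v t)))
    nlinarith [norm_nonneg (v t)]
  have h5 : 2 * ⟪v t, f t⟫_ℝ ≤ ‖v t‖ ^ 2 + ε ^ 2 := by
    have := (real_inner_le_norm (v t) (f t)).trans
      (mul_le_mul_of_nonneg_left (hε t ht) (norm_nonneg _))
    nlinarith [sq_nonneg (‖v t‖ - ε)]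
  nlinarith [mul_nonneg hK (sq_nonneg ‖u t‖), sq_nonneg ‖u t‖]

end IsApprox

theorem neg_inner_smul_sub_smul_le {E : Type*} [NormedAddCommGroup E] [InnerProductSpace ℝ E]
    {μ ν M : ℝ} (hμ : 0 < μ) (hν : 0 < ν) {x y : E} (hx : ‖x‖ ≤ M) (hy : ‖y‖ ≤ M) :
    -⟪μ • x - ν • y, x - y⟫_ℝ ≤ 2 * (μ + ν) * M ^ 2 := by
  have hM : 0 ≤ M := (norm_nonneg _).trans hx
  refine (neg_le_abs _).trans ((abs_real_inner_le_norm _ _).trans ?_)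
  have i1 : ‖μ • x - ν • y‖ ≤ (μ + ν) * M := by
    refine (norm_sub_le _ _).trans ?_
    rw [norm_smul, norm_smul, Real.norm_eq_abs, Real.norm_eq_abs, abs_of_pos hμ, abs_of_pos hν]
    nlinarith
  have i2 : ‖x - y‖ ≤ 2 * M := (norm_sub_le _ _).trans (by linarith)
  calc ‖μ • x - ν • y‖ * ‖x - y‖ ≤ ((μ + ν) * M) * (2 * M) := by gcongr
    _ = _ := by ring

/-- The cross term in the comparison of two regularizations. -/
theorem inner_generator_sub_le {μ ν M : ℝ} (hμ : 0 < μ) (hν : 0 < ν) (t : ℝ) (p r : V × H)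
    (h1 : ‖W.vhat μ t p‖ ≤ M) (h2 : ‖W.vhat ν t r‖ ≤ M) (h3 : ‖W.accel μ t p‖ ≤ M)
    (h4 : ‖W.accel ν t r‖ ≤ M) :
    ⟪p.1 - r.1, W.vhat μ t p - W.vhat ν t r⟫_ℝ + ⟪p.2 - r.2, W.accel μ t p - W.accel ν t r⟫_ℝ
      ≤ 4 * (μ + ν) * M ^ 2 := by
  set a := W.vhat μ t p with ha
  set b := W.vhat ν t r with hb
  set q := W.accel μ t p with hq
  set s := W.accel ν t r with hs
  have e1 := W.inner_accel hμ t p (a - b)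
  have e2 := W.inner_accel hν t r (a - b)
  have e3 := W.emb_vhat hμ t p
  have e4 := W.emb_vhat hν t r
  rw [← ha] at e1 e3
  rw [← hb] at e2 e4
  rw [← hq] at e1 e3
  rw [← hs] at e2 e4
  -- Each velocity is exchanged for its resolvent velocity, which is an admissible test vector. The
  -- exchange leaves a damping term of good sign and errors of order `μ + ν`.
  have e5 : p.2 - r.2 = W.emb (a - b) - (μ • q - ν • s) := by
    rw [map_sub, e3, e4]; abel
  have e6 : ⟪q - s, W.emb (a - b)⟫_ℝ = -⟪p.1 - r.1, a - b⟫_ℝ - ⟪μ • a - ν • b, a - b⟫_ℝ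
      - W.coeff t * ‖W.obs (a - b)‖ ^ 2 := by
    rw [inner_sub_left, e1, e2, ← real_inner_self_eq_norm_sq]
    simp only [map_sub, inner_sub_left, inner_add_left]
    ring
  have e7 : ⟪p.1 - r.1, a - b⟫_ℝ + ⟪p.2 - r.2, q - s⟫_ℝ = -⟪μ • a - ν • b, a - b⟫_ℝ
      - W.coeff t * ‖W.obs (a - b)‖ ^ 2 - ⟪μ • q - ν • s, q - s⟫_ℝ := by
    rw [e5, inner_sub_left (𝕜 := ℝ) (W.emb (a - b)), real_inner_comm (q - s), e6]
    ring
  have hM : 0 ≤ M := (norm_nonneg _).trans h1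
  have k1 := neg_inner_smul_sub_smul_le hμ hν h1 h2
  have k2 := neg_inner_smul_sub_smul_le hμ hν h3 h4
  have k3 : 0 ≤ W.coeff t * ‖W.obs (a - b)‖ ^ 2 := mul_nonneg (W.coeff_nonneg t) (sq_nonneg _)
  linarith

end DampedWave

end IntermittentDelay

/-! ### Regular data and bounds for the time derivative. -/

namespace IntermittentDelay

theorem exists_norm_le_on_Icc {E : Type*} [NormedAddCommGroup E] {g : ℝ → E} {c d : ℝ}
    (hg : ContinuousOn g (Icc c d)) : ∃ K, 0 ≤ K ∧ ∀ t ∈ Icc c d, ‖g t‖ ≤ K := by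
  obtain ⟨K, hK⟩ := isCompact_Icc.exists_bound_of_continuousOn hg
  exact ⟨max K 0, le_max_right _ _, fun t ht => (hK t ht).trans (le_max_left _ _)⟩

namespace DampedWave

set_option linter.unusedSectionVars false

variable {V H U : Type*} [NormedAddCommGroup V] [InnerProductSpace ℝ V] [CompleteSpace V]
  [NormedAddCommGroup H] [InnerProductSpace ℝ H] [CompleteSpace H]
  [NormedAddCommGroup U] [InnerProductSpace ℝ U] [CompleteSpace U]
  (W : DampedWave V H U)

/-- Initial data in the domain of the generator at time `c`. -/
def IsRegular (c : ℝ) (u₀ : V) (v₀ : H) : Prop :=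
  ∃ (y : V) (q : H), v₀ = W.emb y ∧
    u₀ + W.coeff c • W.obs.adjoint (W.obs y) = W.emb.adjoint q

/-- The orthogonal complement of the range of an adjoint is the kernel of the operator, and the
embedding is injective. -/
theorem denseRange_adjoint_emb : DenseRange W.emb.adjoint := by
  have h : (LinearMap.range (W.emb.adjoint : H →ₗ[ℝ] V)).topologicalClosure = ⊤ := by
    rw [Submodule.topologicalClosure_eq_top_iff, Submodule.eq_bot_iff]
    intro x hx
    rw [Submodule.mem_orthogonal] at hx
    have h1 := hx (W.emb.adjoint (W.emb x)) ⟨_, rfl⟩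
    rw [ContinuousLinearMap.adjoint_inner_left] at h1
    exact W.emb_injective (by rw [inner_self_eq_zero.mp h1, map_zero])
  rw [DenseRange, dense_iff_closure_eq]
  exact congrArg (fun s : Submodule ℝ V => (s : Set V)) h

/-- The velocity is approximated first, by some `y` in `V`. With `y` fixed, the compatibility
condition only asks that `u + b L*L y` lie in the dense range of the adjoint embedding, so the
displacement can be adjusted afterwards. -/
theorem exists_isRegular_near (c : ℝ) (u₀ : V) (v₀ : H) {ε : ℝ} (hε : 0 < ε) :
    ∃ u v, W.IsRegular c u v ∧ ‖u - u₀‖ < ε ∧ ‖v - v₀‖ < ε := by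
  obtain ⟨y, hy⟩ := W.emb_dense.exists_dist_lt v₀ hε
  obtain ⟨q, hq⟩ := W.denseRange_adjoint_emb.exists_dist_lt
    (u₀ + W.coeff c • W.obs.adjoint (W.obs y)) hε
  refine ⟨W.emb.adjoint q - W.coeff c • W.obs.adjoint (W.obs y), W.emb y,
    ⟨y, q, rfl, by abel⟩, ?_, by rw [← dist_eq_norm, dist_comm]; exact hy⟩
  rw [dist_comm, dist_eq_norm] at hq
  have e : W.emb.adjoint q - W.coeff c • W.obs.adjoint (W.obs y) - u₀ =
      W.emb.adjoint q - (u₀ + W.coeff c • W.obs.adjoint (W.obs y)) := by abel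
  rwa [e]

variable {W}

/-- The Yosida approximations are bounded on the domain of the generator. -/
theorem IsRegular.exists_bound {c : ℝ} {u₀ : V} {v₀ : H} (h : W.IsRegular c u₀ v₀) :
    ∃ M, ∀ μ : ℝ, 0 < μ → ‖W.vhat μ c (u₀, v₀)‖ ≤ M ∧ ‖W.accel μ c (u₀, v₀)‖ ≤ M := by
  obtain ⟨y, q, rfl, hq⟩ := h
  refine ⟨‖q‖ + 2 * ‖y‖, fun μ hμ => ?_⟩
  set w := W.vhat μ c (u₀, W.emb y) with hw
  set a := W.accel μ c (u₀, W.emb y) with ha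
  have e1 : W.emb (w - y) = μ • a := by
    rw [map_sub, hw, W.emb_vhat hμ, ← ha]; simp
  have e2 := W.inner_vhat hμ c (u₀, W.emb y) (w - y)
  rw [← hw] at e2
  have e3 : ⟪u₀, w - y⟫_ℝ = ⟪q, W.emb (w - y)⟫_ℝ - W.coeff c * ⟪W.obs y, W.obs (w - y)⟫_ℝ := by
    rw [eq_sub_of_add_eq hq, inner_sub_left, real_inner_smul_left,
      ContinuousLinearMap.adjoint_inner_left, ContinuousLinearMap.adjoint_inner_left]
  -- The resolvent equation tested with `w - y`. As `emb (w - y) = μ a`, every term except the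
  -- damping carries a factor `μ²`, and dividing by it leaves a bound free of `μ`.
  have e4 : ‖W.emb (w - y)‖ ^ 2 + μ ^ 2 * ‖w - y‖ ^ 2 + μ * W.coeff c * ‖W.obs (w - y)‖ ^ 2 =
      -(μ * ⟪q, W.emb (w - y)⟫_ℝ) - μ ^ 2 * ⟪y, w - y⟫_ℝ := by
    simp only [← real_inner_self_eq_norm_sq]
    have i1 : ⟪W.emb (w - y), W.emb (w - y)⟫_ℝ =
        ⟪W.emb w, W.emb (w - y)⟫_ℝ - ⟪W.emb y, W.emb (w - y)⟫_ℝ := by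
      rw [← inner_sub_left, ← map_sub]
    have i2 : ⟪W.obs (w - y), W.obs (w - y)⟫_ℝ =
        ⟪W.obs w, W.obs (w - y)⟫_ℝ - ⟪W.obs y, W.obs (w - y)⟫_ℝ := by
      rw [← inner_sub_left, ← map_sub]
    have i3 : ⟪w - y, w - y⟫_ℝ = ⟪w, w - y⟫_ℝ - ⟪y, w - y⟫_ℝ := inner_sub_left _ _ _
    rw [i1, i2, i3]
    simp only at e2
    rw [e3] at e2
    linear_combination e2
  rw [e1, norm_smul, Real.norm_eq_abs, abs_of_pos hμ, real_inner_smul_right] at e4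
  have e5 : ‖a‖ ^ 2 + ‖w - y‖ ^ 2 ≤ -⟪q, a⟫_ℝ - ⟪y, w - y⟫_ℝ := by
    have h1 : 0 ≤ μ * W.coeff c * ‖W.obs (w - y)‖ ^ 2 :=
      mul_nonneg (mul_nonneg hμ.le (W.coeff_nonneg c)) (sq_nonneg _)
    have h2 : μ ^ 2 * (‖a‖ ^ 2 + ‖w - y‖ ^ 2) ≤ μ ^ 2 * (-⟪q, a⟫_ℝ - ⟪y, w - y⟫_ℝ) := by
      nlinarith
    exact le_of_mul_le_mul_left h2 (by positivity)
  have e6 := (neg_le_abs _).trans (abs_real_inner_le_norm q a)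
  have e7 := (neg_le_abs _).trans (abs_real_inner_le_norm y (w - y))
  have e8 : ‖a‖ ^ 2 + ‖w - y‖ ^ 2 ≤ ‖q‖ ^ 2 + ‖y‖ ^ 2 := by
    nlinarith [sq_nonneg (‖q‖ - ‖a‖), sq_nonneg (‖y‖ - ‖w - y‖)]
  have hqy : 0 ≤ ‖q‖ * ‖y‖ := by positivity
  have e9 : ‖a‖ ≤ ‖q‖ + ‖y‖ := 
    (abs_le_of_sq_le_sq' (by nlinarith [sq_nonneg ‖w - y‖]) (by positivity)).2
  have e10 : ‖w - y‖ ≤ ‖q‖ + ‖y‖ := 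
    (abs_le_of_sq_le_sq' (by nlinarith [sq_nonneg ‖a‖]) (by positivity)).2
  have e11 : ‖w‖ ≤ ‖w - y‖ + ‖y‖ := by simpa using norm_add_le (w - y) y
  exact ⟨by linarith, by linarith [norm_nonneg y]⟩

namespace IsApprox

variable {μ c d : ℝ} {f : ℝ → H} {u : ℝ → V} {v : ℝ → H}

/-- Inversion is smooth at invertible operators, so the resolvent velocity is differentiable. Its
derivative is characterized by differentiating the equation `shifted w = ι* v - μ u` rather than the
inverse. -/
theorem hasDerivAt_vhat (hμ : 0 < μ) (h : W.IsApprox μ f c d u v) {t : ℝ} (ht : t ∈ Icc c d)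
    (hb : 0 < W.coeff t) : ∃ p, HasDerivAt (fun s => W.vhat μ s (u s, v s)) p t ∧
      W.shifted μ (W.coeff t) p =
        W.emb.adjoint (W.accel μ t (u t, v t) - W.pert t (v t) + f t) - μ • W.vhat μ t (u t, v t)
          - (μ * W.coeff' t) • W.obs.adjoint (W.obs (W.vhat μ t (u t, v t))) := by
  have hS := W.hasDerivAt_shifted μ (W.coeff_hasDerivAt t hb)
  have hr : HasDerivAt (fun s => W.emb.adjoint (v s) - μ • u s)
      (W.emb.adjoint (W.accel μ t (u t, v t) - W.pert t (v t) + f t)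
        - μ • W.vhat μ t (u t, v t)) t :=
    (W.emb.adjoint.hasFDerivAt.comp_hasDerivAt t (h.snd t ht)).sub ((h.fst t ht).const_smul μ)
  obtain ⟨x, hx⟩ := W.isUnit_shifted hμ (W.coeff_nonneg t)
  have hinv := hasFDerivAt_ringInverse (𝕜 := ℝ) x
  rw [hx] at hinv
  obtain ⟨p, hp⟩ : ∃ p, HasDerivAt (fun s => W.vhat μ s (u s, v s)) p t :=
    ⟨_, (HasFDerivAt.comp_hasDerivAt (f := fun s => W.shifted μ (W.coeff s)) t hinv hS).clm_apply hr⟩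
  refine ⟨p, hp, ?_⟩
  have h1 := hS.clm_apply hp
  have h2 : (fun s => W.shifted μ (W.coeff s) (W.vhat μ s (u s, v s))) =
      fun s => W.emb.adjoint (v s) - μ • u s := by
    ext s
    exact W.shifted_vhat hμ s (u s, v s)
  rw [h2] at h1
  exact eq_sub_of_add_eq' (h1.unique hr)

/-- The derivative of the energy of the time derivative. -/
theorem exists_hasDerivAt_energy_deriv (hμ : 0 < μ) (h : W.IsApprox μ f c d u v) {t : ℝ}
    (ht : t ∈ Icc c d) (hb : 0 < W.coeff t) {f' : H} (hf : HasDerivAt f f' t) :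
    ∃ y', HasDerivAt (fun s => ‖W.vhat μ s (u s, v s)‖ ^ 2
        + ‖W.accel μ s (u s, v s) - W.pert s (v s) + f s‖ ^ 2) y' t ∧
      y' ≤ W.coeff' t ^ 2 / (2 * W.coeff t) * ‖W.obs (W.vhat μ t (u t, v t))‖ ^ 2
        + 2 * ⟪W.accel μ t (u t, v t) - W.pert t (v t) + f t, f' - W.pert' t (v t)
          - W.pert t (W.accel μ t (u t, v t) - W.pert t (v t) + f t)⟫_ℝ := by
  obtain ⟨p, hp, hSp⟩ := h.hasDerivAt_vhat hμ ht hb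
  set q := W.accel μ t (u t, v t) - W.pert t (v t) + f t with hq
  set w := W.vhat μ t (u t, v t) with hw
  set g := f' - W.pert' t (v t) - W.pert t q with hg
  have hq' : HasDerivAt (fun s => W.accel μ s (u s, v s) - W.pert s (v s) + f s)
      (μ⁻¹ • (W.emb p - q) + g) t := by
    have h1 := (((W.emb.hasFDerivAt.comp_hasDerivAt t hp).sub (h.snd t ht)).const_smul μ⁻¹)
    have h2 := (h1.sub ((W.pert_hasDerivAt t).clm_apply (h.snd t ht))).add hf
    refine h2.congr_deriv ?_
    rw [hg]
    abel
  refine ⟨_, hp.norm_sq.add hq'.norm_sq, ?_⟩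
  rw [← hw, ← hq]
  -- `z` represents the functional `p ↦ ⟪q, ι p⟫ + μ ⟪w, p⟫` in the form of `shifted`. By symmetry
  -- this functional at `p` equals the right-hand side of the equation for `p` tested with `z`, so
  -- no bound on `p` itself is required.
  set z := W.vhat μ t (-w, q) with hz
  have a1 := W.inner_vhat hμ t (-w, q) p
  have a2 := W.inner_vhat hμ t (-w, q) z
  have a3 : ⟪W.shifted μ (W.coeff t) p, z⟫_ℝ = ⟪q, W.emb z⟫_ℝ - μ * ⟪w, z⟫_ℝ
      - μ * W.coeff' t * ⟪W.obs w, W.obs z⟫_ℝ := by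
    rw [hSp, inner_sub_left, inner_sub_left, real_inner_smul_left, real_inner_smul_left,
      ContinuousLinearMap.adjoint_inner_left, ContinuousLinearMap.adjoint_inner_left]
  rw [inner_shifted] at a3
  rw [← hz] at a1 a2
  simp only [real_inner_self_eq_norm_sq, inner_neg_left] at a1 a2
  rw [real_inner_comm, real_inner_comm z p, real_inner_comm (W.obs z)] at a3
  have a4 : μ * ⟪w, p⟫_ℝ + ⟪q, W.emb p⟫_ℝ = 2 * ⟪q, W.emb z⟫_ℝ - ‖W.emb z‖ ^ 2
      - μ ^ 2 * ‖z‖ ^ 2 - μ * W.coeff t * ‖W.obs z‖ ^ 2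
      - μ * W.coeff' t * ⟪W.obs w, W.obs z⟫_ℝ := by
    linarith
  have a5 : 2 * ⟪q, W.emb z⟫_ℝ ≤ ‖q‖ ^ 2 + ‖W.emb z‖ ^ 2 := by
    have := norm_sub_sq_real q (W.emb z)
    nlinarith [sq_nonneg ‖q - W.emb z‖]
  have a6 : ⟪w, p⟫_ℝ + μ⁻¹ * (⟪q, W.emb p⟫_ℝ - ‖q‖ ^ 2) ≤
      - W.coeff t * ‖W.obs z‖ ^ 2 - W.coeff' t * ⟪W.obs w, W.obs z⟫_ℝ := by
    have : μ * (⟪w, p⟫_ℝ + μ⁻¹ * (⟪q, W.emb p⟫_ℝ - ‖q‖ ^ 2)) ≤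
        μ * (- W.coeff t * ‖W.obs z‖ ^ 2 - W.coeff' t * ⟪W.obs w, W.obs z⟫_ℝ) := by
      have e : μ * (⟪w, p⟫_ℝ + μ⁻¹ * (⟪q, W.emb p⟫_ℝ - ‖q‖ ^ 2)) =
          μ * ⟪w, p⟫_ℝ + ⟪q, W.emb p⟫_ℝ - ‖q‖ ^ 2 := by
        field_simp
        ring
      rw [e]
      nlinarith [sq_nonneg (μ * ‖z‖)]
    exact le_of_mul_le_mul_left this hμ
  -- Young's inequality: the damping absorbs `L z` and leaves `b'² / (4b)` in front of `‖L w‖²`.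
  have a7 : - W.coeff t * ‖W.obs z‖ ^ 2 - W.coeff' t * ⟪W.obs w, W.obs z⟫_ℝ ≤
      W.coeff' t ^ 2 / (4 * W.coeff t) * ‖W.obs w‖ ^ 2 := by
    have h1 : - W.coeff' t * ⟪W.obs w, W.obs z⟫_ℝ ≤ |W.coeff' t| * (‖W.obs w‖ * ‖W.obs z‖) := by
      refine (le_abs_self _).trans ?_
      rw [abs_mul, abs_neg]
      exact mul_le_mul_of_nonneg_left (abs_real_inner_le_norm _ _) (abs_nonneg _)
    have h2 : W.coeff' t ^ 2 / (4 * W.coeff t) * ‖W.obs w‖ ^ 2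
        + W.coeff t * ‖W.obs z‖ ^ 2 - |W.coeff' t| * (‖W.obs w‖ * ‖W.obs z‖) =
        (|W.coeff' t| * ‖W.obs w‖ - 2 * W.coeff t * ‖W.obs z‖) ^ 2 / (4 * W.coeff t) := by
      rw [← sq_abs (W.coeff' t)]
      field_simp
      ring
    have h3 : 0 ≤ (|W.coeff' t| * ‖W.obs w‖ - 2 * W.coeff t * ‖W.obs z‖) ^ 2 / (4 * W.coeff t) := by
      positivity
    linarith
  have a8 : W.coeff' t ^ 2 / (2 * W.coeff t) = 2 * (W.coeff' t ^ 2 / (4 * W.coeff t)) := by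
    field_simp
    ring
  rw [a8, inner_add_right, real_inner_smul_right, inner_sub_right, real_inner_self_eq_norm_sq]
  linarith

end IsApprox

set_option maxHeartbeats 1000000 in
variable (W) in
/-- For regular data and a `C¹` source the generator stays bounded along the regularized
solutions, uniformly in the parameter. -/
theorem exists_bound_generator {c T : ℝ} (hcT : c ≤ T) (hb : ∀ t ∈ Icc c T, 0 < W.coeff t)
    {f f' : ℝ → H} (hf : ∀ t, HasDerivAt f (f' t) t) (hf' : Continuous f') {u₀ : V} {v₀ : H}
    (h₀ : W.IsRegular c u₀ v₀) :
    ∃ M, ∀ (μ : ℝ) (u : ℝ → V) (v : ℝ → H), 0 < μ → W.IsApprox μ f c T u v → u c = u₀ → v c = v₀ →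
      ∀ t ∈ Icc c T, ‖W.vhat μ t (u t, v t)‖ ≤ M ∧ ‖W.accel μ t (u t, v t)‖ ≤ M := by
  have hfc : Continuous f := continuous_iff_continuousAt.mpr fun t => (hf t).continuousAt
  have hc : c ∈ Icc c T := ⟨le_rfl, hcT⟩
  obtain ⟨K₁, hK₁0, hK₁⟩ := exists_norm_le_on_Icc (g := fun t => W.coeff' t ^ 2 / (2 * W.coeff t))
    ((W.coeff'_continuous.continuousOn.pow 2).div (continuousOn_const.mul
      W.coeff_continuous.continuousOn) fun t ht => (mul_pos two_pos (hb t ht)).ne')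
  obtain ⟨K₂, hK₂0, hK₂⟩ := exists_norm_le_on_Icc (c := c) (d := T) W.pert_continuous.continuousOn
  obtain ⟨K₃, hK₃0, hK₃⟩ := exists_norm_le_on_Icc (c := c) (d := T) W.pert'_continuous.continuousOn
  obtain ⟨K₄, hK₄0, hK₄⟩ := exists_norm_le_on_Icc (c := c) (d := T) hfc.continuousOn
  obtain ⟨K₅, hK₅0, hK₅⟩ := exists_norm_le_on_Icc (c := c) (d := T) hf'.continuousOn
  obtain ⟨M₀, hM₀⟩ := h₀.exists_bound
  have hM₀0 : 0 ≤ M₀ := (norm_nonneg _).trans (hM₀ 1 one_pos).1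
  set E : ℝ := Real.exp ((2 * K₂ + 1) * (T - c)) * (‖u₀‖ ^ 2 + ‖v₀‖ ^ 2 + K₄ ^ 2 * (T - c)) with hE
  have hE0 : 0 ≤ E := by
    have : 0 ≤ T - c := by linarith
    positivity
  set N : ℝ := √E with hN
  -- The growth rate collects the variable coefficient (`K₁`), the bounded perturbation (`2 K₂`) and
  -- a `1` from Young's inequality for the inhomogeneity.
  set L : ℝ := K₁ * ‖W.obs‖ ^ 2 + 2 * K₂ + 1 with hL
  have hL0 : 0 ≤ L := by positivity
  set Y₀ : ℝ := M₀ ^ 2 + (M₀ + K₂ * ‖v₀‖ + K₄) ^ 2 with hY₀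
  set B : ℝ := Real.exp (L * (T - c)) * (Y₀ + (K₅ + K₃ * N) ^ 2 * (T - c)) with hB
  have hB0 : 0 ≤ B := by
    have : 0 ≤ T - c := by linarith
    positivity
  refine ⟨√B + K₂ * N + K₄, fun μ u v hμ h hu hv t ht => ?_⟩
  have hvN : ∀ s ∈ Icc c T, ‖v s‖ ≤ N := by
    intro s hs
    have h1 := h.energy_le hμ hK₂0 hK₂ hK₄ s hs
    have h2 : Real.exp ((2 * K₂ + 1) * (s - c)) * (‖u c‖ ^ 2 + ‖v c‖ ^ 2 + K₄ ^ 2 * (s - c)) ≤ E := by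
      rw [hE, hu, hv]
      have i1 : s - c ≤ T - c := by linarith [hs.2]
      have i2 : 0 ≤ s - c := by linarith [hs.1]
      gcongr
    refine Real.le_sqrt_of_sq_le ?_
    nlinarith [sq_nonneg ‖u s‖]
  set w : ℝ → V := fun s => W.vhat μ s (u s, v s) with hw
  set q : ℝ → H := fun s => W.accel μ s (u s, v s) - W.pert s (v s) + f s with hq
  have hder : ∀ s, ∃ y', s ∈ Icc c T →
      HasDerivAt (fun s => ‖w s‖ ^ 2 + ‖q s‖ ^ 2) y' s ∧
        y' ≤ L * (‖w s‖ ^ 2 + ‖q s‖ ^ 2) + (K₅ + K₃ * N) ^ 2 := by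
    intro s
    by_cases hs : s ∈ Icc c T
    · obtain ⟨y', h1, h2⟩ := h.exists_hasDerivAt_energy_deriv hμ hs (hb s hs) (hf s)
      refine ⟨y', fun _ => ⟨h1, h2.trans ?_⟩⟩
      have i1 : W.coeff' s ^ 2 / (2 * W.coeff s) * ‖W.obs (w s)‖ ^ 2 ≤
          K₁ * ‖W.obs‖ ^ 2 * ‖w s‖ ^ 2 := by
        have j1 := (le_abs_self _).trans (hK₁ s hs)
        have j2 : ‖W.obs (w s)‖ ^ 2 ≤ ‖W.obs‖ ^ 2 * ‖w s‖ ^ 2 := by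
          rw [← mul_pow]
          exact pow_le_pow_left₀ (norm_nonneg _) (W.obs.le_opNorm _) 2
        rw [mul_assoc]
        exact mul_le_mul j1 j2 (sq_nonneg _) hK₁0
      have i2 : ‖f' s - W.pert' s (v s) - W.pert s (q s)‖ ≤ K₅ + K₃ * N + K₂ * ‖q s‖ := by
        refine (norm_sub_le _ _).trans (add_le_add ((norm_sub_le _ _).trans
          (add_le_add (hK₅ s hs) ?_)) ?_)
        · exact ((W.pert' s).le_opNorm _).trans
            (mul_le_mul (hK₃ s hs) (hvN s hs) (norm_nonneg _) hK₃0)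
        · exact ((W.pert s).le_opNorm _).trans
            (mul_le_mul_of_nonneg_right (hK₂ s hs) (norm_nonneg _))
      have i3 := (real_inner_le_norm (q s) (f' s - W.pert' s (v s) - W.pert s (q s))).trans
        (mul_le_mul_of_nonneg_left i2 (norm_nonneg _))
      have i4 : 2 * (‖q s‖ * (K₅ + K₃ * N)) ≤ ‖q s‖ ^ 2 + (K₅ + K₃ * N) ^ 2 := by
        nlinarith [sq_nonneg (‖q s‖ - (K₅ + K₃ * N))]
      have i5 : 0 ≤ (2 * K₂ + 1) * ‖w s‖ ^ 2 + K₁ * ‖W.obs‖ ^ 2 * ‖q s‖ ^ 2 := by positivity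
      change W.coeff' s ^ 2 / (2 * W.coeff s) * ‖W.obs (w s)‖ ^ 2
        + 2 * ⟪q s, f' s - W.pert' s (v s) - W.pert s (q s)⟫_ℝ ≤ _
      rw [hL]
      linarith
    · exact ⟨0, fun h => absurd h hs⟩
  choose y' hy' using hder
  have hY := le_exp_mul_of_hasDerivAt hL0 (sq_nonneg (K₅ + K₃ * N)) (fun s hs => (hy' s hs).1)
    (fun s hs => (hy' s hs).2) t ht
  have hY₀' : ‖w c‖ ^ 2 + ‖q c‖ ^ 2 ≤ Y₀ := by
    have h1 := hM₀ μ hμ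
    have h2 : ‖q c‖ ≤ M₀ + K₂ * ‖v₀‖ + K₄ := by
      simp only [hq]
      rw [hu, hv]
      refine (norm_add_le _ _).trans (add_le_add ((norm_sub_le _ _).trans (add_le_add h1.2 ?_))
        (hK₄ c hc))
      exact ((W.pert c).le_opNorm _).trans (mul_le_mul_of_nonneg_right (hK₂ c hc) (norm_nonneg _))
    have h3 : ‖w c‖ ≤ M₀ := by
      simp only [hw]
      rw [hu, hv]
      exact h1.1
    rw [hY₀]
    gcongr
  have hYB : ‖w t‖ ^ 2 + ‖q t‖ ^ 2 ≤ B := by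
    refine hY.trans ?_
    rw [hB]
    have i1 : t - c ≤ T - c := by linarith [ht.2]
    have i2 : 0 ≤ t - c := by linarith [ht.1]
    gcongr
  have hKN : 0 ≤ K₂ * N := mul_nonneg hK₂0 (Real.sqrt_nonneg _)
  have hwB : ‖w t‖ ≤ √B := Real.le_sqrt_of_sq_le (by nlinarith [sq_nonneg ‖q t‖])
  have hqB : ‖q t‖ ≤ √B := Real.le_sqrt_of_sq_le (by nlinarith [sq_nonneg ‖w t‖])
  refine ⟨by linarith, ?_⟩
  have e : W.accel μ t (u t, v t) = q t + W.pert t (v t) - f t := by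
    simp only [hq]; abel
  rw [e]
  refine (norm_sub_le _ _).trans (add_le_add ((norm_add_le _ _).trans (add_le_add hqB ?_))
    (hK₄ t ht))
  exact ((W.pert t).le_opNorm _).trans
    (mul_le_mul (hK₂ t ht) (hvN t ht) (norm_nonneg _) hK₂0)

end DampedWave

end IntermittentDelay

/-! ### Convergence of the regularized solutions. -/

namespace IntermittentDelay

/-- A continuous function is a uniform limit, on a compact interval, of `C¹` functions. -/
theorem exists_C1_near {E : Type*} [NormedAddCommGroup E] [NormedSpace ℝ E] [CompleteSpace E]
    {f : ℝ → E} (hf : Continuous f) (c d : ℝ) {ε : ℝ} (hε : 0 < ε) :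
    ∃ g g' : ℝ → E, (∀ t, HasDerivAt g (g' t) t) ∧ Continuous g' ∧
      ∀ t ∈ Icc c d, ‖g t - f t‖ ≤ ε := by
  have huc := isCompact_Icc.uniformContinuousOn_of_continuous
    (hf.continuousOn (s := Icc c (d + 1)))
  obtain ⟨δ, hδ, hδf⟩ := Metric.uniformContinuousOn_iff_le.mp huc ε hε
  -- The approximation is the mean of `f` over `[t, t + h]`. The bound `h ≤ 1` keeps this interval
  -- inside `[c, d + 1]`, on which the modulus of continuity was taken.
  set h := min δ 1 with hh
  have hh0 : 0 < h := lt_min hδ one_pos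
  refine ⟨fun t => h⁻¹ • ((∫ s in (0 : ℝ)..(t + h), f s) - ∫ s in (0 : ℝ)..t, f s),
    fun t => h⁻¹ • (f (t + h) - f t), fun t => ?_, by fun_prop, fun t ht => ?_⟩
  · have hd : ∀ x, HasDerivAt (fun t => ∫ s in (0 : ℝ)..t, f s) (f x) x := fun x =>
      intervalIntegral.integral_hasDerivAt_right (hf.intervalIntegrable _ _)
        (hf.stronglyMeasurableAtFilter _ _) hf.continuousAt
    exact (((hd (t + h)).comp_add_const t h).sub (hd t)).const_smul h⁻¹
  · have e1 : (∫ s in (0 : ℝ)..(t + h), f s) - ∫ s in (0 : ℝ)..t, f s = ∫ s in t..(t + h), f s :=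
      intervalIntegral.integral_interval_sub_left (hf.intervalIntegrable _ _)
        (hf.intervalIntegrable _ _)
    have e2 : h⁻¹ • (∫ s in t..(t + h), f s) - f t = h⁻¹ • ∫ s in t..(t + h), (f s - f t) := by
      rw [intervalIntegral.integral_sub (hf.intervalIntegrable _ _) intervalIntegrable_const,
        intervalIntegral.integral_const, smul_sub, smul_smul]
      simp [hh0.ne']
    beta_reduce
    rw [e1, e2, norm_smul, Real.norm_eq_abs, abs_of_pos (inv_pos.mpr hh0)]
    have e3 : ‖∫ s in t..(t + h), (f s - f t)‖ ≤ ε * |t + h - t| := by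
      refine intervalIntegral.norm_integral_le_of_norm_le_const fun s hs => ?_
      rw [uIoc_of_le (by linarith)] at hs
      have h1 : h ≤ 1 := min_le_right _ _
      rw [← dist_eq_norm]
      refine hδf s ⟨by linarith [ht.1, hs.1], by linarith [ht.2, hs.2]⟩ t
        ⟨ht.1, by linarith [ht.2]⟩ ?_
      rw [Real.dist_eq, abs_of_pos (by linarith [hs.1])]
      have h2 : h ≤ δ := min_le_left _ _
      linarith [hs.2]
    rw [add_sub_cancel_left, abs_of_pos hh0] at e3
    calc h⁻¹ * _ ≤ h⁻¹ * (ε * h) := by gcongr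
      _ = ε := by field_simp

namespace DampedWave

set_option linter.unusedSectionVars false

variable {V H U : Type*} [NormedAddCommGroup V] [InnerProductSpace ℝ V] [CompleteSpace V]
  [NormedAddCommGroup H] [InnerProductSpace ℝ H] [CompleteSpace H]
  [NormedAddCommGroup U] [InnerProductSpace ℝ U] [CompleteSpace U]
  (W : DampedWave V H U)

/-- Along regular approximations the generators are bounded by a common `M`, so the difference of
two of them is dissipative up to `4 (μ + ν) M²`. Gronwall leaves an error proportional to `μ + ν`.
-/
theorem cauchy_of_isRegular {c T : ℝ} (hcT : c ≤ T) (hb : ∀ t ∈ Icc c T, 0 < W.coeff t)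
    {f f' : ℝ → H} (hf : ∀ t, HasDerivAt f (f' t) t) (hf' : Continuous f') {u₀ : V} {v₀ : H}
    (h₀ : W.IsRegular c u₀ v₀) {ε : ℝ} (hε : 0 < ε) :
    ∃ δ > 0, ∀ (μ ν : ℝ) (u₁ u₂ : ℝ → V) (v₁ v₂ : ℝ → H), 0 < μ → μ < δ → 0 < ν → ν < δ →
      W.IsApprox μ f c T u₁ v₁ → W.IsApprox ν f c T u₂ v₂ → u₁ c = u₀ → v₁ c = v₀ →
      u₂ c = u₀ → v₂ c = v₀ → ∀ t ∈ Icc c T, ‖u₁ t - u₂ t‖ ^ 2 + ‖v₁ t - v₂ t‖ ^ 2 ≤ ε := by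
  obtain ⟨M, hM⟩ := W.exists_bound_generator hcT hb hf hf' h₀
  obtain ⟨K, hK0, hK⟩ := exists_norm_le_on_Icc (c := c) (d := T) W.pert_continuous.continuousOn
  -- The squared norms double the error to `8 (μ + ν) M²`, and `μ + ν` is at most twice the
  -- threshold below.
  set C : ℝ := Real.exp (2 * K * (T - c)) * (16 * M ^ 2 * (T - c)) with hC
  have hC0 : 0 ≤ C := by
    have : 0 ≤ T - c := by linarith
    positivity
  refine ⟨ε / (C + 1), by positivity, ?_⟩
  intro μ ν u₁ u₂ v₁ v₂ hμ hμδ hν hνδ h₁ h₂ hu₁ hv₁ hu₂ hv₂ t ht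
  have hder : ∀ s ∈ Icc c T, HasDerivAt (fun s => ‖u₁ s - u₂ s‖ ^ 2 + ‖v₁ s - v₂ s‖ ^ 2)
      (2 * ⟪u₁ s - u₂ s, W.vhat μ s (u₁ s, v₁ s) - W.vhat ν s (u₂ s, v₂ s)⟫_ℝ
        + 2 * ⟪v₁ s - v₂ s, (W.accel μ s (u₁ s, v₁ s) - W.pert s (v₁ s) + f s)
          - (W.accel ν s (u₂ s, v₂ s) - W.pert s (v₂ s) + f s)⟫_ℝ) s := fun s hs =>
    ((h₁.fst s hs).sub (h₂.fst s hs)).norm_sq.add ((h₁.snd s hs).sub (h₂.snd s hs)).norm_sq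
  have hle := le_exp_mul_of_hasDerivAt (K := 2 * K) (ε := 8 * (μ + ν) * M ^ 2) (by positivity)
    (by positivity) hder (fun s hs => by
      obtain ⟨m1, m2⟩ := hM μ u₁ v₁ hμ h₁ hu₁ hv₁ s hs
      obtain ⟨m3, m4⟩ := hM ν u₂ v₂ hν h₂ hu₂ hv₂ s hs
      have h3 := W.inner_generator_sub_le hμ hν s (u₁ s, v₁ s) (u₂ s, v₂ s) m1 m3 m2 m4
      have h4 : (W.accel μ s (u₁ s, v₁ s) - W.pert s (v₁ s) + f s)
          - (W.accel ν s (u₂ s, v₂ s) - W.pert s (v₂ s) + f s) =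
          (W.accel μ s (u₁ s, v₁ s) - W.accel ν s (u₂ s, v₂ s)) - W.pert s (v₁ s - v₂ s) := by
        rw [map_sub]; abel
      rw [h4, inner_sub_right (𝕜 := ℝ) (v₁ s - v₂ s) (_ - _)]
      have h5 : -⟪v₁ s - v₂ s, W.pert s (v₁ s - v₂ s)⟫_ℝ ≤ K * ‖v₁ s - v₂ s‖ ^ 2 := by
        refine (neg_le_abs _).trans ((abs_real_inner_le_norm _ _).trans ?_)
        have := ((W.pert s).le_opNorm (v₁ s - v₂ s)).trans
          (mul_le_mul_of_nonneg_right (hK s hs) (norm_nonneg _))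
        nlinarith [norm_nonneg (v₁ s - v₂ s)]
      have h6 : 0 ≤ K * ‖u₁ s - u₂ s‖ ^ 2 := by positivity
      simp only at h3
      linarith) t ht
  rw [hu₁, hu₂, hv₁, hv₂, sub_self, sub_self, norm_zero, norm_zero] at hle
  have hμν : μ + ν ≤ 2 * (ε / (C + 1)) := by linarith
  calc _ ≤ _ := hle
    _ = Real.exp (2 * K * (t - c)) * (8 * (μ + ν) * M ^ 2 * (t - c)) := by ring
    _ ≤ Real.exp (2 * K * (T - c)) * (8 * (2 * (ε / (C + 1))) * M ^ 2 * (T - c)) := by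
        have i1 : t - c ≤ T - c := by linarith [ht.2]
        have i2 : 0 ≤ t - c := by linarith [ht.1]
        gcongr
    _ = C * (ε / (C + 1)) := by rw [hC]; ring
    _ ≤ (C + 1) * (ε / (C + 1)) := by
        refine mul_le_mul_of_nonneg_right (by linarith) (by positivity)
    _ = ε := by field_simp

theorem norm_sq_sub_le_three {E : Type*} [NormedAddCommGroup E] (a b c d : E) :
    ‖a - d‖ ^ 2 ≤ 3 * (‖a - b‖ ^ 2 + ‖b - c‖ ^ 2 + ‖c - d‖ ^ 2) := by
  have h : ‖a - d‖ ≤ ‖a - b‖ + ‖b - c‖ + ‖c - d‖ := by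
    have e : a - d = (a - b) + (b - c) + (c - d) := by abel
    rw [e]
    exact norm_add₃_le
  have h1 : ‖a - d‖ ^ 2 ≤ (‖a - b‖ + ‖b - c‖ + ‖c - d‖) ^ 2 :=
    pow_le_pow_left₀ (norm_nonneg _) h 2
  nlinarith [sq_nonneg (‖a - b‖ - ‖b - c‖), sq_nonneg (‖a - b‖ - ‖c - d‖),
    sq_nonneg (‖b - c‖ - ‖c - d‖)]

/-- The regularized solutions are uniformly Cauchy where the damping coefficient is positive. -/
theorem cauchy {c T : ℝ} (hcT : c ≤ T) (hb : ∀ t ∈ Icc c T, 0 < W.coeff t)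
    {f : ℝ → H} (hf : Continuous f) (u₀ : V) (v₀ : H) {ε : ℝ} (hε : 0 < ε) :
    ∃ δ > 0, ∀ (μ ν : ℝ) (u₁ u₂ : ℝ → V) (v₁ v₂ : ℝ → H), 0 < μ → μ < δ → 0 < ν → ν < δ →
      W.IsApprox μ f c T u₁ v₁ → W.IsApprox ν f c T u₂ v₂ → u₁ c = u₀ → v₁ c = v₀ →
      u₂ c = u₀ → v₂ c = v₀ → ∀ t ∈ Icc c T, ‖u₁ t - u₂ t‖ ^ 2 + ‖v₁ t - v₂ t‖ ^ 2 ≤ ε := by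
  obtain ⟨K, hK0, hK⟩ := exists_norm_le_on_Icc (c := c) (d := T) W.pert_continuous.continuousOn
  set C : ℝ := Real.exp ((2 * K + 1) * (T - c)) * (2 + (T - c)) with hC
  have hTc : 0 ≤ T - c := by linarith
  have hC0 : 0 < C := by positivity
  -- With data and source perturbed by at most `η`, passing to the regular problem costs `ε / 9`.
  -- Two such passages and the regular comparison, through `norm_sq_sub_le_three`, add up to `ε`.
  set η : ℝ := √(ε / (9 * C)) with hη
  have hη0 : 0 < η := Real.sqrt_pos.mpr (by positivity)
  have hη2 : C * η ^ 2 = ε / 9 := by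
    rw [hη, Real.sq_sqrt (by positivity)]
    field_simp
  obtain ⟨g, g', hg, hg', hgf⟩ := exists_C1_near hf c T hη0
  have hgc : Continuous g := continuous_iff_continuousAt.mpr fun t => (hg t).continuousAt
  obtain ⟨a, b, hab, ha, hb'⟩ := W.exists_isRegular_near c u₀ v₀ hη0
  obtain ⟨δ, hδ, hδ'⟩ := W.cauchy_of_isRegular hcT hb hg hg' hab (ε := ε / 9) (by positivity)
  have close : ∀ (μ : ℝ) (u u' : ℝ → V) (v v' : ℝ → H), 0 < μ → W.IsApprox μ f c T u v →
      W.IsApprox μ g c T u' v' → u c = u₀ → v c = v₀ → u' c = a → v' c = b →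
      ∀ t ∈ Icc c T, ‖u' t - u t‖ ^ 2 + ‖v' t - v t‖ ^ 2 ≤ ε / 9 := by
    intro μ u u' v v' hμ h h' e1 e2 e3 e4 t ht
    have h1 := (h'.sub h).energy_le hμ hK0 hK (ε := η) (fun t ht => hgf t ht) t ht
    simp only [Pi.sub_apply, e1, e2, e3, e4] at h1
    refine h1.trans ?_
    calc _ ≤ Real.exp ((2 * K + 1) * (T - c)) * (η ^ 2 + η ^ 2 + η ^ 2 * (T - c)) := by
          have i1 : t - c ≤ T - c := by linarith [ht.2]
          have i2 : 0 ≤ t - c := by linarith [ht.1]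
          gcongr
      _ = C * η ^ 2 := by rw [hC]; ring
      _ = ε / 9 := hη2
  refine ⟨δ, hδ, ?_⟩
  intro μ ν u₁ u₂ v₁ v₂ hμ hμδ hν hνδ h₁ h₂ hu₁ hv₁ hu₂ hv₂ t ht
  obtain ⟨x₁, y₁, hx₁, hx₁u, hx₁v⟩ := W.exists_isApprox hμ hgc hcT a b
  obtain ⟨x₂, y₂, hx₂, hx₂u, hx₂v⟩ := W.exists_isApprox hν hgc hcT a b
  have i1 := close μ u₁ x₁ v₁ y₁ hμ h₁ hx₁ hu₁ hv₁ hx₁u hx₁v t ht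
  have i2 := close ν u₂ x₂ v₂ y₂ hν h₂ hx₂ hu₂ hv₂ hx₂u hx₂v t ht
  have i3 := hδ' μ ν x₁ x₂ y₁ y₂ hμ hμδ hν hνδ hx₁ hx₂ hx₁u hx₁v hx₂u hx₂v t ht
  have j1 := norm_sq_sub_le_three (u₁ t) (x₁ t) (x₂ t) (u₂ t)
  have j2 := norm_sq_sub_le_three (v₁ t) (y₁ t) (y₂ t) (v₂ t)
  rw [norm_sub_rev (u₁ t) (x₁ t)] at j1
  rw [norm_sub_rev (v₁ t) (y₁ t)] at j2
  linarith

end DampedWave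

end IntermittentDelay

/-! ### The integrated weak form and passage to the limit. -/

namespace IntermittentDelay

open Filter Topology in
/-- Passage to the limit in the fundamental theorem of calculus. -/
theorem sub_eq_integral_of_tendsto {E : Type*} [NormedAddCommGroup E] [NormedSpace ℝ E]
    [CompleteSpace E] {c T B : ℝ} {μ : ℕ → ℝ} (hμ0 : Tendsto μ atTop (𝓝 0))
    {φ g r : ℕ → ℝ → E} {φ₀ g₀ : ℝ → E}
    (hφ : ∀ k, ∀ t ∈ Icc c T, HasDerivAt (φ k) (g k t + μ k • r k t) t)
    (hφ₀ : ∀ t ∈ Icc c T, Tendsto (fun k => φ k t) atTop (𝓝 (φ₀ t)))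
    (hg₀ : ∀ t ∈ Icc c T, Tendsto (fun k => g k t) atTop (𝓝 (g₀ t)))
    (hg : ∀ k, ContinuousOn (g k) (Icc c T)) (hr : ∀ k, ContinuousOn (r k) (Icc c T))
    (hgB : ∀ k, ∀ t ∈ Icc c T, ‖g k t‖ ≤ B) (hrB : ∀ k, ∀ t ∈ Icc c T, ‖r k t‖ ≤ B) :
    ∀ t ∈ Icc c T, φ₀ t - φ₀ c = ∫ s in c..t, g₀ s := by
  intro t ht
  have hc : c ∈ Icc c T := ⟨le_rfl, ht.1.trans ht.2⟩
  have hsub : uIcc c t ⊆ Icc c T := by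
    rw [uIcc_of_le ht.1]; exact Icc_subset_Icc_right ht.2
  have hsub' : ∀ s ∈ uIoc c t, s ∈ Icc c T := fun s hs => hsub (uIoc_subset_uIcc hs)
  have hcont : ∀ k, ContinuousOn (fun s => g k s + μ k • r k s) (uIcc c t) := fun k =>
    ((hg k).add ((hr k).const_smul (μ k))).mono hsub
  have h1 : ∀ k, φ k t - φ k c = ∫ s in c..t, (g k s + μ k • r k s) := fun k =>
    (intervalIntegral.integral_eq_sub_of_hasDerivAt (fun s hs => hφ k s (hsub hs))
      (hcont k).intervalIntegrable).symm
  have hμr : ∀ s ∈ Icc c T, Tendsto (fun k => μ k • r k s) atTop (𝓝 0) := by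
    intro s hs
    refine squeeze_zero_norm (a := fun k => |μ k| * B) (fun k => ?_) ?_
    · rw [norm_smul, Real.norm_eq_abs]
      exact mul_le_mul_of_nonneg_left (hrB k s hs) (abs_nonneg _)
    · have := (hμ0.abs).mul_const B
      simpa using this
  obtain ⟨m, hm⟩ := (hμ0.abs.bddAbove_range)
  have h2 : Tendsto (fun k => ∫ s in c..t, (g k s + μ k • r k s)) atTop
      (𝓝 (∫ s in c..t, g₀ s)) := by
    refine intervalIntegral.tendsto_integral_filter_of_dominated_convergence
      (fun _ => B + m * B) ?_ ?_ intervalIntegrable_const ?_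
    · refine Eventually.of_forall fun k => ?_
      exact ((hcont k).mono uIoc_subset_uIcc).aestronglyMeasurable measurableSet_uIoc
    · refine Eventually.of_forall fun k => Eventually.of_forall fun s hs => ?_
      have hB : 0 ≤ B := (norm_nonneg _).trans (hrB k s (hsub' s hs))
      refine (norm_add_le _ _).trans (add_le_add (hgB k s (hsub' s hs)) ?_)
      rw [norm_smul, Real.norm_eq_abs]
      exact mul_le_mul (hm ⟨k, rfl⟩) (hrB k s (hsub' s hs)) (norm_nonneg _)
        ((abs_nonneg _).trans (hm ⟨k, rfl⟩))
    · refine Eventually.of_forall fun s hs => ?_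
      simpa using (hg₀ s (hsub' s hs)).add (hμr s (hsub' s hs))
  refine tendsto_nhds_unique ((hφ₀ t ht).sub (hφ₀ c hc)) ?_
  simpa only [h1] using h2

namespace DampedWave

set_option linter.unusedSectionVars false

variable {V H U : Type*} [NormedAddCommGroup V] [InnerProductSpace ℝ V] [CompleteSpace V]
  [NormedAddCommGroup H] [InnerProductSpace ℝ H] [CompleteSpace H]
  [NormedAddCommGroup U] [InnerProductSpace ℝ U] [CompleteSpace U]
  (W : DampedWave V H U)

/-- The functional `v + b L* L u + D u` at the test vector `z`. -/
noncomputable def momentum (t : ℝ) (x : V) (y : H) (z : V) : ℝ :=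
  ⟪y, W.emb z⟫_ℝ + W.coeff t * ⟪W.obs x, W.obs z⟫_ℝ + ⟪W.pert t (W.emb x), W.emb z⟫_ℝ

/-- The functional `-A u + b' L* L u + D' u` at the test vector `z`; up to the source this is the
time derivative of the momentum. -/
noncomputable def force (t : ℝ) (x z : V) : ℝ :=
  -⟪x, z⟫_ℝ + W.coeff' t * ⟪W.obs x, W.obs z⟫_ℝ + ⟪W.pert' t (W.emb x), W.emb z⟫_ℝ

/-- The integrated weak form of the equation on `[c, d]`. -/
structure IsWeak (f : ℝ → H) (c d : ℝ) (u : ℝ → V) (v : ℝ → H) : Prop where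
  continuousOn_fst : ContinuousOn u (Icc c d)
  continuousOn_snd : ContinuousOn v (Icc c d)
  displacement : ∀ t ∈ Icc c d, W.emb (u t) - W.emb (u c) = ∫ s in c..t, v s
  balance : ∀ t ∈ Icc c d, ∀ z, W.momentum t (u t) (v t) z - W.momentum c (u c) (v c) z =
    ∫ s in c..t, (W.force s (u s) z + ⟪f s, W.emb z⟫_ℝ)

-- The correction of order `μ` is chosen so that all contributions of `vhat` and `accel` cancel: for
-- general data these are not bounded uniformly in `μ`. What remains is the force plus `μ` times a
-- quantity controlled by the energy alone.
variable {W} in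
theorem IsApprox.hasDerivAt_momentum {μ c d : ℝ} {f : ℝ → H} {u : ℝ → V} {v : ℝ → H}
    (hμ : 0 < μ) (h : W.IsApprox μ f c d u v) {t : ℝ} (ht : t ∈ Icc c d) (hb : 0 < W.coeff t)
    (z : V) :
    HasDerivAt (fun t => W.momentum t (u t) (v t) z + μ * (⟪u t, z⟫_ℝ - ⟪W.pert t (v t), W.emb z⟫_ℝ))
      ((W.force t (u t) z + ⟪f t, W.emb z⟫_ℝ) + μ * (⟪W.pert t (W.pert t (v t) - f t), W.emb z⟫_ℝ
        - ⟪W.pert' t (v t), W.emb z⟫_ℝ)) t := by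
  have hu := h.fst t ht
  have hv := h.snd t ht
  have hD := W.pert_hasDerivAt t
  have k1 := hv.inner ℝ (hasDerivAt_const t (W.emb z))
  have k2 := (W.coeff_hasDerivAt t hb).mul ((W.obs.hasFDerivAt.comp_hasDerivAt t hu).inner ℝ
    (hasDerivAt_const t (W.obs z)))
  have k3 := (hD.clm_apply (W.emb.hasFDerivAt.comp_hasDerivAt t hu)).inner ℝ
    (hasDerivAt_const t (W.emb z))
  have k4 := (hu.inner ℝ (hasDerivAt_const t z)).sub ((hD.clm_apply hv).inner ℝ
    (hasDerivAt_const t (W.emb z)))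
  refine (((k1.add k2).add k3).add (k4.const_mul μ)).congr_deriv ?_
  have e1 := W.inner_accel hμ t (u t, v t) z
  have e2 := W.emb_vhat hμ t (u t, v t)
  simp only [inner_zero_right, Function.comp_apply, e2, map_add, map_sub, map_smul, inner_add_left,
    inner_sub_left, real_inner_smul_left, e1, force]
  ring

variable {W} in
theorem IsApprox.hasDerivAt_displacement {μ c d : ℝ} {f : ℝ → H} {u : ℝ → V} {v : ℝ → H}
    (hμ : 0 < μ) (h : W.IsApprox μ f c d u v) {t : ℝ} (ht : t ∈ Icc c d) :
    HasDerivAt (fun t => W.emb (u t) - μ • v t) (v t + μ • (W.pert t (v t) - f t)) t := by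
  refine ((W.emb.hasFDerivAt.comp_hasDerivAt t (h.fst t ht)).sub
    ((h.snd t ht).const_smul μ)).congr_deriv ?_
  rw [W.emb_vhat hμ]
  module

-- The corrected momentum and displacement satisfy the fundamental theorem of calculus with
-- integrands bounded by the energy; dominated convergence then gives both integral identities.
open Filter Topology in
theorem isWeak_of_tendsto {c T N : ℝ} (hb : ∀ t ∈ Icc c T, 0 < W.coeff t) {f : ℝ → H}
    (hf : Continuous f) {μ : ℕ → ℝ} (hμ : ∀ k, 0 < μ k) (hμ0 : Tendsto μ atTop (𝓝 0))
    {u : ℕ → ℝ → V} {v : ℕ → ℝ → H} {u₀ : ℝ → V} {v₀ : ℝ → H}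
    (h : ∀ k, W.IsApprox (μ k) f c T (u k) (v k))
    (huN : ∀ k, ∀ t ∈ Icc c T, ‖u k t‖ ≤ N) (hvN : ∀ k, ∀ t ∈ Icc c T, ‖v k t‖ ≤ N)
    (hu : ∀ t ∈ Icc c T, Tendsto (fun k => u k t) atTop (𝓝 (u₀ t)))
    (hv : ∀ t ∈ Icc c T, Tendsto (fun k => v k t) atTop (𝓝 (v₀ t)))
    (hu₀ : ContinuousOn u₀ (Icc c T)) (hv₀ : ContinuousOn v₀ (Icc c T)) :
    W.IsWeak f c T u₀ v₀ := by
  obtain ⟨K₁, hK₁0, hK₁⟩ := exists_norm_le_on_Icc (c := c) (d := T) W.coeff'_continuous.continuousOn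
  obtain ⟨K₂, hK₂0, hK₂⟩ := exists_norm_le_on_Icc (c := c) (d := T) W.pert_continuous.continuousOn
  obtain ⟨K₃, hK₃0, hK₃⟩ := exists_norm_le_on_Icc (c := c) (d := T) W.pert'_continuous.continuousOn
  obtain ⟨K₄, hK₄0, hK₄⟩ := exists_norm_le_on_Icc (c := c) (d := T) hf.continuousOn
  have hcu : ∀ k, ContinuousOn (u k) (Icc c T) := fun k t ht =>
    ((h k).fst t ht).continuousAt.continuousWithinAt
  have hcv : ∀ k, ContinuousOn (v k) (Icc c T) := fun k t ht =>
    ((h k).snd t ht).continuousAt.continuousWithinAt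
  have hD := W.pert_continuous.continuousOn (s := Icc c T)
  have hD' := W.pert'_continuous.continuousOn (s := Icc c T)
  have hb' := W.coeff'_continuous.continuousOn (s := Icc c T)
  have hfc := hf.continuousOn (s := Icc c T)
  have hN : ∀ t ∈ Icc c T, 0 ≤ N := fun t ht => (norm_nonneg _).trans (huN 0 t ht)
  have hr : ∀ k, ∀ t ∈ Icc c T, ‖W.pert t (v k t) - f t‖ ≤ K₂ * N + K₄ := fun k t ht =>
    (norm_sub_le _ _).trans (add_le_add (((W.pert t).le_opNorm _).trans
      (mul_le_mul (hK₂ t ht) (hvN k t ht) (norm_nonneg _) hK₂0)) (hK₄ t ht))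
  refine ⟨hu₀, hv₀, ?_, fun t ht z => ?_⟩
  · refine sub_eq_integral_of_tendsto (E := H) hμ0 (φ := fun k t => W.emb (u k t) - μ k • v k t)
      (φ₀ := fun t => W.emb (u₀ t)) (g := fun k t => v k t)
      (r := fun k t => W.pert t (v k t) - f t) (B := N + (K₂ * N + K₄))
      (fun k t ht => (h k).hasDerivAt_displacement (hμ k) ht) (fun t ht => ?_) hv hcv
      (fun k => (hD.clm_apply (hcv k)).sub hfc) (fun k t ht => ?_) (fun k t ht => ?_)
    · have h1 := ((W.emb.continuous.tendsto _).comp (hu t ht)).sub (hμ0.smul (hv t ht))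
      simpa using h1
    · have := (norm_nonneg _).trans (hr k t ht)
      linarith [hvN k t ht]
    · have := hN t ht
      linarith [hr k t ht]
  · refine sub_eq_integral_of_tendsto (E := ℝ) hμ0
      (φ := fun k t => W.momentum t (u k t) (v k t) z
        + μ k * (⟪u k t, z⟫_ℝ - ⟪W.pert t (v k t), W.emb z⟫_ℝ))
      (φ₀ := fun t => W.momentum t (u₀ t) (v₀ t) z)
      (g := fun k t => W.force t (u k t) z + ⟪f t, W.emb z⟫_ℝ)
      (r := fun k t => ⟪W.pert t (W.pert t (v k t) - f t), W.emb z⟫_ℝ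
        - ⟪W.pert' t (v k t), W.emb z⟫_ℝ)
      (B := (N * ‖z‖ + K₁ * (‖W.obs‖ * N * ‖W.obs z‖) + K₃ * (‖W.emb‖ * N) * ‖W.emb z‖
        + K₄ * ‖W.emb z‖) + (K₂ * (K₂ * N + K₄) * ‖W.emb z‖ + K₃ * N * ‖W.emb z‖))
      (fun k t ht => (h k).hasDerivAt_momentum (hμ k) ht (hb t ht) z) (fun t ht => ?_)
      (fun t ht => ?_) (fun k => ?_) (fun k => ?_) (fun k t ht => ?_) (fun k t ht => ?_) t ht
    · have hu1 := hu t ht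
      have hv1 := hv t ht
      have i1 := (hv1.inner (𝕜 := ℝ) (tendsto_const_nhds (x := W.emb z))).add
        ((((W.obs.continuous.tendsto _).comp hu1).inner (𝕜 := ℝ)
          (tendsto_const_nhds (x := W.obs z))).const_mul (W.coeff t)) |>.add
        ((((W.pert t ∘L W.emb).continuous.tendsto _).comp hu1).inner (𝕜 := ℝ)
          (tendsto_const_nhds (x := W.emb z)))
      have i2 := hμ0.mul ((hu1.inner (𝕜 := ℝ) (tendsto_const_nhds (x := z))).sub
        ((((W.pert t).continuous.tendsto _).comp hv1).inner (𝕜 := ℝ)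
          (tendsto_const_nhds (x := W.emb z))))
      have i3 := i1.add i2
      rw [zero_mul, add_zero] at i3
      exact i3
    · have hu1 := hu t ht
      exact ((hu1.inner (𝕜 := ℝ) (tendsto_const_nhds (x := z))).neg.add
        ((((W.obs.continuous.tendsto _).comp hu1).inner (𝕜 := ℝ)
          (tendsto_const_nhds (x := W.obs z))).const_mul (W.coeff' t)) |>.add
        ((((W.pert' t ∘L W.emb).continuous.tendsto _).comp hu1).inner (𝕜 := ℝ)
          (tendsto_const_nhds (x := W.emb z)))).add_const _
    · have j := hcu k
      have j1 : ContinuousOn (fun t => W.obs (u k t)) (Icc c T) := W.obs.continuous.comp_continuousOn j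
      have j2 : ContinuousOn (fun t => W.emb (u k t)) (Icc c T) := W.emb.continuous.comp_continuousOn j
      exact (((j.inner continuousOn_const).neg.add (hb'.mul (j1.inner continuousOn_const))).add
        ((hD'.clm_apply j2).inner continuousOn_const)).add (hfc.inner continuousOn_const)
    · exact ((hD.clm_apply ((hD.clm_apply (hcv k)).sub hfc)).inner continuousOn_const).sub
        ((hD'.clm_apply (hcv k)).inner continuousOn_const)
    · have hN0 := hN t ht
      have i1 : |⟪u k t, z⟫_ℝ| ≤ N * ‖z‖ :=
        (abs_real_inner_le_norm _ _).trans (mul_le_mul_of_nonneg_right (huN k t ht) (norm_nonneg _))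
      have i2 : |W.coeff' t * ⟪W.obs (u k t), W.obs z⟫_ℝ| ≤ K₁ * (‖W.obs‖ * N * ‖W.obs z‖) := by
        rw [abs_mul]
        refine mul_le_mul (hK₁ t ht) ((abs_real_inner_le_norm _ _).trans
          (mul_le_mul_of_nonneg_right ?_ (norm_nonneg _))) (abs_nonneg _) hK₁0
        exact (W.obs.le_opNorm _).trans (mul_le_mul_of_nonneg_left (huN k t ht) (norm_nonneg _))
      have i3 : |⟪W.pert' t (W.emb (u k t)), W.emb z⟫_ℝ| ≤ K₃ * (‖W.emb‖ * N) * ‖W.emb z‖ := by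
        refine (abs_real_inner_le_norm _ _).trans (mul_le_mul_of_nonneg_right ?_ (norm_nonneg _))
        refine ((W.pert' t).le_opNorm _).trans (mul_le_mul (hK₃ t ht) ?_ (norm_nonneg _) hK₃0)
        exact (W.emb.le_opNorm _).trans (mul_le_mul_of_nonneg_left (huN k t ht) (norm_nonneg _))
      have i4 : |⟪f t, W.emb z⟫_ℝ| ≤ K₄ * ‖W.emb z‖ :=
        (abs_real_inner_le_norm _ _).trans (mul_le_mul_of_nonneg_right (hK₄ t ht) (norm_nonneg _))
      have i5 : 0 ≤ K₂ * (K₂ * N + K₄) * ‖W.emb z‖ + K₃ * N * ‖W.emb z‖ := by positivity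
      rw [Real.norm_eq_abs, force]
      refine (abs_add_le _ _).trans ?_
      have i6 := abs_add_three (-⟪u k t, z⟫_ℝ) (W.coeff' t * ⟪W.obs (u k t), W.obs z⟫_ℝ)
        ⟪W.pert' t (W.emb (u k t)), W.emb z⟫_ℝ
      rw [abs_neg] at i6
      linarith
    · have hN0 := hN t ht
      have i1 : |⟪W.pert t (W.pert t (v k t) - f t), W.emb z⟫_ℝ| ≤ K₂ * (K₂ * N + K₄) * ‖W.emb z‖ := by
        refine (abs_real_inner_le_norm _ _).trans (mul_le_mul_of_nonneg_right ?_ (norm_nonneg _))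
        exact ((W.pert t).le_opNorm _).trans (mul_le_mul (hK₂ t ht) (hr k t ht) (norm_nonneg _) hK₂0)
      have i2 : |⟪W.pert' t (v k t), W.emb z⟫_ℝ| ≤ K₃ * N * ‖W.emb z‖ := by
        refine (abs_real_inner_le_norm _ _).trans (mul_le_mul_of_nonneg_right ?_ (norm_nonneg _))
        exact ((W.pert' t).le_opNorm _).trans (mul_le_mul (hK₃ t ht) (hvN k t ht) (norm_nonneg _) hK₃0)
      have i5 : 0 ≤ N * ‖z‖ + K₁ * (‖W.obs‖ * N * ‖W.obs z‖) + K₃ * (‖W.emb‖ * N) * ‖W.emb z‖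
        + K₄ * ‖W.emb z‖ := by positivity
      rw [Real.norm_eq_abs]
      refine (abs_sub _ _).trans ?_
      linarith

end DampedWave

end IntermittentDelay

/-! ### Existence for a positive damping coefficient, and estimates near a zero of it. -/

namespace IntermittentDelay

namespace DampedWave

set_option linter.unusedSectionVars false

variable {V H U : Type*} [NormedAddCommGroup V] [InnerProductSpace ℝ V] [CompleteSpace V]
  [NormedAddCommGroup H] [InnerProductSpace ℝ H] [CompleteSpace H]
  [NormedAddCommGroup U] [InnerProductSpace ℝ U] [CompleteSpace U]
  (W : DampedWave V H U)

open Filter Topology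

/-- A sequence of regularized solutions with parameters `1 / (k + 1)` and fixed initial data. -/
structure IsApproxSeq (f : ℝ → H) (c d : ℝ) (u₀ : V) (v₀ : H) (u : ℕ → ℝ → V) (v : ℕ → ℝ → H) :
    Prop where
  isApprox : ∀ k : ℕ, W.IsApprox (1 / ((k : ℝ) + 1)) f c d (u k) (v k)
  fst_initial : ∀ k, u k c = u₀
  snd_initial : ∀ k, v k c = v₀

theorem exists_isApproxSeq {f : ℝ → H} (hf : Continuous f) {c d : ℝ} (hcd : c ≤ d) (u₀ : V)
    (v₀ : H) : ∃ u v, W.IsApproxSeq f c d u₀ v₀ u v := by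
  choose u v h h1 h2 using fun k : ℕ =>
    W.exists_isApprox (μ := 1 / ((k : ℝ) + 1)) Nat.one_div_pos_of_nat hf hcd u₀ v₀
  exact ⟨u, v, h, h1, h2⟩

namespace IsApproxSeq

variable {W} {f : ℝ → H} {c d T : ℝ} {u₀ : V} {v₀ : H} {u : ℕ → ℝ → V} {v : ℕ → ℝ → H}

theorem mono (h : W.IsApproxSeq f c d u₀ v₀ u v) (hT : T ≤ d) : W.IsApproxSeq f c T u₀ v₀ u v :=
  ⟨fun k => (h.isApprox k).mono le_rfl hT, h.fst_initial, h.snd_initial⟩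

theorem exists_dist_le (h : W.IsApproxSeq f c T u₀ v₀ u v) (hf : Continuous f) (hcT : c ≤ T)
    (hb : ∀ t ∈ Icc c T, 0 < W.coeff t) {ε : ℝ} (hε : 0 < ε) :
    ∃ N, ∀ m ≥ N, ∀ n ≥ N, ∀ t ∈ Icc c T, dist (u m t) (u n t) < ε ∧ dist (v m t) (v n t) < ε := by
  obtain ⟨δ, hδ, hC⟩ := W.cauchy hcT hb hf u₀ v₀ (ε := ε ^ 2 / 2) (by positivity)
  obtain ⟨N, hN⟩ := exists_nat_one_div_lt hδ
  have hlt : ∀ m ≥ N, 1 / ((m : ℝ) + 1) < δ := fun m hm =>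
    (one_div_le_one_div_of_le (by positivity) (by gcongr)).trans_lt hN
  refine ⟨N, fun m hm n hn t ht => ?_⟩
  have h1 := hC _ _ (u m) (u n) (v m) (v n) Nat.one_div_pos_of_nat (hlt m hm)
    Nat.one_div_pos_of_nat (hlt n hn) (h.isApprox m) (h.isApprox n) (h.fst_initial m)
    (h.snd_initial m) (h.fst_initial n) (h.snd_initial n) t ht
  rw [dist_eq_norm, dist_eq_norm]
  have hε2 : 0 < ε ^ 2 := by positivity
  exact ⟨lt_of_pow_lt_pow_left₀ 2 hε.le (by nlinarith [sq_nonneg ‖v m t - v n t‖]),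
    lt_of_pow_lt_pow_left₀ 2 hε.le (by nlinarith [sq_nonneg ‖u m t - u n t‖])⟩

theorem exists_tendsto (h : W.IsApproxSeq f c T u₀ v₀ u v) (hf : Continuous f)
    (hb : ∀ t ∈ Icc c T, 0 < W.coeff t) {t : ℝ} (ht : t ∈ Icc c T) :
    (∃ x, Tendsto (fun k => u k t) atTop (𝓝 x)) ∧ ∃ y, Tendsto (fun k => v k t) atTop (𝓝 y) := by
  constructor <;> refine cauchySeq_tendsto_of_complete (Metric.cauchySeq_iff.mpr fun ε hε => ?_) <;>
    obtain ⟨N, hN⟩ := h.exists_dist_le hf (ht.1.trans ht.2) hb hε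
  · exact ⟨N, fun m hm n hn => (hN m hm n hn t ht).1⟩
  · exact ⟨N, fun m hm n hn => (hN m hm n hn t ht).2⟩

/-- The energy estimate supplies the uniform bound, and the Cauchy property, uniform in time, makes
the pointwise limits continuous. -/
theorem isWeak (h : W.IsApproxSeq f c T u₀ v₀ u v) (hf : Continuous f) (hcT : c ≤ T)
    (hb : ∀ t ∈ Icc c T, 0 < W.coeff t) {x : ℝ → V} {y : ℝ → H}
    (hx : ∀ t ∈ Icc c T, Tendsto (fun k => u k t) atTop (𝓝 (x t)))
    (hy : ∀ t ∈ Icc c T, Tendsto (fun k => v k t) atTop (𝓝 (y t))) : W.IsWeak f c T x y := by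
  obtain ⟨K, hK0, hK⟩ := exists_norm_le_on_Icc (c := c) (d := T) W.pert_continuous.continuousOn
  obtain ⟨F, hF0, hF⟩ := exists_norm_le_on_Icc (c := c) (d := T) hf.continuousOn
  set E : ℝ := Real.exp ((2 * K + 1) * (T - c)) * (‖u₀‖ ^ 2 + ‖v₀‖ ^ 2 + F ^ 2 * (T - c)) with hE
  have hen : ∀ k, ∀ t ∈ Icc c T, ‖u k t‖ ^ 2 + ‖v k t‖ ^ 2 ≤ E := by
    intro k t ht
    have h1 := (h.isApprox k).energy_le Nat.one_div_pos_of_nat hK0 hK hF t ht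
    rw [h.fst_initial, h.snd_initial] at h1
    refine h1.trans ?_
    have i1 : t - c ≤ T - c := by linarith [ht.2]
    have i2 : 0 ≤ t - c := by linarith [ht.1]
    rw [hE]
    gcongr
  refine W.isWeak_of_tendsto (N := √E) hb hf (fun k => Nat.one_div_pos_of_nat)
    tendsto_one_div_add_atTop_nhds_zero_nat h.isApprox
    (fun k t ht => Real.le_sqrt_of_sq_le (by nlinarith [hen k t ht, sq_nonneg ‖v k t‖]))
    (fun k t ht => Real.le_sqrt_of_sq_le (by nlinarith [hen k t ht, sq_nonneg ‖u k t‖])) hx hy ?_ ?_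
  · have hu : UniformCauchySeqOn u atTop (Icc c T) := Metric.uniformCauchySeqOn_iff.mpr
      fun ε hε => (h.exists_dist_le hf hcT hb hε).imp fun N hN m hm n hn t ht => (hN m hm n hn t ht).1
    exact (hu.tendstoUniformlyOn_of_tendsto hx).continuousOn (Frequently.of_forall fun k t ht =>
      ((h.isApprox k).fst t ht).continuousAt.continuousWithinAt)
  · have hu : UniformCauchySeqOn v atTop (Icc c T) := Metric.uniformCauchySeqOn_iff.mpr
      fun ε hε => (h.exists_dist_le hf hcT hb hε).imp fun N hN m hm n hn t ht => (hN m hm n hn t ht).2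
    exact (hu.tendstoUniformlyOn_of_tendsto hy).continuousOn (Frequently.of_forall fun k t ht =>
      ((h.isApprox k).snd t ht).continuousAt.continuousWithinAt)

end IsApproxSeq

/-- Existence when the damping coefficient is positive on the closed interval. -/
theorem exists_isWeak {f : ℝ → H} (hf : Continuous f) {c d : ℝ} (hcd : c ≤ d)
    (hb : ∀ t ∈ Icc c d, 0 < W.coeff t) (u₀ : V) (v₀ : H) :
    ∃ u v, W.IsWeak f c d u v ∧ u c = u₀ ∧ v c = v₀ := by
  obtain ⟨u, v, h⟩ := W.exists_isApproxSeq hf hcd u₀ v₀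
  have hx : ∀ t, ∃ x, t ∈ Icc c d → Tendsto (fun k => u k t) atTop (𝓝 x) := fun t => by
    by_cases ht : t ∈ Icc c d
    · exact (h.exists_tendsto hf hb ht).1.imp fun x hx _ => hx
    · exact ⟨0, fun h => absurd h ht⟩
  have hy : ∀ t, ∃ x, t ∈ Icc c d → Tendsto (fun k => v k t) atTop (𝓝 x) := fun t => by
    by_cases ht : t ∈ Icc c d
    · exact (h.exists_tendsto hf hb ht).2.imp fun x hx _ => hx
    · exact ⟨0, fun h => absurd h ht⟩
  choose x hx using hx
  choose y hy using hy
  refine ⟨x, y, h.isWeak hf hcd hb hx hy, ?_, ?_⟩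
  · exact tendsto_nhds_unique (hx c ⟨le_rfl, hcd⟩) (by simp [h.fst_initial])
  · exact tendsto_nhds_unique (hy c ⟨le_rfl, hcd⟩) (by simp [h.snd_initial])

/-! ### Undisturbed equation with a damping that vanishes at the right end point -/

namespace IsApprox

variable {W} {μ c d : ℝ} {u : ℝ → V} {v : ℝ → H}

theorem hasDerivAt_energy_free (hμ : 0 < μ) (hD : ∀ t, W.pert t = 0)
    (h : W.IsApprox μ 0 c d u v) {t : ℝ} (ht : t ∈ Icc c d) :
    ∃ y', HasDerivAt (fun t => ‖u t‖ ^ 2 + ‖v t‖ ^ 2) y' t ∧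
      y' ≤ -(2 * W.coeff t * ‖W.obs (W.vhat μ t (u t, v t))‖ ^ 2) := by
  refine ⟨_, h.hasDerivAt_energy hμ ht, ?_⟩
  have h1 : 0 ≤ μ * ‖W.vhat μ t (u t, v t)‖ ^ 2 := by positivity
  have h3 : 0 ≤ μ * ‖W.accel μ t (u t, v t)‖ ^ 2 := by positivity
  simp only [hD, zero_apply, inner_zero_right, Pi.zero_apply]
  linarith

theorem energy_antitone (hμ : 0 < μ) (hD : ∀ t, W.pert t = 0) (h : W.IsApprox μ 0 c d u v) :
    AntitoneOn (fun t => ‖u t‖ ^ 2 + ‖v t‖ ^ 2) (Icc c d) := by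
  refine antitoneOn_of_deriv_nonpos (convex_Icc c d)
    (fun t ht => ?_) (fun t ht => ?_) fun t ht => ?_
  · obtain ⟨y', h1, -⟩ := h.hasDerivAt_energy_free hμ hD ht
    exact h1.continuousAt.continuousWithinAt
  · obtain ⟨y', h1, -⟩ := h.hasDerivAt_energy_free hμ hD (interior_subset ht)
    exact h1.differentiableAt.differentiableWithinAt
  · obtain ⟨y', h1, h2⟩ := h.hasDerivAt_energy_free hμ hD (interior_subset ht)
    rw [h1.deriv]
    have : 0 ≤ 2 * W.coeff t * ‖W.obs (W.vhat μ t (u t, v t))‖ ^ 2 :=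
      mul_nonneg (mul_nonneg two_pos.le (W.coeff_nonneg t)) (sq_nonneg _)
    linarith

/-- The energy of the time derivative near a zero of the damping coefficient. -/
theorem energy_deriv_le (hμ : 0 < μ) (hD : ∀ t, W.pert t = 0) (hD' : ∀ t, W.pert' t = 0)
    (h : W.IsApprox μ 0 c d u v) (hb : ∀ t ∈ Ico c d, 0 < W.coeff t) {K : ℝ} (hK : 0 ≤ K)
    (hbK : ∀ t ∈ Ico c d, W.coeff' t ^ 2 ≤ K * W.coeff t + 4 * W.coeff t ^ 2 / (d - t) ^ 2)
    {s t₀ : ℝ} (hs : c ≤ s) (hst : s ≤ t₀) (ht₀ : t₀ < d) :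
    ‖W.vhat μ t₀ (u t₀, v t₀)‖ ^ 2 + ‖W.accel μ t₀ (u t₀, v t₀)‖ ^ 2 ≤
      Real.exp (K * ‖W.obs‖ ^ 2 / 2 * (d - c)) *
        (‖W.vhat μ s (u s, v s)‖ ^ 2 + ‖W.accel μ s (u s, v s)‖ ^ 2
          + ((‖u s‖ ^ 2 + ‖v s‖ ^ 2) - (‖u t₀‖ ^ 2 + ‖v t₀‖ ^ 2)) / (d - t₀) ^ 2) := by
  set L := K * ‖W.obs‖ ^ 2 / 2 with hL
  have hL0 : 0 ≤ L := by positivity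
  have hdt : 0 < d - t₀ := by linarith
  set y : ℝ → ℝ := fun t => ‖W.vhat μ t (u t, v t)‖ ^ 2 + ‖W.accel μ t (u t, v t)‖ ^ 2 with hy
  set e : ℝ → ℝ := fun t => ‖u t‖ ^ 2 + ‖v t‖ ^ 2 with he
  have hder : ∀ t, ∃ y' e', t ∈ Icc s t₀ → HasDerivAt y y' t ∧ HasDerivAt e e' t ∧
      y' - L * y t ≤ -e' / (d - t₀) ^ 2 ∧ e' ≤ 0 := by
    intro t
    by_cases ht : t ∈ Icc s t₀
    swap
    · exact ⟨0, 0, fun h => absurd h ht⟩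
    have htd : t ∈ Ico c d := ⟨hs.trans ht.1, ht.2.trans_lt ht₀⟩
    have hbt := hb t htd
    obtain ⟨e', he1, he2⟩ := h.hasDerivAt_energy_free hμ hD (Ico_subset_Icc_self htd)
    obtain ⟨y', hy1, hy2⟩ := h.exists_hasDerivAt_energy_deriv hμ (Ico_subset_Icc_self htd)
      hbt (hasDerivAt_const t (0 : H))
    simp only [hD, hD', zero_apply, sub_zero, Pi.zero_apply, add_zero,
      inner_zero_right, mul_zero] at hy1 hy2
    refine ⟨y', e', fun _ => ⟨hy1, he1, ?_, ?_⟩⟩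
    · set X := ‖W.obs (W.vhat μ t (u t, v t))‖ ^ 2 with hX
      have hX0 : 0 ≤ X := sq_nonneg _
      -- On `[s, t₀]` the singular weight is replaced by its largest value. As this is constant in
      -- time, the term `2 b ‖L w‖² / (d - t₀)²` is bounded by the derivative of `-e / (d - t₀)²`
      -- and integrates to the energy loss.
      have i1 : W.coeff' t ^ 2 / (2 * W.coeff t) ≤ K / 2 + 2 * W.coeff t / (d - t₀) ^ 2 := by
        have j1 : 4 * W.coeff t ^ 2 / (d - t) ^ 2 ≤ 4 * W.coeff t ^ 2 / (d - t₀) ^ 2 := by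
          have : d - t₀ ≤ d - t := by linarith [ht.2]
          gcongr
        have j2 : W.coeff' t ^ 2 ≤
            (K / 2 + 2 * W.coeff t / (d - t₀) ^ 2) * (2 * W.coeff t) := by
          refine ((hbK t htd).trans (add_le_add_right j1 _)).trans (le_of_eq ?_)
          field_simp
          ring
        rw [div_le_iff₀ (by positivity)]
        exact j2
      have i2 : X ≤ ‖W.obs‖ ^ 2 * y t := by
        have j1 : X ≤ (‖W.obs‖ * ‖W.vhat μ t (u t, v t)‖) ^ 2 :=
          pow_le_pow_left₀ (norm_nonneg _) (W.obs.le_opNorm _) 2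
        rw [mul_pow] at j1
        refine j1.trans (mul_le_mul_of_nonneg_left ?_ (sq_nonneg _))
        simp only [hy]
        nlinarith [sq_nonneg ‖W.accel μ t (u t, v t)‖]
      have i3 : K / 2 * X ≤ L * y t := by
        have := mul_le_mul_of_nonneg_left i2 (by positivity : 0 ≤ K / 2)
        rw [hL]
        linarith
      have i4 : 2 * W.coeff t / (d - t₀) ^ 2 * X ≤ -e' / (d - t₀) ^ 2 := by
        rw [div_mul_eq_mul_div]
        gcongr
        linarith
      have i5 := mul_le_mul_of_nonneg_right i1 hX0
      rw [add_mul] at i5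
      linarith
    · have : 0 ≤ 2 * W.coeff t * ‖W.obs (W.vhat μ t (u t, v t))‖ ^ 2 := by positivity
      linarith
  choose y' e' hye using hder
  have hanti := antitoneOn_Icc_of_hasDerivAt_nonpos (c := s) (d := t₀)
    (y := fun t => Real.exp (-(L * (t - s))) * y t + e t / (d - t₀) ^ 2)
    (y' := fun t => Real.exp (-(L * (t - s))) * (y' t - L * y t) + e' t / (d - t₀) ^ 2)
    (fun t ht => by
      have h1 : HasDerivAt (fun t : ℝ => -(L * (t - s))) (-(L * 1)) t :=
        (((hasDerivAt_id t).sub_const s).const_mul L).neg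
      refine ((h1.exp.mul (hye t ht).1).add ((hye t ht).2.1.div_const _)).congr_deriv ?_
      ring)
    (fun t ht => by
      obtain ⟨-, -, h3, h4⟩ := hye t ht
      have h5 : Real.exp (-(L * (t - s))) ≤ 1 := Real.exp_le_one_iff.mpr (by nlinarith [ht.1])
      have h6 : 0 ≤ -e' t / (d - t₀) ^ 2 := div_nonneg (by linarith) (by positivity)
      have h7 := mul_le_mul_of_nonneg_left h3 (Real.exp_pos (-(L * (t - s)))).le
      have h8 := mul_le_mul_of_nonneg_right h5 h6
      have h9 : -e' t / (d - t₀) ^ 2 = -(e' t / (d - t₀) ^ 2) := by ring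
      rw [h9] at h7 h8
      linarith)
  have h1 := hanti ⟨le_rfl, hst⟩ ⟨hst, le_rfl⟩ hst
  simp only [sub_self, mul_zero, neg_zero, Real.exp_zero, one_mul] at h1
  have h2 : Real.exp (-(L * (t₀ - s))) * y t₀ ≤ y s + (e s - e t₀) / (d - t₀) ^ 2 := by
    rw [sub_div]; linarith
  have h3 : y t₀ = Real.exp (L * (t₀ - s)) * (Real.exp (-(L * (t₀ - s))) * y t₀) := by
    rw [← mul_assoc, ← Real.exp_add]; simp
  have h0 : 0 ≤ y s + (e s - e t₀) / (d - t₀) ^ 2 :=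
    (mul_nonneg (Real.exp_pos _).le (by positivity)).trans h2
  calc y t₀ = _ := h3
    _ ≤ Real.exp (L * (t₀ - s)) * (y s + (e s - e t₀) / (d - t₀) ^ 2) :=
        mul_le_mul_of_nonneg_left h2 (Real.exp_pos _).le
    _ ≤ Real.exp (L * (d - c)) * (y s + (e s - e t₀) / (d - t₀) ^ 2) := by
        refine mul_le_mul_of_nonneg_right (Real.exp_le_exp.mpr ?_) h0
        refine mul_le_mul_of_nonneg_left (by linarith) hL0

end IsApprox

end DampedWave

end IntermittentDelay

/-! ### Limits at a zero of the damping coefficient. -/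

namespace IntermittentDelay

namespace DampedWave

set_option linter.unusedSectionVars false

variable {V H U : Type*} [NormedAddCommGroup V] [InnerProductSpace ℝ V] [CompleteSpace V]
  [NormedAddCommGroup H] [InnerProductSpace ℝ H] [CompleteSpace H]
  [NormedAddCommGroup U] [InnerProductSpace ℝ U] [CompleteSpace U]
  (W : DampedWave V H U)

open Filter Topology

theorem abs_inner_add_inner_le {E F : Type*} [NormedAddCommGroup E] [InnerProductSpace ℝ E]
    [NormedAddCommGroup F] [InnerProductSpace ℝ F] {a b : E} {x y : F} {A B : ℝ} (ha : ‖a‖ ≤ A)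
    (hb : ‖b‖ ≤ B) (hx : ‖x‖ ≤ A) (hy : ‖y‖ ≤ B) : |⟪a, b⟫_ℝ + ⟪x, y⟫_ℝ| ≤ 2 * (A * B) := by
  have hA : 0 ≤ A := (norm_nonneg _).trans ha
  refine (abs_add_le _ _).trans ?_
  have h1 := (abs_real_inner_le_norm a b).trans (mul_le_mul ha hb (norm_nonneg _) hA)
  have h2 := (abs_real_inner_le_norm x y).trans (mul_le_mul hx hy (norm_nonneg _) hA)
  linarith

variable {W} in
/-- A regularized solution moves little after the time `t₀` if its time derivative at `t₀` is small
compared with `1 / (d - t₀)`. -/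
theorem IsApprox.dist_sq_le {μ c d : ℝ} {u : ℝ → V} {v : ℝ → H} (hμ : 0 < μ)
    (hD : ∀ t, W.pert t = 0) (h : W.IsApprox μ 0 c d u v) {K M ζ : ℝ} (hK : 0 ≤ K) (hζ : 0 < ζ)
    (hbK : ∀ t ∈ Ico c d, W.coeff t ≤ K * (d - t)) {t₀ : ℝ} (hc : c ≤ t₀) (ht₀ : t₀ < d)
    (hM : ∀ t ∈ Icc c d, ‖u t‖ ≤ M ∧ ‖v t‖ ≤ M)
    (hw : (d - t₀) * ‖W.vhat μ t₀ (u t₀, v t₀)‖ ≤ ζ) (hq : (d - t₀) * ‖W.accel μ t₀ (u t₀, v t₀)‖ ≤ ζ)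
    {t : ℝ} (ht : t ∈ Ico t₀ d) :
    ‖u t - u t₀‖ ^ 2 + ‖v t - v t₀‖ ^ 2 ≤
      (4 * K * ‖W.obs‖ ^ 2 * M + M ^ 2 + 4 * M + K * ‖W.obs‖ ^ 2) * ζ
        + 16 * μ * (ζ / (d - t₀) * M) := by
  have hdt : 0 < d - t₀ := by linarith
  have hdt' : d - t₀ ≠ 0 := hdt.ne'
  set w := W.vhat μ t₀ (u t₀, v t₀) with hw'
  set q := W.accel μ t₀ (u t₀, v t₀) with hq'
  set σ := ζ / (d - t₀) with hσ
  have hσ0 : 0 < σ := by positivity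
  have hσ1 : (d - t₀) * σ = ζ := by rw [hσ]; field_simp
  have hwσ : ‖w‖ ≤ σ := by rw [hσ, le_div_iff₀ hdt]; linarith
  have hqσ : ‖q‖ ≤ σ := by rw [hσ, le_div_iff₀ hdt]; linarith
  have ht₀' : t₀ ∈ Icc c d := ⟨hc, ht₀.le⟩
  have hM0 : 0 ≤ M := (norm_nonneg _).trans (hM t₀ ht₀').1
  have hb₀ := hbK t₀ ⟨hc, ht₀⟩
  set b₀ := W.coeff t₀ with hb₀'
  have hb₀0 : 0 ≤ b₀ := W.coeff_nonneg t₀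
  -- `Ψ` is the inner product of the states at `t₀` and at `t` with two corrections. The term with
  -- `b₀` cancels the damping at time `t₀`, the term with `2 μ` the regularization error. In the
  -- derivative the generator is thereby moved onto the state at `t₀`, where `w` and `q` are small
  -- compared with `1 / (d - t₀)`; only `b(s) ⟪L w, L w(s)⟫` remains at the running time.
  set Ψ : ℝ → ℝ := fun t => ⟪u t₀, u t⟫_ℝ + ⟪v t₀, v t⟫_ℝ + b₀ * ⟪W.obs w, W.obs (u t)⟫_ℝ
    + 2 * μ * (⟪w, u t⟫_ℝ + ⟪q, v t⟫_ℝ) with hΨ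
  set e : ℝ → ℝ := fun t => ‖u t‖ ^ 2 + ‖v t‖ ^ 2 with he
  have hIcc : ∀ s ∈ Icc t₀ t, s ∈ Icc c d := fun s hs => ⟨hc.trans hs.1, hs.2.trans ht.2.le⟩
  have hΨ' : ∀ s ∈ Icc t₀ t, HasDerivAt Ψ (-(⟪w, u s⟫_ℝ + ⟪q, v s⟫_ℝ)
      - W.coeff s * ⟪W.obs w, W.obs (W.vhat μ s (u s, v s))⟫_ℝ) s := by
    intro s hs
    have hu := h.fst s (hIcc s hs)
    have hv := h.snd s (hIcc s hs)
    simp only [hD, zero_apply, sub_zero, Pi.zero_apply, add_zero] at hv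
    have k1 := ((hasDerivAt_const s (u t₀)).inner ℝ hu).add ((hasDerivAt_const s (v t₀)).inner ℝ hv)
    have k2 := (((hasDerivAt_const s (W.obs w)).inner ℝ
      (W.obs.hasFDerivAt.comp_hasDerivAt s hu))).const_mul b₀
    have k3 := (((hasDerivAt_const s w).inner ℝ hu).add
      ((hasDerivAt_const s q).inner ℝ hv)).const_mul (2 * μ)
    refine ((k1.add k2).add k3).congr_deriv ?_
    have e1 := W.inner_accel hμ s (u s, v s) w
    have e2 := W.inner_accel hμ t₀ (u t₀, v t₀) (W.vhat μ s (u s, v s))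
    have e3 := W.emb_vhat hμ t₀ (u t₀, v t₀)
    have e4 := W.emb_vhat hμ s (u s, v s)
    rw [← hw', ← hq'] at e3 e2
    rw [← hb₀'] at e2
    rw [e3] at e1
    rw [e4] at e2
    simp only [inner_add_left, inner_add_right, real_inner_smul_left, real_inner_smul_right,
      inner_zero_left] at e1 e2 ⊢
    rw [real_inner_comm (v t₀), real_inner_comm q, real_inner_comm w (u s),
      real_inner_comm w (W.vhat μ s (u s, v s)), real_inner_comm (W.obs w)] at e1
    linarith
  have hanti : ∀ s, ∃ e', s ∈ Icc t₀ t → HasDerivAt e e' s ∧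
      e' ≤ -(2 * W.coeff s * ‖W.obs (W.vhat μ s (u s, v s))‖ ^ 2) := fun s => by
    by_cases hs : s ∈ Icc t₀ t
    · exact (h.hasDerivAt_energy_free hμ hD (hIcc s hs)).imp fun e' he' _ => he'
    · exact ⟨0, fun h => absurd h hs⟩
  choose e' he' using hanti
  set R : ℝ := 2 * M + K * ‖W.obs‖ ^ 2 / 2 with hR
  -- The fraction `ζ / 4` of the dissipated energy absorbs the remaining damping term by Young's
  -- inequality. The linear bound on `b` near `d` then makes the leftover at most a multiple of `σ`,
  -- which `R σ s` compensates.
  have hmono := antitoneOn_Icc_of_hasDerivAt_nonpos (c := t₀) (d := t)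
    (y := fun s => ζ / 4 * e s - Ψ s - R * σ * s)
    (fun s hs => (((he' s hs).1.const_mul (ζ / 4)).sub (hΨ' s hs)).sub
      ((hasDerivAt_id s).const_mul (R * σ))) (fun s hs => by
      have h1 := (he' s hs).2
      have hs' : s ∈ Ico c d := ⟨hc.trans hs.1, hs.2.trans_lt ht.2⟩
      have h2 := abs_inner_add_inner_le hwσ (hM s (hIcc s hs)).1 hqσ (hM s (hIcc s hs)).2
      have h3 := (le_abs_self _).trans h2
      set X := ‖W.obs (W.vhat μ s (u s, v s))‖ with hX
      have h4 : ⟪W.obs w, W.obs (W.vhat μ s (u s, v s))⟫_ℝ ≤ ‖W.obs‖ * σ * X :=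
        (real_inner_le_norm _ _).trans (mul_le_mul_of_nonneg_right
          ((W.obs.le_opNorm _).trans (mul_le_mul_of_nonneg_left hwσ (norm_nonneg _)))
          (norm_nonneg _))
      have hbs := W.coeff_nonneg s
      have h5 : ‖W.obs‖ * σ * X ≤ ζ / 2 * X ^ 2 + ‖W.obs‖ ^ 2 * σ ^ 2 / (2 * ζ) := by
        have : ζ / 2 * X ^ 2 + ‖W.obs‖ ^ 2 * σ ^ 2 / (2 * ζ) - ‖W.obs‖ * σ * X =
            (ζ * X - ‖W.obs‖ * σ) ^ 2 / (2 * ζ) := by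
          field_simp
          ring
        have : 0 ≤ (ζ * X - ‖W.obs‖ * σ) ^ 2 / (2 * ζ) := by positivity
        linarith
      have h6 : W.coeff s * (‖W.obs‖ ^ 2 * σ ^ 2 / (2 * ζ)) ≤ K * ‖W.obs‖ ^ 2 / 2 * σ := by
        have i1 : W.coeff s ≤ K * (d - t₀) :=
          (hbK s hs').trans (mul_le_mul_of_nonneg_left (by linarith [hs.1]) hK)
        calc W.coeff s * (‖W.obs‖ ^ 2 * σ ^ 2 / (2 * ζ))
            ≤ K * (d - t₀) * (‖W.obs‖ ^ 2 * σ ^ 2 / (2 * ζ)) :=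
              mul_le_mul_of_nonneg_right i1 (by positivity)
          _ = K * ‖W.obs‖ ^ 2 / 2 * σ * (((d - t₀) * σ) / ζ) := by field_simp
          _ = _ := by rw [hσ1, div_self hζ.ne', mul_one]
      have h7 := mul_le_mul_of_nonneg_left (h4.trans h5) hbs
      rw [mul_add] at h7
      have h8 := mul_le_mul_of_nonneg_left h1 (by positivity : 0 ≤ ζ / 4)
      rw [hR]
      linarith)
  have hfin := hmono ⟨le_rfl, ht.1⟩ ⟨ht.1, le_rfl⟩ ht.1
  simp only at hfin
  have hE := h.energy_antitone hμ hD ht₀' ⟨hc.trans ht.1, ht.2.le⟩ ht.1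
  simp only at hE
  have hRt : R * σ * (t - t₀) ≤ R * ζ := by
    rw [← hσ1]
    have : t - t₀ ≤ d - t₀ := by linarith [ht.2]
    have hR0 : 0 ≤ R := by positivity
    calc R * σ * (t - t₀) ≤ R * σ * (d - t₀) := by gcongr
      _ = _ := by ring
  have hu0 := hM t₀ ht₀'
  have hut := hM t ⟨hc.trans ht.1, ht.2.le⟩
  have g1 : b₀ * (⟪W.obs w, W.obs (u t)⟫_ℝ - ⟪W.obs w, W.obs (u t₀)⟫_ℝ) ≤
      2 * K * ‖W.obs‖ ^ 2 * M * ζ := by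
    rw [← inner_sub_right, ← map_sub]
    have i1 : ⟪W.obs w, W.obs (u t - u t₀)⟫_ℝ ≤ (‖W.obs‖ * σ) * (‖W.obs‖ * (2 * M)) := by
      refine (real_inner_le_norm _ _).trans (mul_le_mul ((W.obs.le_opNorm _).trans
        (mul_le_mul_of_nonneg_left hwσ (norm_nonneg _))) ((W.obs.le_opNorm _).trans
        (mul_le_mul_of_nonneg_left ?_ (norm_nonneg _))) (norm_nonneg _) (by positivity))
      exact (norm_sub_le _ _).trans (by linarith [hu0.1, hut.1])
    calc _ ≤ b₀ * ((‖W.obs‖ * σ) * (‖W.obs‖ * (2 * M))) := mul_le_mul_of_nonneg_left i1 hb₀0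
      _ ≤ K * (d - t₀) * ((‖W.obs‖ * σ) * (‖W.obs‖ * (2 * M))) :=
          mul_le_mul_of_nonneg_right hb₀ (by positivity)
      _ = 2 * K * ‖W.obs‖ ^ 2 * M * ((d - t₀) * σ) := by ring
      _ = _ := by rw [hσ1]
  have g2 := abs_inner_add_inner_le hwσ hut.1 hqσ hut.2
  have g3 := abs_inner_add_inner_le hwσ hu0.1 hqσ hu0.2
  have g4 : μ * (⟪w, u t⟫_ℝ + ⟪q, v t⟫_ℝ) ≤ μ * (2 * (σ * M)) :=
    mul_le_mul_of_nonneg_left ((le_abs_self _).trans g2) hμ.le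
  have g5 : μ * -(⟪w, u t₀⟫_ℝ + ⟪q, v t₀⟫_ℝ) ≤ μ * (2 * (σ * M)) :=
    mul_le_mul_of_nonneg_left ((neg_le_abs _).trans g3) hμ.le
  have g6 : ζ / 4 * e t₀ ≤ ζ / 4 * (2 * M ^ 2) := by
    refine mul_le_mul_of_nonneg_left ?_ (by positivity)
    simp only [he]
    nlinarith [hu0.1, hu0.2, norm_nonneg (u t₀), norm_nonneg (v t₀)]
  have g7 : 0 ≤ ζ / 4 * e t := by positivity
  -- As the energy does not increase, the squared distance is at most `2 (e t₀ - ⟪U t₀, U t⟫)`, and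
  -- the lower bound on the inner product comes from `hfin`.
  rw [norm_sub_sq_real, norm_sub_sq_real, real_inner_comm, real_inner_comm (v t₀)]
  simp only [hΨ, he, real_inner_self_eq_norm_sq] at hfin
  simp only [he] at g6 g7
  rw [hR] at hRt hfin
  linarith

end DampedWave

end IntermittentDelay

namespace IntermittentDelay

open Filter Topology

/-- A point where `e` almost attains its infimum does it. For the limiting energy this means that
little is dissipated after `s`. -/
theorem exists_forall_sub_le_of_antitoneOn {e : ℝ → ℝ} {c d η : ℝ} (hcd : c < d)
    (he0 : ∀ t, 0 ≤ e t) (hη : 0 < η) : ∃ s ∈ Ico c d, ∀ t ∈ Ico c d, e s - e t ≤ η := by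
  have hne : (e '' Ico c d).Nonempty := ⟨e c, c, ⟨le_rfl, hcd⟩, rfl⟩
  have hbdd : BddBelow (e '' Ico c d) := ⟨0, by rintro _ ⟨t, -, rfl⟩; exact he0 t⟩
  obtain ⟨_, ⟨s, hs, rfl⟩, hlt⟩ := exists_lt_of_csInf_lt hne (lt_add_of_pos_right _ hη)
  exact ⟨s, hs, fun t ht => by linarith [csInf_le hbdd ⟨t, ht, rfl⟩]⟩

theorem exists_tendsto_left_of_forall_norm_sub_le {E : Type*} [NormedAddCommGroup E]
    [CompleteSpace E] {x : ℝ → E} {c d : ℝ}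
    (h : ∀ ε > 0, ∃ t₀ ∈ Ico c d, ∀ t ∈ Ico t₀ d, ‖x t - x t₀‖ ≤ ε) :
    ∃ y, Tendsto x (𝓝[<] d) (𝓝 y) := by
  refine cauchy_map_iff_exists_tendsto.mp (Metric.cauchy_iff.mpr ⟨inferInstance, fun ε hε => ?_⟩)
  obtain ⟨t₀, ht₀, hx⟩ := h (ε / 3) (by positivity)
  refine ⟨x '' Ico t₀ d, image_mem_map (Ico_mem_nhdsLT ht₀.2), ?_⟩
  rintro _ ⟨s, hs, rfl⟩ _ ⟨t, ht, rfl⟩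
  have h1 := hx s hs
  have h2 := hx t ht
  rw [dist_eq_norm]
  have h3 := norm_sub_le (x s - x t₀) (x t - x t₀)
  rw [sub_sub_sub_cancel_right] at h3
  linarith

namespace DampedWave

set_option linter.unusedSectionVars false

variable {V H U : Type*} [NormedAddCommGroup V] [InnerProductSpace ℝ V] [CompleteSpace V]
  [NormedAddCommGroup H] [InnerProductSpace ℝ H] [CompleteSpace H]
  [NormedAddCommGroup U] [InnerProductSpace ℝ U] [CompleteSpace U]
  (W : DampedWave V H U)

/-- The equation is undisturbed on `[c, d)`, where the damping coefficient is positive and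
degenerates at most like a `C^{1,1}` function as `t → d`. -/
structure Degenerates (c d K : ℝ) : Prop where
  pert_eq_zero : ∀ t, W.pert t = 0
  pert'_eq_zero : ∀ t, W.pert' t = 0
  nonneg : 0 ≤ K
  lt : c < d
  pos : ∀ t ∈ Ico c d, 0 < W.coeff t
  le_mul : ∀ t ∈ Ico c d, W.coeff t ≤ K * (d - t)
  deriv_sq_le : ∀ t ∈ Ico c d, W.coeff' t ^ 2 ≤ K * W.coeff t + 4 * W.coeff t ^ 2 / (d - t) ^ 2

variable {W} {c d K : ℝ}

theorem IsApproxSeq.energy_le {u₀ : V} {v₀ : H} {u : ℕ → ℝ → V} {v : ℕ → ℝ → H}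
    (h : W.IsApproxSeq 0 c d u₀ v₀ u v) (hD : ∀ t, W.pert t = 0) (k : ℕ) {t : ℝ}
    (ht : t ∈ Icc c d) : ‖u k t‖ ^ 2 + ‖v k t‖ ^ 2 ≤ ‖u₀‖ ^ 2 + ‖v₀‖ ^ 2 := by
  have h1 := (h.isApprox k).energy_antitone Nat.one_div_pos_of_nat hD ⟨le_rfl, ht.1.trans ht.2⟩ ht
    ht.1
  simpa only [h.fst_initial, h.snd_initial] using h1

namespace Degenerates

-- Combines `energy_deriv_le`, which bounds `(d - t₀)` times the time derivative, with `dist_sq_le`.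
-- Both are used for the approximations, and the error of order `μ` disappears in the limit with
-- `t₀` fixed.
set_option maxHeartbeats 600000 in
theorem exists_dist_sq_le_of_isRegular (hW : W.Degenerates c d K) {u₀ : V} {v₀ : H}
    (h₀ : W.IsRegular c u₀ v₀) {u : ℕ → ℝ → V} {v : ℕ → ℝ → H}
    (h : W.IsApproxSeq 0 c d u₀ v₀ u v) {x : ℝ → V} {y : ℝ → H}
    (hx : ∀ t ∈ Ico c d, Tendsto (fun k => u k t) atTop (𝓝 (x t)))
    (hy : ∀ t ∈ Ico c d, Tendsto (fun k => v k t) atTop (𝓝 (y t))) {ε : ℝ} (hε : 0 < ε) :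
    ∃ t₀ ∈ Ico c d, ∀ t ∈ Ico t₀ d, ‖x t - x t₀‖ ^ 2 + ‖y t - y t₀‖ ^ 2 ≤ ε := by
  set M : ℝ := √(‖u₀‖ ^ 2 + ‖v₀‖ ^ 2) with hM
  have hM0 : 0 ≤ M := Real.sqrt_nonneg _
  have huM : ∀ k, ∀ t ∈ Icc c d, ‖u k t‖ ≤ M ∧ ‖v k t‖ ≤ M := fun k t ht =>
    ⟨Real.le_sqrt_of_sq_le (by
      nlinarith [h.energy_le hW.pert_eq_zero k ht, sq_nonneg ‖v k t‖]),
    Real.le_sqrt_of_sq_le (by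
      nlinarith [h.energy_le hW.pert_eq_zero k ht, sq_nonneg ‖u k t‖])⟩
  set C : ℝ := 4 * K * ‖W.obs‖ ^ 2 * M + M ^ 2 + 4 * M + K * ‖W.obs‖ ^ 2 with hC
  have hK := hW.nonneg
  have hC0 : 0 ≤ C := by positivity
  set ζ : ℝ := ε / (C + 1) with hζ
  have hζ0 : 0 < ζ := by positivity
  set G : ℝ := Real.exp (K * ‖W.obs‖ ^ 2 / 2 * (d - c)) with hG
  have hG0 : 0 < G := Real.exp_pos _
  have hlim : ∀ t ∈ Ico c d, Tendsto (fun k => ‖u k t‖ ^ 2 + ‖v k t‖ ^ 2) atTop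
      (𝓝 (‖x t‖ ^ 2 + ‖y t‖ ^ 2)) := fun t ht =>
    ((hx t ht).norm.pow 2).add ((hy t ht).norm.pow 2)
  -- The order of choices matters: `s` makes the later energy loss small, and the bound `B` on the
  -- generator at `s` depends on it. Only then is `t₀` taken so near `d` that `(d - t₀)² B²` is
  -- negligible. The factor `4` rather than `2` leaves room for passing from the limit to large `k`.
  obtain ⟨s, hs, hse⟩ := exists_forall_sub_le_of_antitoneOn hW.lt
    (e := fun t => ‖x t‖ ^ 2 + ‖y t‖ ^ 2) (η := ζ ^ 2 / (4 * G)) (fun t => by positivity)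
    (by positivity)
  obtain ⟨B, hB⟩ := W.exists_bound_generator (T := s) hs.1
    (fun t ht => hW.pos t ⟨ht.1, ht.2.trans_lt hs.2⟩) (f := 0) (f' := fun _ => 0)
    (fun t => hasDerivAt_const t (0 : H)) continuous_const h₀
  have hBs : ∀ k : ℕ, ‖W.vhat (1 / ((k : ℝ) + 1)) s (u k s, v k s)‖ ≤ B ∧
      ‖W.accel (1 / ((k : ℝ) + 1)) s (u k s, v k s)‖ ≤ B := fun k =>
    hB _ (u k) (v k) Nat.one_div_pos_of_nat ((h.isApprox k).mono le_rfl hs.2.le)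
      (h.fst_initial k) (h.snd_initial k) s ⟨hs.1, le_rfl⟩
  obtain ⟨t₀, hst₀, ht₀d, hGt⟩ : ∃ t₀, s ≤ t₀ ∧ t₀ < d ∧
      G * ((d - t₀) ^ 2 * (2 * B ^ 2)) ≤ ζ ^ 2 / 2 := by
    have hcont : Tendsto (fun t : ℝ => G * ((d - t) ^ 2 * (2 * B ^ 2))) (𝓝[<] d)
        (𝓝 (G * ((d - d) ^ 2 * (2 * B ^ 2)))) :=
      (Continuous.tendsto (by fun_prop) d).mono_left nhdsWithin_le_nhds
    rw [sub_self, zero_pow two_ne_zero, zero_mul, mul_zero] at hcont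
    have h1 := (hcont.eventually_le_const (by positivity : 0 < ζ ^ 2 / 2)).and
      (Ico_mem_nhdsLT hs.2)
    obtain ⟨t₀, h2, h3⟩ := h1.exists
    exact ⟨t₀, h3.1, h3.2, h2⟩
  have ht₀ : t₀ ∈ Ico c d := ⟨hs.1.trans hst₀, ht₀d⟩
  refine ⟨t₀, ht₀, fun t ht => ?_⟩
  have hdt : 0 < d - t₀ := by linarith
  have hev : ∀ᶠ k in atTop, (‖u k s‖ ^ 2 + ‖v k s‖ ^ 2) - (‖u k t₀‖ ^ 2 + ‖v k t₀‖ ^ 2) ≤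
      ζ ^ 2 / (2 * G) := by
    refine ((hlim s hs).sub (hlim t₀ ht₀)).eventually_le_const ((hse t₀ ht₀).trans_lt ?_)
    exact div_lt_div_of_pos_left (by positivity) (by positivity) (by linarith)
  have hbound : ∀ᶠ k : ℕ in atTop, ‖u k t - u k t₀‖ ^ 2 + ‖v k t - v k t₀‖ ^ 2 ≤
      C * ζ + 16 * (1 / ((k : ℝ) + 1)) * (ζ / (d - t₀) * M) := by
    filter_upwards [hev] with k hk
    have hμ : (0 : ℝ) < 1 / ((k : ℝ) + 1) := Nat.one_div_pos_of_nat
    have h1 := (h.isApprox k).energy_deriv_le hμ hW.pert_eq_zero hW.pert'_eq_zero hW.pos hK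
      hW.deriv_sq_le hs.1 hst₀ ht₀d
    set X := ‖W.vhat (1 / ((k : ℝ) + 1)) t₀ (u k t₀, v k t₀)‖ with hX
    set Q := ‖W.accel (1 / ((k : ℝ) + 1)) t₀ (u k t₀, v k t₀)‖ with hQ
    obtain ⟨b1, b2⟩ := hBs k
    have h2 : (d - t₀) ^ 2 * (X ^ 2 + Q ^ 2) ≤ ζ ^ 2 := by
      have i1 : (d - t₀) ^ 2 * (X ^ 2 + Q ^ 2) ≤ (d - t₀) ^ 2 * (G * (B ^ 2 + B ^ 2
          + (ζ ^ 2 / (2 * G)) / (d - t₀) ^ 2)) := by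
        refine mul_le_mul_of_nonneg_left (h1.trans ?_) (sq_nonneg _)
        rw [← hG]
        gcongr
      refine i1.trans ?_
      have i2 : (d - t₀) ^ 2 * (G * (B ^ 2 + B ^ 2 + (ζ ^ 2 / (2 * G)) / (d - t₀) ^ 2)) =
          G * ((d - t₀) ^ 2 * (2 * B ^ 2)) + ζ ^ 2 / 2 := by
        field_simp
        ring
      rw [i2]
      linarith
    have hXζ : (d - t₀) * X ≤ ζ :=
      (abs_le_of_sq_le_sq' (by
        rw [mul_pow]; linarith [mul_nonneg (sq_nonneg (d - t₀)) (sq_nonneg Q)]) hζ0.le).2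
    have hQζ : (d - t₀) * Q ≤ ζ :=
      (abs_le_of_sq_le_sq' (by
        rw [mul_pow]; linarith [mul_nonneg (sq_nonneg (d - t₀)) (sq_nonneg X)]) hζ0.le).2
    exact (h.isApprox k).dist_sq_le hμ hW.pert_eq_zero hK hζ0 hW.le_mul ht₀.1 ht₀d (huM k) hXζ hQζ ht
  have htd : t ∈ Ico c d := ⟨ht₀.1.trans ht.1, ht.2⟩
  have hl1 : Tendsto (fun k => ‖u k t - u k t₀‖ ^ 2 + ‖v k t - v k t₀‖ ^ 2) atTop
      (𝓝 (‖x t - x t₀‖ ^ 2 + ‖y t - y t₀‖ ^ 2)) :=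
    (((hx t htd).sub (hx t₀ ht₀)).norm.pow 2).add (((hy t htd).sub (hy t₀ ht₀)).norm.pow 2)
  have hl2 : Tendsto (fun k : ℕ => C * ζ + 16 * (1 / ((k : ℝ) + 1)) * (ζ / (d - t₀) * M)) atTop
      (𝓝 (C * ζ + 16 * 0 * (ζ / (d - t₀) * M))) :=
    ((tendsto_one_div_add_atTop_nhds_zero_nat.const_mul 16).mul_const _).const_add _
  refine (le_of_tendsto_of_tendsto hl1 hl2 hbound).trans ?_
  have : (C + 1) * ζ = ε := by rw [hζ]; field_simp
  linarith

theorem exists_limits (hW : W.Degenerates c d K) {u₀ : V} {v₀ : H} {u : ℕ → ℝ → V}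
    {v : ℕ → ℝ → H} (h : W.IsApproxSeq 0 c d u₀ v₀ u v) :
    ∃ (x : ℝ → V) (y : ℝ → H), (∀ t ∈ Ico c d, Tendsto (fun k => u k t) atTop (𝓝 (x t))) ∧
      ∀ t ∈ Ico c d, Tendsto (fun k => v k t) atTop (𝓝 (y t)) := by
  have hlim : ∀ t, ∃ (x : V) (y : H), t ∈ Ico c d → Tendsto (fun k => u k t) atTop (𝓝 x) ∧
      Tendsto (fun k => v k t) atTop (𝓝 y) := fun t => by
    by_cases ht : t ∈ Ico c d
    · obtain ⟨⟨x, hx⟩, y, hy⟩ := (h.mono ht.2.le).exists_tendsto continuous_const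
        (fun s hs => hW.pos s ⟨hs.1, hs.2.trans_lt ht.2⟩) (t := t) ⟨ht.1, le_rfl⟩
      exact ⟨x, y, fun _ => ⟨hx, hy⟩⟩
    · exact ⟨0, 0, fun h => absurd h ht⟩
  choose x y hxy using hlim
  exact ⟨x, y, fun t ht => (hxy t ht).1, fun t ht => (hxy t ht).2⟩

/-- The free evolution does not increase the energy of differences, so regular data close to the
given ones stay close for all times before `d`, and the previous estimate carries over. -/
theorem exists_dist_sq_le (hW : W.Degenerates c d K) {u₀ : V} {v₀ : H} {u : ℕ → ℝ → V}
    {v : ℕ → ℝ → H} (h : W.IsApproxSeq 0 c d u₀ v₀ u v) {x : ℝ → V} {y : ℝ → H}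
    (hx : ∀ t ∈ Ico c d, Tendsto (fun k => u k t) atTop (𝓝 (x t)))
    (hy : ∀ t ∈ Ico c d, Tendsto (fun k => v k t) atTop (𝓝 (y t))) {ε : ℝ} (hε : 0 < ε) :
    ∃ t₀ ∈ Ico c d, ∀ t ∈ Ico t₀ d, ‖x t - x t₀‖ ^ 2 + ‖y t - y t₀‖ ^ 2 ≤ ε := by
  set η : ℝ := √(ε / 18) with hη
  have hη0 : 0 < η := Real.sqrt_pos.mpr (by positivity)
  have hη2 : η ^ 2 = ε / 18 := Real.sq_sqrt (by positivity)
  obtain ⟨a, b, hab, ha, hb⟩ := W.exists_isRegular_near c u₀ v₀ hη0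
  obtain ⟨u', v', h'⟩ := W.exists_isApproxSeq (f := 0) continuous_const hW.lt.le a b
  obtain ⟨x', y', hx', hy'⟩ := hW.exists_limits h'
  obtain ⟨t₀, ht₀, hle⟩ := hW.exists_dist_sq_le_of_isRegular hab h' hx' hy'
    (ε := ε / 9) (by positivity)
  have hclose : ∀ t ∈ Ico c d, ‖x' t - x t‖ ^ 2 + ‖y' t - y t‖ ^ 2 ≤ ε / 9 := by
    intro t ht
    refine le_of_tendsto ((((hx' t ht).sub (hx t ht)).norm.pow 2).add
      (((hy' t ht).sub (hy t ht)).norm.pow 2)) (Eventually.of_forall fun k => ?_)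
    have h1 := (h'.isApprox k).sub (h.isApprox k)
    rw [sub_zero] at h1
    have h2 := h1.energy_antitone Nat.one_div_pos_of_nat hW.pert_eq_zero ⟨le_rfl, hW.lt.le⟩
      (Ico_subset_Icc_self ht) ht.1
    simp only [Pi.sub_apply, h.fst_initial, h'.fst_initial, h.snd_initial, h'.snd_initial] at h2
    have h3 : ‖a - u₀‖ ^ 2 ≤ η ^ 2 := by gcongr
    have h4 : ‖b - v₀‖ ^ 2 ≤ η ^ 2 := by gcongr
    linarith
  refine ⟨t₀, ht₀, fun t ht => ?_⟩
  have i1 := hclose t ⟨ht₀.1.trans ht.1, ht.2⟩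
  have i2 := hclose t₀ ht₀
  have i3 := hle t ht
  have j1 := norm_sq_sub_le_three (x t) (x' t) (x' t₀) (x t₀)
  have j2 := norm_sq_sub_le_three (y t) (y' t) (y' t₀) (y t₀)
  rw [norm_sub_rev (x t) (x' t)] at j1
  rw [norm_sub_rev (y t) (y' t)] at j2
  linarith

end Degenerates

theorem continuousOn_Icc_update {E : Type*} [TopologicalSpace E] {x : ℝ → E} {l : E}
    (hx : ∀ T ∈ Ico c d, ContinuousOn x (Icc c T)) (hl : Tendsto x (𝓝[<] d) (𝓝 l)) :
    ContinuousOn (Function.update x d l) (Icc c d) := by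
  intro t ht
  rcases eq_or_lt_of_le ht.2 with rfl | htd
  · rw [continuousWithinAt_update_same]
    exact hl.mono_left (nhdsWithin_mono _ fun s hs => lt_of_le_of_ne hs.1.2 hs.2)
  · rw [continuousWithinAt_update_of_ne htd.ne]
    obtain ⟨T, hT1, hT2⟩ := exists_between htd
    refine ((hx T ⟨ht.1.trans hT1.le, hT2⟩) t ⟨ht.1, hT1.le⟩).mono_of_mem_nhdsWithin ?_
    exact mem_nhdsWithin.mpr ⟨Iio T, isOpen_Iio, hT1, fun s hs => ⟨hs.2.1, hs.1.le⟩⟩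

end DampedWave

end IntermittentDelay

/-! ### Uniqueness of weak solutions, and existence up to a zero of the damping. -/

namespace IntermittentDelay

open Filter Topology

theorem intervalIntegral_inner_left {E : Type*} [NormedAddCommGroup E] [InnerProductSpace ℝ E]
    [CompleteSpace E] {g : ℝ → E} {a b : ℝ} (hg : IntervalIntegrable g volume a b) (z : E) :
    ∫ s in a..b, ⟪g s, z⟫_ℝ = ⟪∫ s in a..b, g s, z⟫_ℝ := by
  have h := (innerSL ℝ z).intervalIntegral_comp_comm hg
  simp only [innerSL_apply_apply] at h
  rw [real_inner_comm, ← h]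
  exact intervalIntegral.integral_congr fun s _ => real_inner_comm _ _

theorem hasDerivAt_primitive {E : Type*} [NormedAddCommGroup E] [NormedSpace ℝ E]
    [CompleteSpace E] {g : ℝ → E} (hg : Continuous g) (c t : ℝ) :
    HasDerivAt (fun t => ∫ s in c..t, g s) (g t) t :=
  intervalIntegral.integral_hasDerivAt_right (hg.intervalIntegrable _ _)
    (hg.stronglyMeasurableAtFilter _ _) hg.continuousAt

theorem continuousOn_primitive_Icc {E : Type*} [NormedAddCommGroup E] [NormedSpace ℝ E]
    {g : ℝ → E} {c d : ℝ} (hcd : c ≤ d) (hg : ContinuousOn g (Icc c d)) :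
    ContinuousOn (fun t => ∫ s in c..t, g s) (Icc c d) := by
  rw [← uIcc_of_le hcd] at hg ⊢
  exact intervalIntegral.continuousOn_primitive_interval hg.integrableOn_uIcc

theorem exists_continuous_eqOn_Icc {E : Type*} [TopologicalSpace E] {g : ℝ → E} {c d : ℝ}
    (hcd : c ≤ d) (hg : ContinuousOn g (Icc c d)) : ∃ p : ℝ → E, Continuous p ∧ EqOn p g (Icc c d) :=
  ⟨fun t => g (projIcc c d hcd t),
    hg.comp_continuous (continuous_subtype_val.comp continuous_projIcc) fun t =>
      (projIcc c d hcd t).2, fun t ht => by simp [projIcc_of_mem hcd ht]⟩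

namespace DampedWave

set_option linter.unusedSectionVars false

variable {V H U : Type*} [NormedAddCommGroup V] [InnerProductSpace ℝ V] [CompleteSpace V]
  [NormedAddCommGroup H] [InnerProductSpace ℝ H] [CompleteSpace H]
  [NormedAddCommGroup U] [InnerProductSpace ℝ U] [CompleteSpace U]
  {W : DampedWave V H U} {c d K : ℝ} {f g : ℝ → H} {u x : ℝ → V} {v y : ℝ → H}

theorem continuousOn_force (W : DampedWave V H U) {s : Set ℝ} (hu : ContinuousOn u s) (z : V) :
    ContinuousOn (fun t => W.force t (u t) z) s := by
  have j1 : ContinuousOn (fun t => W.obs (u t)) s := W.obs.continuous.comp_continuousOn hu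
  have j2 : ContinuousOn (fun t => W.emb (u t)) s := W.emb.continuous.comp_continuousOn hu
  exact ((hu.inner continuousOn_const).neg.add
    (W.coeff'_continuous.continuousOn.mul (j1.inner continuousOn_const))).add
    ((W.pert'_continuous.continuousOn.clm_apply j2).inner continuousOn_const)

theorem continuousOn_momentum (W : DampedWave V H U) {s : Set ℝ} (hu : ContinuousOn u s)
    (hv : ContinuousOn v s) (z : V) : ContinuousOn (fun t => W.momentum t (u t) (v t) z) s := by
  have j1 : ContinuousOn (fun t => W.obs (u t)) s := W.obs.continuous.comp_continuousOn hu
  have j2 : ContinuousOn (fun t => W.emb (u t)) s := W.emb.continuous.comp_continuousOn hu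
  exact ((hv.inner continuousOn_const).add
    (W.coeff_continuous.continuousOn.mul (j1.inner continuousOn_const))).add
    ((W.pert_continuous.continuousOn.clm_apply j2).inner continuousOn_const)

namespace IsWeak

theorem mono {T : ℝ} (h : W.IsWeak f c d u v) (hT : T ≤ d) : W.IsWeak f c T u v :=
  ⟨h.continuousOn_fst.mono (Icc_subset_Icc_right hT), h.continuousOn_snd.mono
    (Icc_subset_Icc_right hT), fun t ht => h.displacement t ⟨ht.1, ht.2.trans hT⟩,
    fun t ht z => h.balance t ⟨ht.1, ht.2.trans hT⟩ z⟩

theorem congr (h : W.IsWeak f c d u v) (hx : EqOn x u (Icc c d)) (hy : EqOn y v (Icc c d))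
    (hg : EqOn g f (Icc c d)) : W.IsWeak g c d x y := by
  have hsub : ∀ t ∈ Icc c d, uIcc c t ⊆ Icc c d := fun t ht => by
    rw [uIcc_of_le ht.1]; exact Icc_subset_Icc_right ht.2
  have hc : ∀ t ∈ Icc c d, c ∈ Icc c d := fun t ht => ⟨le_rfl, ht.1.trans ht.2⟩
  refine ⟨h.continuousOn_fst.congr hx, h.continuousOn_snd.congr hy, fun t ht => ?_,
    fun t ht z => ?_⟩
  · rw [hx ht, hx (hc t ht), h.displacement t ht]
    exact intervalIntegral.integral_congr fun s hs => (hy (hsub t ht hs)).symm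
  · rw [hx ht, hx (hc t ht), hy ht, hy (hc t ht), h.balance t ht]
    refine intervalIntegral.integral_congr fun s hs => ?_
    simp only [hx (hsub t ht hs), hg (hsub t ht hs)]

theorem sub (hf : Continuous f) (h₁ : W.IsWeak f c d u v) (h₂ : W.IsWeak f c d x y) :
    W.IsWeak 0 c d (u - x) (v - y) := by
  have hsub : ∀ t ∈ Icc c d, uIcc c t ⊆ Icc c d := fun t ht => by
    rw [uIcc_of_le ht.1]; exact Icc_subset_Icc_right ht.2
  refine ⟨h₁.continuousOn_fst.sub h₂.continuousOn_fst,
    h₁.continuousOn_snd.sub h₂.continuousOn_snd, fun t ht => ?_, fun t ht z => ?_⟩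
  · simp only [Pi.sub_apply, map_sub]
    rw [intervalIntegral.integral_sub
      (h₁.continuousOn_snd.mono (hsub t ht)).intervalIntegrable
      (h₂.continuousOn_snd.mono (hsub t ht)).intervalIntegrable,
      ← h₁.displacement t ht, ← h₂.displacement t ht]
    abel
  · have i1 : IntervalIntegrable (fun s => W.force s (u s) z + ⟪f s, W.emb z⟫_ℝ) volume c t :=
      (((W.continuousOn_force h₁.continuousOn_fst z).mono (hsub t ht)).add
        (hf.continuousOn.inner continuousOn_const)).intervalIntegrable
    have i2 : IntervalIntegrable (fun s => W.force s (x s) z + ⟪f s, W.emb z⟫_ℝ) volume c t :=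
      (((W.continuousOn_force h₂.continuousOn_fst z).mono (hsub t ht)).add
        (hf.continuousOn.inner continuousOn_const)).intervalIntegrable
    have e1 := h₁.balance t ht z
    have e2 := h₂.balance t ht z
    have e3 := intervalIntegral.integral_sub i1 i2
    have e4 : ∫ s in c..t, (W.force s ((u - x) s) z + ⟪(0 : ℝ → H) s, W.emb z⟫_ℝ) =
        ∫ s in c..t, ((W.force s (u s) z + ⟪f s, W.emb z⟫_ℝ)
          - (W.force s (x s) z + ⟪f s, W.emb z⟫_ℝ)) := by
      refine intervalIntegral.integral_congr fun s _ => ?_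
      simp only [force, Pi.sub_apply, Pi.zero_apply, map_sub, inner_sub_left, inner_zero_left]
      ring
    rw [e4, e3, ← e1, ← e2]
    simp only [momentum, Pi.sub_apply, map_sub, inner_sub_left]
    ring

/-- A weak solution with vanishing data vanishes where the damping coefficient is positive. -/
theorem eq_zero (h : W.IsWeak 0 c d u v) (hb : ∀ t ∈ Icc c d, 0 < W.coeff t) (hu : u c = 0)
    (hv : v c = 0) : ∀ t ∈ Icc c d, u t = 0 := by
  intro t₁ ht₁
  have hcd : c ≤ d := ht₁.1.trans ht₁.2
  have hc : c ∈ Icc c d := ⟨le_rfl, hcd⟩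
  have hsub : ∀ t ∈ Icc c d, uIcc c t ⊆ Icc c d := fun t ht => by
    rw [uIcc_of_le ht.1]; exact Icc_subset_Icc_right ht.2
  obtain ⟨tm, htm, hmin⟩ := isCompact_Icc.exists_isMinOn ⟨c, hc⟩
    (W.coeff_continuous.continuousOn (s := Icc c d))
  set b₀ := W.coeff tm with hb₀
  have hb₀0 : 0 < b₀ := hb tm htm
  have hbb : ∀ t ∈ Icc c d, b₀ ≤ W.coeff t := fun t ht => hmin ht
  obtain ⟨K₁, hK₁0, hK₁⟩ := exists_norm_le_on_Icc (c := c) (d := d) W.coeff'_continuous.continuousOn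
  obtain ⟨K₂, hK₂0, hK₂⟩ := exists_norm_le_on_Icc (c := c) (d := d) W.pert_continuous.continuousOn
  obtain ⟨K₃, hK₃0, hK₃⟩ := exists_norm_le_on_Icc (c := c) (d := d) W.pert'_continuous.continuousOn
  obtain ⟨p, hpc, hpu⟩ := exists_continuous_eqOn_Icc hcd h.continuousOn_fst
  obtain ⟨r, hrc, hrv⟩ := exists_continuous_eqOn_Icc hcd h.continuousOn_snd
  have hGc : Continuous fun s => W.coeff' s • W.obs (p s) :=
    W.coeff'_continuous.smul (W.obs.continuous.comp hpc)
  have hQc : Continuous fun s => W.pert' s (W.emb (p s)) :=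
    W.pert'_continuous.clm_apply (W.emb.continuous.comp hpc)
  set X : ℝ → V := fun t => ∫ s in c..t, p s with hX
  set G : ℝ → U := fun t => ∫ s in c..t, W.coeff' s • W.obs (p s) with hG
  set Q : ℝ → H := fun t => ∫ s in c..t, W.pert' s (W.emb (p s)) with hQ
  set E : ℝ → H := fun t => ∫ s in c..t, r s with hE
  have hEu : ∀ t ∈ Icc c d, W.emb (p t) = E t := by
    intro t ht
    have h1 := h.displacement t ht
    rw [hu, map_zero, sub_zero] at h1
    rw [hpu ht, h1]
    exact intervalIntegral.integral_congr fun s hs => (hrv (hsub t ht hs)).symm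
  -- The balance is tested with the displacement at the same time. Then `⟪E, r⟫` and `⟪X, p⟫` are
  -- half the derivatives of `‖E‖²` and `‖X‖²`, and the terms with `L p` are absorbed by the
  -- coercive `b ‖L p‖²` because `b ≥ b₀ > 0`.
  have hbal : ∀ t ∈ Icc c d, ⟪E t, r t⟫_ℝ + W.coeff t * ‖W.obs (p t)‖ ^ 2
      + ⟪W.pert t (E t), E t⟫_ℝ = -⟪X t, p t⟫_ℝ + ⟪G t, W.obs (p t)⟫_ℝ + ⟪Q t, E t⟫_ℝ := by
    intro t ht
    have h1 := h.balance t ht (p t)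
    have h2 : ∫ s in c..t, (W.force s (u s) (p t) + ⟪(0 : ℝ → H) s, W.emb (p t)⟫_ℝ) =
        ∫ s in c..t, (-⟪p s, p t⟫_ℝ + ⟪W.coeff' s • W.obs (p s), W.obs (p t)⟫_ℝ
          + ⟪W.pert' s (W.emb (p s)), W.emb (p t)⟫_ℝ) := by
      refine intervalIntegral.integral_congr fun s hs => ?_
      simp only [force, ← hpu (hsub t ht hs), Pi.zero_apply, inner_zero_left, real_inner_smul_left,
        add_zero]
    have i1 : IntervalIntegrable (fun s => -⟪p s, p t⟫_ℝ) volume c t :=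
      (hpc.inner continuous_const).neg.intervalIntegrable _ _
    have i2 : IntervalIntegrable (fun s => ⟪W.coeff' s • W.obs (p s), W.obs (p t)⟫_ℝ) volume c t :=
      (hGc.inner continuous_const).intervalIntegrable _ _
    have i3 : IntervalIntegrable (fun s => ⟪W.pert' s (W.emb (p s)), W.emb (p t)⟫_ℝ) volume c t :=
      (hQc.inner continuous_const).intervalIntegrable _ _
    rw [h2, intervalIntegral.integral_add (i1.add i2) i3, intervalIntegral.integral_add i1 i2,
      intervalIntegral.integral_neg, intervalIntegral_inner_left (hpc.intervalIntegrable _ _),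
      intervalIntegral_inner_left (hGc.intervalIntegrable _ _),
      intervalIntegral_inner_left (hQc.intervalIntegrable _ _), hEu t ht, ← hpu ht, ← hrv ht] at h1
    simp only [momentum, hu, hv, map_zero, inner_zero_left, mul_zero, add_zero, sub_zero, hEu t ht,
      real_inner_self_eq_norm_sq] at h1
    rw [real_inner_comm (r t)]
    exact h1
  have hder : ∀ t ∈ Icc c d, HasDerivAt
      (fun t => ‖E t‖ ^ 2 + ‖X t‖ ^ 2 + ‖G t‖ ^ 2 + ‖Q t‖ ^ 2)
      (2 * ⟪E t, r t⟫_ℝ + 2 * ⟪X t, p t⟫_ℝ + 2 * ⟪G t, W.coeff' t • W.obs (p t)⟫_ℝ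
        + 2 * ⟪Q t, W.pert' t (W.emb (p t))⟫_ℝ) t := fun t _ =>
    (((hasDerivAt_primitive hrc c t).norm_sq.add (hasDerivAt_primitive hpc c t).norm_sq).add
      (hasDerivAt_primitive hGc c t).norm_sq).add (hasDerivAt_primitive hQc c t).norm_sq
  set C : ℝ := 2 * K₂ + (1 + K₁) ^ 2 / (2 * b₀) + (1 + K₃) with hC
  have hC0 : 0 ≤ (1 + K₁) ^ 2 / (2 * b₀) := by positivity
  have hle := le_exp_mul_of_hasDerivAt (K := C) (ε := 0) (by positivity) le_rfl hder
    (fun t ht => by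
      have h1 := hbal t ht
      rw [hEu t ht, real_inner_smul_right]
      set z := ‖W.obs (p t)‖ with hz
      have hz0 : 0 ≤ z := norm_nonneg _
      have j1 : -⟪W.pert t (E t), E t⟫_ℝ ≤ K₂ * ‖E t‖ ^ 2 := by
        refine (neg_le_abs _).trans ((abs_real_inner_le_norm _ _).trans ?_)
        rw [pow_two, ← mul_assoc]
        exact mul_le_mul_of_nonneg_right (((W.pert t).le_opNorm _).trans
          (mul_le_mul_of_nonneg_right (hK₂ t ht) (norm_nonneg _))) (norm_nonneg _)
      have j2 : ⟪G t, W.obs (p t)⟫_ℝ ≤ ‖G t‖ * z := real_inner_le_norm _ _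
      have j3 : W.coeff' t * ⟪G t, W.obs (p t)⟫_ℝ ≤ K₁ * (‖G t‖ * z) := by
        refine (le_abs_self _).trans ?_
        rw [abs_mul]
        exact mul_le_mul (hK₁ t ht) (abs_real_inner_le_norm _ _) (abs_nonneg _) hK₁0
      have j4 : ⟪Q t, E t⟫_ℝ ≤ ‖Q t‖ * ‖E t‖ := real_inner_le_norm _ _
      have j5 : ⟪Q t, W.pert' t (E t)⟫_ℝ ≤ ‖Q t‖ * (K₃ * ‖E t‖) :=
        (real_inner_le_norm _ _).trans (mul_le_mul_of_nonneg_left (((W.pert' t).le_opNorm _).trans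
          (mul_le_mul_of_nonneg_right (hK₃ t ht) (norm_nonneg _))) (norm_nonneg _))
      have j6 : b₀ * z ^ 2 ≤ W.coeff t * z ^ 2 :=
        mul_le_mul_of_nonneg_right (hbb t ht) (sq_nonneg _)
      have j7 : 2 * ((1 + K₁) * (‖G t‖ * z)) ≤ 2 * (b₀ * z ^ 2)
          + (1 + K₁) ^ 2 / (2 * b₀) * ‖G t‖ ^ 2 := by
        have e : 2 * (b₀ * z ^ 2) + (1 + K₁) ^ 2 / (2 * b₀) * ‖G t‖ ^ 2
            - 2 * ((1 + K₁) * (‖G t‖ * z)) = (2 * b₀ * z - (1 + K₁) * ‖G t‖) ^ 2 / (2 * b₀) := by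
          field_simp
          ring
        have : 0 ≤ (2 * b₀ * z - (1 + K₁) * ‖G t‖) ^ 2 / (2 * b₀) := by positivity
        linarith
      have j8 : 2 * ((1 + K₃) * (‖Q t‖ * ‖E t‖)) ≤ (1 + K₃) * (‖Q t‖ ^ 2 + ‖E t‖ ^ 2) := by
        have : 0 ≤ (1 + K₃) * (‖Q t‖ - ‖E t‖) ^ 2 := by positivity
        linarith
      have j9 : 0 ≤ (2 * K₂ + (1 + K₁) ^ 2 / (2 * b₀)) * (‖X t‖ ^ 2 + ‖Q t‖ ^ 2)
          + (1 + K₃) * (‖X t‖ ^ 2 + ‖G t‖ ^ 2) + (1 + K₁) ^ 2 / (2 * b₀) * ‖E t‖ ^ 2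
          + 2 * K₂ * ‖G t‖ ^ 2 := by positivity
      rw [hC]
      linarith) t₁ ht₁
  simp only [hE, hX, hG, hQ, intervalIntegral.integral_same, norm_zero] at hle
  have hE0 : ‖E t₁‖ ^ 2 ≤ 0 := by
    have h1 := sq_nonneg ‖X t₁‖
    have h2 := sq_nonneg ‖G t₁‖
    have h3 := sq_nonneg ‖Q t₁‖
    simp only [hE, hX, hG, hQ] at h1 h2 h3 ⊢
    linarith
  have hE1 : E t₁ = 0 := norm_eq_zero.mp (pow_eq_zero_iff two_ne_zero |>.mp
    (le_antisymm hE0 (sq_nonneg _)))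
  rw [← hpu ht₁]
  exact W.emb_injective (by rw [hEu t₁ ht₁, hE1, map_zero])

/-- Uniqueness of weak solutions. -/
theorem eqOn (hf : Continuous f) (hb : ∀ t ∈ Ico c d, 0 < W.coeff t) (hcd : c < d)
    (h₁ : W.IsWeak f c d u v) (h₂ : W.IsWeak f c d x y) (hux : u c = x c) (hvy : v c = y c) :
    EqOn u x (Icc c d) := by
  have hcl : Icc c d ⊆ closure (Ico c d) := by rw [closure_Ico hcd.ne]
  refine EqOn.of_subset_closure (s := Ico c d) (fun t ht => ?_) h₁.continuousOn_fst
    h₂.continuousOn_fst Ico_subset_Icc_self hcl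
  have h := h₁.sub hf h₂
  have h' : W.IsWeak 0 c t (u - x) (v - y) := h.mono ht.2.le
  exact sub_eq_zero.mp (h'.eq_zero (fun s hs => hb s ⟨hs.1, hs.2.trans_lt ht.2⟩)
    (by simp [hux]) (by simp [hvy]) t ⟨ht.1, le_rfl⟩)

end IsWeak

/-- Both sides of each identity are continuous up to `d`. -/
theorem isWeak_of_forall_lt (hcd : c < d) (hf : Continuous f) (hu : ContinuousOn u (Icc c d))
    (hv : ContinuousOn v (Icc c d)) (h : ∀ T ∈ Ico c d, W.IsWeak f c T u v) :
    W.IsWeak f c d u v := by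
  have hcl : Icc c d ⊆ closure (Ico c d) := by rw [closure_Ico hcd.ne]
  refine ⟨hu, hv, ?_, fun t ht z => ?_⟩
  · exact EqOn.of_subset_closure (s := Ico c d) (fun t ht => (h t ht).displacement t ⟨ht.1, le_rfl⟩)
      ((W.emb.continuous.comp_continuousOn hu).sub continuousOn_const)
      (continuousOn_primitive_Icc hcd.le hv) Ico_subset_Icc_self hcl
  · exact EqOn.of_subset_closure (s := Ico c d)
      (f := fun t => W.momentum t (u t) (v t) z - W.momentum c (u c) (v c) z)
      (fun t ht => (h t ht).balance t ⟨ht.1, le_rfl⟩ z)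
      ((W.continuousOn_momentum hu hv z).sub continuousOn_const)
      (continuousOn_primitive_Icc hcd.le ((W.continuousOn_force hu z).add
        (hf.continuousOn.inner continuousOn_const))) Ico_subset_Icc_self hcl ht

/-- Existence when the damping coefficient vanishes at the right end point. -/
theorem Degenerates.exists_isWeak (hW : W.Degenerates c d K) (u₀ : V) (v₀ : H) :
    ∃ u v, W.IsWeak 0 c d u v ∧ u c = u₀ ∧ v c = v₀ := by
  obtain ⟨u, v, h⟩ := W.exists_isApproxSeq (f := 0) continuous_const hW.lt.le u₀ v₀
  obtain ⟨x, y, hx, hy⟩ := hW.exists_limits h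
  have hweak : ∀ T ∈ Ico c d, W.IsWeak 0 c T x y := fun T hT =>
    (h.mono hT.2.le).isWeak continuous_const hT.1 (fun s hs => hW.pos s ⟨hs.1, hs.2.trans_lt hT.2⟩)
      (fun t ht => hx t ⟨ht.1, ht.2.trans_lt hT.2⟩) (fun t ht => hy t ⟨ht.1, ht.2.trans_lt hT.2⟩)
  obtain ⟨l, hl⟩ := exists_tendsto_left_of_forall_norm_sub_le (x := x) (c := c) (d := d)
    fun ε hε => by
      obtain ⟨t₀, ht₀, hle⟩ := hW.exists_dist_sq_le h hx hy (ε := ε ^ 2) (by positivity)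
      exact ⟨t₀, ht₀, fun t ht => (abs_le_of_sq_le_sq' (by
        nlinarith [hle t ht, sq_nonneg ‖y t - y t₀‖]) hε.le).2⟩
  obtain ⟨m, hm⟩ := exists_tendsto_left_of_forall_norm_sub_le (x := y) (c := c) (d := d)
    fun ε hε => by
      obtain ⟨t₀, ht₀, hle⟩ := hW.exists_dist_sq_le h hx hy (ε := ε ^ 2) (by positivity)
      exact ⟨t₀, ht₀, fun t ht => (abs_le_of_sq_le_sq' (by
        nlinarith [hle t ht, sq_nonneg ‖x t - x t₀‖]) hε.le).2⟩
  have hc : c ∈ Ico c d := ⟨le_rfl, hW.lt⟩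
  refine ⟨Function.update x d l, Function.update y d m, isWeak_of_forall_lt hW.lt continuous_const
    (continuousOn_Icc_update (fun T hT => (hweak T hT).continuousOn_fst) hl)
    (continuousOn_Icc_update (fun T hT => (hweak T hT).continuousOn_snd) hm)
    (fun T hT => (hweak T hT).congr (fun t ht => ?_) (fun t ht => ?_) (fun _ _ => rfl)), ?_, ?_⟩
  · exact Function.update_of_ne (ht.2.trans_lt hT.2).ne _ _
  · exact Function.update_of_ne (ht.2.trans_lt hT.2).ne _ _
  · rw [Function.update_of_ne hW.lt.ne]
    exact tendsto_nhds_unique (hx c hc) (by simp [h.fst_initial])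
  · rw [Function.update_of_ne hW.lt.ne]
    exact tendsto_nhds_unique (hy c hc) (by simp [h.snd_initial])

end DampedWave

end IntermittentDelay

/-! ### Weak derivatives and the regularity of the damping coefficient. -/

namespace IntermittentDelay

open Filter Topology

theorem integral_Ioo_eq_intervalIntegral {E : Type*} [NormedAddCommGroup E] [NormedSpace ℝ E]
    {a b : ℝ} (hab : a ≤ b) (f : ℝ → E) : ∫ s in Ioo a b, f s = ∫ s in a..b, f s := by
  rw [intervalIntegral.integral_of_le hab, integral_Ioc_eq_integral_Ioo]

namespace IsTestFunction

variable {φ ψ : ℝ → ℝ} {a b : ℝ}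

theorem eq_zero (hφ : IsTestFunction φ a b) {t : ℝ} (ht : t ∉ Ioo a b) : φ t = 0 :=
  image_eq_zero_of_notMem_tsupport fun h => ht (hφ.2.2 h)

theorem hasDerivAt (hφ : IsTestFunction φ a b) (t : ℝ) : HasDerivAt φ (deriv φ t) t :=
  (hφ.1.differentiable (by simp)).differentiableAt.hasDerivAt

theorem continuous (hφ : IsTestFunction φ a b) : Continuous φ := hφ.1.continuous

theorem continuous_deriv (hφ : IsTestFunction φ a b) : Continuous (deriv φ) :=
  hφ.1.continuous_deriv (by simp)

theorem sub_smul (hφ : IsTestFunction φ a b) (hψ : IsTestFunction ψ a b) (c : ℝ) :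
    IsTestFunction (fun t => φ t - c * ψ t) a b := by
  have hK : ∀ x, x ∉ tsupport φ ∪ tsupport ψ → φ x - c * ψ x = 0 := fun x hx => by
    rw [mem_union, not_or] at hx
    rw [image_eq_zero_of_notMem_tsupport hx.1, image_eq_zero_of_notMem_tsupport hx.2]
    simp
  have hKc : IsCompact (tsupport φ ∪ tsupport ψ) := hφ.2.1.isCompact.union hψ.2.1.isCompact
  refine ⟨hφ.1.sub (contDiff_const.mul hψ.1), HasCompactSupport.intro hKc hK, ?_⟩
  refine (closure_minimal (fun x hx => ?_) hKc.isClosed).trans (union_subset hφ.2.2 hψ.2.2)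
  by_contra h
  exact hx (hK x h)

/-- A test function with vanishing mean is the derivative of a test function. -/
theorem exists_deriv_eq (hφ : IsTestFunction φ a b) (hab : a < b)
    (h0 : ∫ s in a..b, φ s = 0) : ∃ χ, IsTestFunction χ a b ∧ deriv χ = φ := by
  obtain ⟨p, q, hap, hpq, hqb, hout⟩ : ∃ p q, a < p ∧ p ≤ q ∧ q < b ∧ ∀ t, t ∉ Icc p q → φ t = 0 := by
    rcases (tsupport φ).eq_empty_or_nonempty with he | hne
    · refine ⟨(a + b) / 2, (a + b) / 2, by linarith, le_rfl, by linarith, fun t _ => ?_⟩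
      exact image_eq_zero_of_notMem_tsupport (by rw [he]; exact notMem_empty t)
    · obtain ⟨p, hp, hpl⟩ := hφ.2.1.isCompact.exists_isLeast hne
      obtain ⟨q, hq, hql⟩ := hφ.2.1.isCompact.exists_isGreatest hne
      exact ⟨p, q, (hφ.2.2 hp).1, hpl hq, (hφ.2.2 hq).2, fun t ht =>
        image_eq_zero_of_notMem_tsupport fun h => ht ⟨hpl h, hql h⟩⟩
  have hder : ∀ t, HasDerivAt (fun t => ∫ s in a..t, φ s) (φ t) t := hasDerivAt_primitive hφ.continuous a
  have hd : deriv (fun t => ∫ s in a..t, φ s) = φ := funext fun t => (hder t).deriv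
  -- To the left of `p` nothing has been integrated yet; to the right of `q` the whole integral has
  -- been, and it vanishes.
  have hK : ∀ t, t ∉ Icc p q → ∫ s in a..t, φ s = 0 := by
    intro t ht
    rcases lt_or_ge t p with h | h
    · refine (intervalIntegral.integral_congr (g := fun _ => (0 : ℝ)) fun s hs => hout s ?_).trans
        (by simp)
      exact fun hs' => absurd hs'.1 (not_le.mpr (lt_of_le_of_lt hs.2 (max_lt hap h)))
    · have h : q < t := not_le.mp fun h' => ht ⟨h, h'⟩
      rw [← intervalIntegral.integral_add_adjacent_intervals
        (hφ.continuous.intervalIntegrable a b) (hφ.continuous.intervalIntegrable b t), h0, zero_add]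
      refine (intervalIntegral.integral_congr (g := fun _ => (0 : ℝ)) fun s hs => hout s ?_).trans
        (by simp)
      exact fun hs' => absurd hs'.2 (not_le.mpr (lt_of_lt_of_le (lt_min hqb h) hs.1))
  refine ⟨fun t => ∫ s in a..t, φ s, ⟨contDiff_infty_iff_deriv.mpr
    ⟨fun t => (hder t).differentiableAt, by rw [hd]; exact hφ.1⟩, HasCompactSupport.intro isCompact_Icc hK, ?_⟩, hd⟩
  refine (closure_minimal (fun x hx => ?_) isClosed_Icc).trans (Icc_subset_Ioo hap hqb)
  by_contra h
  exact hx (hK x h)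

end IsTestFunction

theorem exists_isTestFunction_integral_eq_one {a b : ℝ} (hab : a < b) :
    ∃ χ, IsTestFunction χ a b ∧ ∫ s in a..b, χ s = 1 := by
  let f : ContDiffBump ((a + b) / 2) := ⟨(b - a) / 8, (b - a) / 4, by linarith, by linarith⟩
  have hsub : tsupport f ⊆ Ioo a b := by
    rw [f.tsupport_eq, Real.closedBall_eq_Icc]
    refine Icc_subset_Ioo ?_ ?_ <;> simp only [f] <;> linarith
  have hpos : 0 < ∫ s in a..b, f s := by
    refine intervalIntegral.integral_pos hab f.continuous.continuousOn (fun s _ => f.nonneg)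
      ⟨(a + b) / 2, ⟨by linarith, by linarith⟩, f.pos_of_mem_ball (Metric.mem_ball_self f.rOut_pos)⟩
  refine ⟨fun s => (∫ s in a..b, f s)⁻¹ * f s, ⟨contDiff_const.mul f.contDiff,
    f.hasCompactSupport.mul_left, ?_⟩, ?_⟩
  · exact (tsupport_mul_subset_right (f := fun _ => (∫ s in a..b, f s)⁻¹) (g := f)).trans hsub
  · rw [intervalIntegral.integral_const_mul, inv_mul_cancel₀ hpos.ne']

/-- The lemma of du Bois-Reymond. -/
theorem exists_ae_eq_const_of_integral_mul_deriv_eq_zero {P : ℝ → ℝ} {a b : ℝ} (hab : a < b)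
    (hP : IntervalIntegrable P volume a b)
    (h : ∀ φ, IsTestFunction φ a b → ∫ s in a..b, P s * deriv φ s = 0) :
    ∃ C, ∀ᵐ s, s ∈ Ioo a b → P s = C := by
  obtain ⟨χ, hχ, hχ1⟩ := exists_isTestFunction_integral_eq_one hab
  set C := ∫ s in a..b, P s * χ s with hC
  have hloc : LocallyIntegrableOn (fun s => P s - C) (Ioo a b) volume :=
    (((intervalIntegrable_iff_integrableOn_Ioo_of_le hab.le).mp hP).sub
      ((intervalIntegrable_iff_integrableOn_Ioo_of_le hab.le).mp
        intervalIntegrable_const)).locallyIntegrableOn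
  -- Subtracting `(∫ ψ) χ` from `ψ` gives mean zero, hence the derivative of a test function; `C` is
  -- the pairing of `P` with `χ`.
  have hz := isOpen_Ioo.ae_eq_zero_of_integral_contDiff_smul_eq_zero hloc fun ψ h1 h2 h3 => by
    have hψ : IsTestFunction ψ a b := ⟨h1, h2, h3⟩
    obtain ⟨φ, hφ, hd⟩ := (hψ.sub_smul hχ (∫ s in a..b, ψ s)).exists_deriv_eq hab (by
      rw [intervalIntegral.integral_sub (hψ.continuous.intervalIntegrable _ _)
        ((hχ.continuous.const_mul _).intervalIntegrable _ _), intervalIntegral.integral_const_mul,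
        hχ1, mul_one, sub_self])
    have h4 := h φ hφ
    have i1 : IntervalIntegrable (fun s => P s * ψ s) volume a b :=
      hP.mul_continuousOn hψ.continuous.continuousOn
    have i2 : IntervalIntegrable (fun s => P s * χ s) volume a b :=
      hP.mul_continuousOn hχ.continuous.continuousOn
    have h5 : ∫ s in a..b, P s * deriv φ s
        = (∫ s in a..b, P s * ψ s) - (∫ s in a..b, ψ s) * ∫ s in a..b, P s * χ s := by
      rw [← intervalIntegral.integral_const_mul, ← intervalIntegral.integral_sub i1 (i2.const_mul _)]
      refine intervalIntegral.integral_congr fun s _ => ?_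
      simp only [hd]
      ring
    have h6 : ∫ s, ψ s • (P s - C) = ∫ s in a..b, ψ s • (P s - C) := by
      rw [← integral_Ioo_eq_intervalIntegral hab.le, setIntegral_eq_integral_of_forall_compl_eq_zero]
      intro s hs
      rw [hψ.eq_zero hs, zero_smul]
    rw [h6]
    have h7 : ∫ s in a..b, ψ s • (P s - C)
        = (∫ s in a..b, P s * ψ s) - C * ∫ s in a..b, ψ s := by
      rw [← intervalIntegral.integral_const_mul, ← intervalIntegral.integral_sub i1
        ((hψ.continuous.const_mul _).intervalIntegrable _ _)]
      refine intervalIntegral.integral_congr fun s _ => ?_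
      simp only [smul_eq_mul]
      ring
    rw [h7]
    linarith
  refine ⟨C, ?_⟩
  filter_upwards [hz] with s hs hsI
  exact sub_eq_zero.mp (hs hsI)

/-- Integration by parts for absolutely continuous functions; the boundary terms vanish with `φ`. -/
theorem integral_primitive_mul_deriv {g φ : ℝ → ℝ} {a b : ℝ}
    (hg : IntervalIntegrable g volume a b) (hφ : IsTestFunction φ a b) :
    ∫ s in a..b, (∫ r in a..s, g r) * deriv φ s = -∫ s in a..b, g s * φ s := by
  have hG := hg.absolutelyContinuousOnInterval_intervalIntegral (c := a) left_mem_uIcc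
  have hφc : AbsolutelyContinuousOnInterval φ a b :=
    (hφ.1.of_le (by simp)).contDiffOn.absolutelyContinuousOnInterval
  rw [hG.integral_mul_deriv_eq_deriv_mul hφc, hφ.eq_zero (by simp), hφ.eq_zero (by simp)]
  simp only [mul_zero, sub_zero, zero_sub, neg_inj]
  refine intervalIntegral.integral_congr_ae ?_
  filter_upwards [hg.ae_hasDerivAt_integral] with s hs hsI
  rw [(hs (uIoc_subset_uIcc hsI) a left_mem_uIcc).deriv]

theorem HasWeakDeriv.exists_ae_eq_primitive {f g : ℝ → ℝ} {a b : ℝ} (hab : a < b)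
    (hf : IntervalIntegrable f volume a b) (hg : IntervalIntegrable g volume a b)
    (h : HasWeakDeriv f g a b) : ∃ C, ∀ᵐ s, s ∈ Ioo a b → f s = C + ∫ r in a..s, g r := by
  have hGc : ContinuousOn (fun s => ∫ r in a..s, g r) (uIcc a b) :=
    intervalIntegral.continuousOn_primitive_interval (by
      rw [uIcc_of_le hab.le]
      exact (intervalIntegrable_iff_integrableOn_Icc_of_le hab.le).mp hg)
  obtain ⟨C, hC⟩ := exists_ae_eq_const_of_integral_mul_deriv_eq_zero
    (P := fun s => f s - ∫ r in a..s, g r) hab (hf.sub hGc.intervalIntegrable) fun φ hφ => by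
      have h1 := h φ hφ
      rw [integral_Ioo_eq_intervalIntegral hab.le, integral_Ioo_eq_intervalIntegral hab.le] at h1
      have h2 := integral_primitive_mul_deriv hg hφ
      simp only [sub_mul]
      rw [intervalIntegral.integral_sub (hf.mul_continuousOn hφ.continuous_deriv.continuousOn)
        (hGc.intervalIntegrable.mul_continuousOn hφ.continuous_deriv.continuousOn), h1, h2, sub_self]
  refine ⟨C, ?_⟩
  filter_upwards [hC] with s hs hsI
  linarith [hs hsI]

/-- A function of class `W^{2,∞}` on a bounded interval is the restriction of a differentiable
function on the line with Lipschitz derivative. -/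
theorem MemW2Infty.exists_extension {β : ℝ → ℝ} {a b : ℝ} (hab : a < b) (h : MemW2Infty β a b)
    (hβ : ContinuousOn β (Ico a b)) : ∃ γ γ' : ℝ → ℝ, ∃ L, 0 < L ∧ EqOn β γ (Ico a b) ∧
      (∀ t, HasDerivAt γ (γ' t) t) ∧ Continuous γ' ∧ ∀ s t, |γ' s - γ' t| ≤ L * |s - t| := by
  obtain ⟨f', f'', m0, m1, m2, w0, w1⟩ := h
  have hint : ∀ {f : ℝ → ℝ}, MemLp f ⊤ (volume.restrict (Ioo a b)) → IntervalIntegrable f volume a b :=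
    fun hf => (intervalIntegrable_iff_integrableOn_Ioo_of_le hab.le).mpr (hf.integrable le_top)
  obtain ⟨C₁, hC₁⟩ := w1.exists_ae_eq_primitive hab (hint m1) (hint m2)
  obtain ⟨C₀, hC₀⟩ := w0.exists_ae_eq_primitive hab (hint m0) (hint m1)
  obtain ⟨M, hM⟩ : ∃ M : ℝ, ∀ᵐ s, ‖(Ioo a b).indicator f'' s‖ ≤ M := by
    have h1 := ae_le_eLpNormEssSup (f := f'') (μ := volume.restrict (Ioo a b))
    have h2 : eLpNormEssSup f'' (volume.restrict (Ioo a b)) < ⊤ := by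
      simpa using m2.eLpNorm_lt_top
    rw [ae_restrict_iff' measurableSet_Ioo] at h1
    refine ⟨(eLpNormEssSup f'' (volume.restrict (Ioo a b))).toReal, ?_⟩
    filter_upwards [h1] with s hs
    by_cases hsI : s ∈ Ioo a b
    · rw [indicator_of_mem hsI]
      have := (ENNReal.toReal_le_toReal (by simp) h2.ne).mpr (hs hsI)
      simpa using this
    · rw [indicator_of_notMem hsI, norm_zero]
      exact ENNReal.toReal_nonneg
  -- Extending the second derivative by zero and integrating twice defines `γ'` and `γ` on the whole
  -- line. The `1` added to `|M|` below only makes the Lipschitz constant positive.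
  set g := (Ioo a b).indicator f'' with hg
  have hgi : Integrable g := (integrable_indicator_iff measurableSet_Ioo).mpr (m2.integrable le_top)
  set γ' : ℝ → ℝ := fun t => C₁ + ∫ r in a..t, g r with hγ'
  have hLip : ∀ s t, |γ' s - γ' t| ≤ (|M| + 1) * |s - t| := by
    intro s t
    have e : γ' s - γ' t = ∫ r in t..s, g r := by
      simp only [hγ', add_sub_add_left_eq_sub]
      exact intervalIntegral.integral_interval_sub_left hgi.intervalIntegrable hgi.intervalIntegrable
    rw [e, ← Real.norm_eq_abs]
    refine (intervalIntegral.norm_integral_le_of_norm_le_const_ae (C := |M| + 1) ?_)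
    filter_upwards [hM] with r hr _
    linarith [le_abs_self M]
  have hγ'c : Continuous γ' := by
    refine (LipschitzWith.of_dist_le_mul (K := (|M| + 1).toNNReal) fun s t => ?_).continuous
    rw [Real.dist_eq, Real.dist_eq, Real.coe_toNNReal _ (by positivity)]
    exact hLip s t
  refine ⟨fun t => C₀ + ∫ r in a..t, γ' r, γ', |M| + 1, by positivity, ?_,
    fun t => (hasDerivAt_primitive hγ'c a t).const_add _, hγ'c, hLip⟩
  have hf' : ∀ s ∈ Ioo a b, ∫ r in a..s, f' r = ∫ r in a..s, γ' r := by
    intro s hs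
    rw [intervalIntegral.integral_of_le hs.1.le, intervalIntegral.integral_of_le hs.1.le,
      integral_Ioc_eq_integral_Ioo, integral_Ioc_eq_integral_Ioo]
    refine setIntegral_congr_ae measurableSet_Ioo ?_
    filter_upwards [hC₁] with r hr hrI
    rw [hr ⟨hrI.1, hrI.2.trans hs.2⟩, hγ']
    simp only [add_right_inj]
    rw [intervalIntegral.integral_of_le hrI.1.le, intervalIntegral.integral_of_le hrI.1.le,
      integral_Ioc_eq_integral_Ioo, integral_Ioc_eq_integral_Ioo]
    refine setIntegral_congr_fun measurableSet_Ioo fun x hx => ?_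
    rw [hg, indicator_of_mem (show x ∈ Ioo a b from ⟨hx.1, hx.2.trans (hrI.2.trans hs.2)⟩)]
  -- Almost everywhere equality becomes equality by continuity. Only `[a, b)` is reached, since `β`
  -- may take any value at `b`.
  refine Measure.eqOn_Ico_of_ae_eq (μ := volume) ?_ hβ ?_
  · rw [EventuallyEq, ae_restrict_iff' measurableSet_Ico]
    filter_upwards [hC₀, measure_eq_zero_iff_ae_notMem.mp (measure_singleton a)] with s hs hsa hsI
    have hsI' : s ∈ Ioo a b := ⟨lt_of_le_of_ne hsI.1 fun h => hsa h.symm, hsI.2⟩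
    rw [hs hsI', hf' s hsI']
  · exact (continuous_const.add (continuous_iff_continuousAt.mpr fun t =>
      (hasDerivAt_primitive hγ'c a t).continuousAt)).continuousOn

/-- Near a zero at the end of the interval a positive function with Lipschitz derivative `β'`
satisfies `β'² ≤ K β + 4 β² / (b - t)²`. -/
theorem exists_deriv_sq_le {β β' : ℝ → ℝ} {a b L : ℝ} (hab : a < b) (hL : 0 < L)
    (hβ : ∀ t, HasDerivAt β (β' t) t) (hβ' : Continuous β')
    (hLip : ∀ s t, |β' s - β' t| ≤ L * |s - t|) (hpos : ∀ t ∈ Ico a b, 0 < β t) (hb : β b = 0) :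
    ∃ K, 0 ≤ K ∧ ∀ t ∈ Ico a b, β t ≤ K * (b - t) ∧
      β' t ^ 2 ≤ K * β t + 4 * β t ^ 2 / (b - t) ^ 2 := by
  have hβc : Continuous β := continuous_iff_continuousAt.mpr fun t => (hβ t).continuousAt
  have taylor : ∀ t r, β (t + r) ≤ β t + β' t * r + L * r ^ 2 := by
    intro t r
    rcases lt_trichotomy r 0 with hr | hr | hr
    · obtain ⟨ξ, hξ, he⟩ := exists_hasDerivAt_eq_slope β β' (show t + r < t by linarith)
        hβc.continuousOn fun x _ => hβ x
      rw [eq_div_iff (by linarith)] at he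
      have h1 := (abs_le.mp (hLip ξ t)).1
      have h2 : |ξ - t| ≤ -r := by
        rw [abs_of_nonpos (by linarith [hξ.2])]; linarith [hξ.1]
      have h3 : L * |ξ - t| ≤ L * (-r) := mul_le_mul_of_nonneg_left h2 hL.le
      have h4 : (β' t - L * (-r)) * (-r) ≤ β' ξ * (-r) :=
        mul_le_mul_of_nonneg_right (by linarith) (by linarith)
      have h5 : t - (t + r) = -r := by ring
      rw [h5] at he
      nlinarith
    · simp [hr]
    · obtain ⟨ξ, hξ, he⟩ := exists_hasDerivAt_eq_slope β β' (show t < t + r by linarith)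
        hβc.continuousOn fun x _ => hβ x
      rw [eq_div_iff (by linarith)] at he
      have h1 := (abs_le.mp (hLip ξ t)).2
      have h2 : |ξ - t| ≤ r := by
        rw [abs_of_nonneg (by linarith [hξ.1])]; linarith [hξ.2]
      have h3 : L * |ξ - t| ≤ L * r := mul_le_mul_of_nonneg_left h2 hL.le
      have h4 : β' ξ * r ≤ (β' t + L * r) * r := mul_le_mul_of_nonneg_right (by linarith) hr.le
      have h5 : t + r - t = r := by ring
      rw [h5] at he
      nlinarith
  obtain ⟨B, hB0, hB⟩ := exists_norm_le_on_Icc (c := a) (d := b) hβ'.continuousOn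
  simp only [Real.norm_eq_abs] at hB
  set m := (a + b) / 2 with hm
  obtain ⟨s₀, hs₀, hmin⟩ := isCompact_Icc.exists_isMinOn (s := Icc a m) ⟨a, le_rfl, by linarith⟩
    hβc.continuousOn
  have hc₀ : 0 < β s₀ := hpos s₀ ⟨hs₀.1, by linarith [hs₀.2]⟩
  -- A larger Lipschitz constant shortens the backward step `β' / (2L')` to at most `(b - a) / 2`,
  -- so that from the right half of the interval it does not leave `[a, b)`.
  set L' := L + B / (b - a) + 1 with hL'
  have hBba : 0 ≤ B / (b - a) := div_nonneg hB0 (by linarith)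
  have hL'0 : 0 < L' := by positivity
  set K := B + 4 * L' + B ^ 2 / β s₀ with hK
  have hBc : 0 ≤ B ^ 2 / β s₀ := by positivity
  refine ⟨K, by positivity, fun t ht => ?_⟩
  have htI : t ∈ Icc a b := ⟨ht.1, ht.2.le⟩
  have hδ : 0 < b - t := by linarith [ht.2]
  have hβt := hpos t ht
  constructor
  · obtain ⟨ξ, hξ, he⟩ := exists_hasDerivAt_eq_slope β β' ht.2 hβc.continuousOn fun x _ => hβ x
    rw [eq_div_iff hδ.ne', hb, zero_sub] at he
    have h1 := (abs_le.mp (hB ξ ⟨ht.1.trans hξ.1.le, hξ.2.le⟩)).1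
    have h2 : -B * (b - t) ≤ β' ξ * (b - t) := mul_le_mul_of_nonneg_right h1 hδ.le
    have h3 : 0 ≤ (4 * L' + B ^ 2 / β s₀) * (b - t) := by positivity
    rw [hK]
    linarith
  have hq : 0 ≤ 4 * β t ^ 2 / (b - t) ^ 2 := by positivity
  have hBβ : 0 ≤ B * β t := by positivity
  have hBcβ : 0 ≤ B ^ 2 / β s₀ * β t := by positivity
  have hL'β : 0 ≤ 4 * L' * β t := by positivity
  -- Glaeser's argument: move by the minimizer of the quadratic upper bound and use `β ≥ 0` there.
  -- For `β' ≤ 0` the step goes right; if it passes `b`, the point `b` itself with `β b = 0` gives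
  -- `-β' ≤ 2 β / (b - t)`. For `β' > 0` it goes left, except in the left half, where `β` is bounded
  -- below.
  rcases le_or_gt (β' t) 0 with hp | hp
  · rcases le_or_gt (-β' t / (2 * L)) (b - t) with hr | hr
    · have h1 := taylor t (-β' t / (2 * L))
      have h2 : 0 ≤ β (t + -β' t / (2 * L)) := by
        have hr0 : 0 ≤ -β' t / (2 * L) := div_nonneg (by linarith) (by linarith)
        rcases eq_or_lt_of_le hr with he | he
        · rw [he, add_sub_cancel, hb]
        · exact (hpos _ ⟨by linarith [ht.1], by linarith⟩).le
      have h3 : β' t * (-β' t / (2 * L)) + L * (-β' t / (2 * L)) ^ 2 = -(β' t ^ 2 / (4 * L)) := by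
        field_simp
        ring
      have h4 : β' t ^ 2 / (4 * L) ≤ β t := by linarith
      rw [div_le_iff₀ (by linarith)] at h4
      have h5 : 0 ≤ 4 * (B / (b - a) + 1) * β t := by positivity
      rw [hK, hL']
      linarith
    · rw [lt_div_iff₀ (by linarith)] at hr
      have h1 := taylor t (b - t)
      rw [add_sub_cancel, hb] at h1
      have h2 : (b - t) * (b - t) * (2 * L) ≤ -β' t * (b - t) := by
        have := mul_le_mul_of_nonneg_right hr.le hδ.le
        linarith
      have h3 : -β' t ≤ 2 * β t / (b - t) := by
        rw [le_div_iff₀ hδ]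
        linarith
      have h4 : β' t ^ 2 ≤ (2 * β t / (b - t)) ^ 2 := by
        have := pow_le_pow_left₀ (by linarith : 0 ≤ -β' t) h3 2
        simpa using this
      have h5 : (2 * β t / (b - t)) ^ 2 = 4 * β t ^ 2 / (b - t) ^ 2 := by
        rw [div_pow]; ring
      rw [hK]
      linarith
  · rcases le_or_gt t m with htm | htm
    · have h1 : β s₀ ≤ β t := hmin ⟨ht.1, htm⟩
      have h2 : β' t ^ 2 ≤ B ^ 2 := by
        rw [← sq_abs]
        exact pow_le_pow_left₀ (abs_nonneg _) (hB t htI) 2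
      have h3 : B ^ 2 ≤ B ^ 2 / β s₀ * β t := by
        calc B ^ 2 = B ^ 2 / β s₀ * β s₀ := by field_simp
          _ ≤ _ := mul_le_mul_of_nonneg_left h1 hBc
      rw [hK]
      linarith
    · have h0 : β' t / (2 * L') ≤ (b - a) / 2 := by
        rw [div_le_iff₀ (by linarith)]
        have h1 := (abs_le.mp (hB t htI)).2
        have h2 : (b - a) / 2 * (2 * L') = (b - a) * (L + 1) + B := by
          rw [hL']
          have : b - a ≠ 0 := by linarith
          field_simp
          ring
        have h3 : 0 ≤ (b - a) * (L + 1) := mul_nonneg (by linarith) (by linarith)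
        linarith
      have h1 := taylor t (-(β' t / (2 * L')))
      have hr0 : 0 < β' t / (2 * L') := div_pos hp (by linarith)
      have h2 := hpos (t + -(β' t / (2 * L'))) ⟨by linarith, by linarith [ht.2]⟩
      have h3 : β' t * (-(β' t / (2 * L'))) + L' * (-(β' t / (2 * L'))) ^ 2
          = -(β' t ^ 2 / (4 * L')) := by
        field_simp
        ring
      have h6 : L * (-(β' t / (2 * L'))) ^ 2 ≤ L' * (-(β' t / (2 * L'))) ^ 2 :=
        mul_le_mul_of_nonneg_right (by rw [hL']; linarith) (sq_nonneg _)
      have h4 : β' t ^ 2 / (4 * L') ≤ β t := by linarith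
      rw [div_le_iff₀ (by linarith)] at h4
      rw [hK]
      linarith

end IntermittentDelay

/-! ### The energy space as a Hilbert space densely embedded in `H`. -/

namespace IntermittentDelay

namespace PositiveOperator

variable {H : Type*} [NormedAddCommGroup H] [InnerProductSpace ℝ H] [CompleteSpace H]
  (A : PositiveOperator H)

theorem inner_op_comm (x y : A.op.domain) : ⟪A.op x, (y : H)⟫_ℝ = ⟪(x : H), A.op y⟫_ℝ := by
  have h := LinearPMap.adjoint_isFormalAdjoint A.selfAdjoint.dense_domain
  rw [LinearPMap.isSelfAdjoint_def.mp A.selfAdjoint] at h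
  exact h x y

/-- The eigenvectors of `A` belong to `D(A^{1/2})`. -/
theorem eigenvector_mem_sqrtGraph (e : A.op.domain) {l : ℝ} (he : A.op e = l • (e : H)) :
    ((e : H), √l • (e : H)) ∈ sqrtGraph A := by
  intro e' l' he'
  have h := A.inner_op_comm e e'
  rw [he, he', real_inner_smul_left, real_inner_smul_right] at h
  simp only [real_inner_smul_left]
  rcases eq_or_ne l l' with rfl | hne
  · rfl
  · have h0 : ⟪(e : H), (e' : H)⟫_ℝ = 0 := by
      by_contra h0
      exact hne (mul_right_cancel₀ h0 h)
    rw [h0, mul_zero, mul_zero]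

/-- The Poincaré inequality with constant `√‖T‖`, where `T` is the inverse of `A`. On the dense span
of eigenvectors `⟪p.1, x⟫ = ⟪p.2, T^{1/2} x⟫`, and `‖T^{1/2} x‖² ≤ ‖T‖ ‖x‖²`. -/
theorem exists_norm_fst_le : ∃ c, 0 ≤ c ∧ ∀ p ∈ sqrtGraph A, ‖p.1‖ ≤ c * ‖p.2‖ := by
  obtain ⟨T, hTc, hT1, hT2⟩ := A.compactInverse
  have hsym : T.IsSymmetric := by
    intro a b
    obtain ⟨a', ha, ha'⟩ := hT1 a
    obtain ⟨b', hb, hb'⟩ := hT1 b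
    have h := A.inner_op_comm a' b'
    rw [ha', hb', ha, hb] at h
    exact h.symm
  set S : Submodule ℝ H := ⨆ μ, Module.End.eigenspace (T : Module.End ℝ H) μ with hS
  have hSd : Dense (S : Set H) := by
    rw [Submodule.dense_iff_topologicalClosure_eq_top, Submodule.topologicalClosure_eq_top_iff]
    exact ContinuousLinearMap.orthogonalComplement_iSup_eigenspaces_eq_bot hTc hsym
  have key : ∀ x ∈ S, ∃ z : H, ‖z‖ ^ 2 ≤ ‖T‖ * ‖x‖ ^ 2 ∧
      ∀ p ∈ sqrtGraph A, ⟪p.1, x⟫_ℝ = ⟪p.2, z⟫_ℝ := by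
    classical
    intro x hx
    obtain ⟨f, hf⟩ := (Submodule.mem_iSup_iff_exists_dfinsupp' _ x).mp hx
    have hort : OrthogonalFamily ℝ (fun μ : ℝ => Module.End.eigenspace (T : Module.End ℝ H) μ)
        (fun μ => (Module.End.eigenspace (T : Module.End ℝ H) μ).subtypeₗᵢ) :=
      hsym.orthogonalFamily_eigenspaces
    have hTf : ∀ μ, T (f μ : H) = μ • (f μ : H) := fun μ =>
      Module.End.mem_eigenspace_iff.mp (f μ).2
    have hμ : ∀ μ, (f μ : H) ≠ 0 → 0 < μ ∧ μ ≤ ‖T‖ := by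
      intro μ h0
      have hn : 0 < ‖(f μ : H)‖ := norm_pos_iff.mpr h0
      have hle : |μ| ≤ ‖T‖ := by
        have := T.le_opNorm (f μ : H)
        rw [hTf, norm_smul, Real.norm_eq_abs] at this
        exact le_of_mul_le_mul_right this hn
      obtain ⟨y', hy1, hy2⟩ := hT1 (f μ : H)
      have hnn := A.nonneg y'
      rw [hy2, hy1, hTf, real_inner_smul_right, real_inner_self_eq_norm_sq] at hnn
      have h1 : 0 ≤ μ := nonneg_of_mul_nonneg_left hnn (by positivity)
      refine ⟨lt_of_le_of_ne h1 fun h => h0 ?_, (le_abs_self _).trans hle⟩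
      have hz : y' = 0 := Subtype.ext (by rw [hy1, hTf, ← h, zero_smul]; rfl)
      rw [← hy2, hz, LinearPMap.map_zero]
    have hxs : x = ∑ μ ∈ f.support, (f μ : H) := by
      rw [← hf, DFinsupp.sum]
    have hsq : ∀ μ ∈ f.support, (f μ : H) ≠ 0 := fun μ h => by
      simpa using DFinsupp.mem_support_iff.mp h
    -- This is `T^{1/2} x` for a finite sum `x` of eigenvectors; orthogonality of the eigenspaces
    -- computes its norm.
    refine ⟨∑ μ ∈ f.support, √μ • (f μ : H), ?_, fun p hp => ?_⟩
    · have e1 := hort.norm_sum (fun μ => √μ • f μ) f.support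
      have e2 := hort.norm_sum (fun μ => f μ) f.support
      simp only [Submodule.coe_subtypeₗᵢ, Submodule.coe_subtype,
        Submodule.coe_smul, Submodule.coe_norm] at e1 e2
      rw [hxs, e1, e2, Finset.mul_sum]
      refine Finset.sum_le_sum fun μ h => ?_
      obtain ⟨h1, h2⟩ := hμ μ (hsq μ h)
      rw [norm_smul, mul_pow, Real.norm_eq_abs, sq_abs, Real.sq_sqrt h1.le]
      exact mul_le_mul_of_nonneg_right h2 (sq_nonneg _)
    · rw [hxs, inner_sum, inner_sum]
      refine Finset.sum_congr rfl fun μ h => ?_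
      obtain ⟨h1, h2⟩ := hμ μ (hsq μ h)
      obtain ⟨y', hy1, hy2⟩ := hT1 (f μ : H)
      have h3 := hp y' μ⁻¹ (by rw [hy2, hy1, hTf, smul_smul, inv_mul_cancel₀ h1.ne', one_smul])
      rw [hy1, hTf, real_inner_smul_right, real_inner_smul_right, Real.sqrt_inv] at h3
      rw [real_inner_smul_right]
      have h4 : √μ ≠ 0 := (Real.sqrt_pos.mpr h1).ne'
      have h5 : √μ * √μ = μ := Real.mul_self_sqrt h1.le
      have h6 : √μ * (√μ * ⟪p.2, (f μ : H)⟫_ℝ) = √μ * ⟪p.1, (f μ : H)⟫_ℝ := by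
        rw [← mul_assoc, h5, h3, ← mul_assoc]
        congr 1
        field_simp
        rw [pow_two, h5]
      exact (mul_left_cancel₀ h4 h6).symm
  refine ⟨√‖T‖, Real.sqrt_nonneg _, fun p hp => ?_⟩
  have hall : ∀ x, ⟪p.1, x⟫_ℝ ≤ ‖p.2‖ * (√‖T‖ * ‖x‖) := by
    intro x
    refine hSd.induction (P := fun x => ⟪p.1, x⟫_ℝ ≤ ‖p.2‖ * (√‖T‖ * ‖x‖)) (fun x hx => ?_)
      (isClosed_le (by fun_prop) (by fun_prop)) x
    obtain ⟨z, hz, hzp⟩ := key x hx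
    rw [hzp p hp]
    refine (real_inner_le_norm _ _).trans (mul_le_mul_of_nonneg_left ?_ (norm_nonneg _))
    refine abs_le_of_sq_le_sq' ?_ (by positivity) |>.2
    rw [mul_pow, Real.sq_sqrt (norm_nonneg _)]
    exact hz
  have h := hall p.1
  rw [real_inner_self_eq_norm_sq, pow_two] at h
  rcases eq_or_lt_of_le (norm_nonneg p.1) with h0 | h0
  · rw [← h0]; positivity
  · refine le_of_mul_le_mul_right ?_ h0
    linarith

end PositiveOperator

namespace EnergySpace

variable {H : Type*} [NormedAddCommGroup H] [InnerProductSpace ℝ H] [CompleteSpace H]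
  {A : PositiveOperator H}

theorem norm_root (u : EnergySpace A) : ‖root u‖ = ‖u‖ := by
  have h : ⟪u, u⟫_ℝ = ⟪root u, root u⟫_ℝ := inner_def u u
  rw [real_inner_self_eq_norm_sq, real_inner_self_eq_norm_sq] at h
  exact ((pow_left_inj₀ (norm_nonneg _) (norm_nonneg _) two_ne_zero).mp h).symm

theorem mem_sqrtGraph (u : EnergySpace A) : (toH u, root u) ∈ sqrtGraph A := by
  rw [← graph_sqrtOp]
  exact LinearPMap.mem_graph (sqrtOp A) u

theorem exists_of_mem_sqrtGraph {p : H × H} (hp : p ∈ sqrtGraph A) :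
    ∃ u : EnergySpace A, toH u = p.1 ∧ root u = p.2 := by
  rw [← graph_sqrtOp, LinearPMap.mem_graph_iff] at hp
  exact hp

theorem toH_injective : Function.Injective (toH (A := A)) := Subtype.val_injective

theorem exists_norm_toH_le (A : PositiveOperator H) :
    ∃ c, ∀ u : EnergySpace A, ‖toH u‖ ≤ c * ‖u‖ := by
  obtain ⟨c, _, hc⟩ := A.exists_norm_fst_le
  exact ⟨c, fun u => by simpa [norm_root] using hc _ (mem_sqrtGraph u)⟩

/-- The embedding of `V` into `H` as a continuous linear map. -/
noncomputable def embedding (A : PositiveOperator H) : EnergySpace A →L[ℝ] H :=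
  (toH (A := A)).mkContinuousOfExistsBound (exists_norm_toH_le A)

@[simp] theorem embedding_apply (u : EnergySpace A) : embedding A u = toH u := rfl

theorem isClosed_sqrtGraph (A : PositiveOperator H) : IsClosed (sqrtGraph A : Set (H × H)) := by
  have h : (sqrtGraph A : Set (H × H)) = ⋂ (e : A.op.domain) (l : ℝ) (_ : A.op e = l • (e : H)),
      {p : H × H | ⟪p.2, (e : H)⟫_ℝ = √l * ⟪p.1, (e : H)⟫_ℝ} := by
    ext p
    simp only [mem_iInter]
    rfl
  rw [h]
  exact isClosed_iInter fun e => isClosed_iInter fun l => isClosed_iInter fun _ =>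
    isClosed_eq (by fun_prop) (by fun_prop)

/-- The energy norm of `u` is `‖A^{1/2} u‖` and dominates the norm of `H`, so a Cauchy sequence
converges in `H × H` along the graph of `A^{1/2}`, which is closed. -/
instance : CompleteSpace (EnergySpace A) := by
  refine Metric.complete_of_cauchySeq_tendsto fun x hx => ?_
  have h1 : CauchySeq fun n => embedding A (x n) := hx.map (embedding A).uniformContinuous
  have hiso : ∀ m n, dist (root (x m)) (root (x n)) = dist (x m) (x n) := fun m n => by
    rw [dist_eq_norm, dist_eq_norm, ← map_sub, norm_root]
  have h2 : CauchySeq fun n => root (x n) := by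
    rw [Metric.cauchySeq_iff] at hx ⊢
    simpa only [hiso] using hx
  obtain ⟨y, hy⟩ := cauchySeq_tendsto_of_complete h1
  obtain ⟨z, hz⟩ := cauchySeq_tendsto_of_complete h2
  have hmem : (y, z) ∈ sqrtGraph A := (isClosed_sqrtGraph A).mem_of_tendsto (hy.prodMk_nhds hz)
    (Filter.Eventually.of_forall fun n => mem_sqrtGraph (x n))
  obtain ⟨u, _, hu⟩ := exists_of_mem_sqrtGraph hmem
  refine ⟨u, tendsto_iff_dist_tendsto_zero.mpr ?_⟩
  have h3 := tendsto_iff_dist_tendsto_zero.mp hz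
  refine h3.congr fun n => ?_
  rw [dist_eq_norm, dist_eq_norm, ← norm_root (x n - u), map_sub, hu]

/-- The range contains all eigenvectors of `A`, and these are complete. -/
theorem denseRange_embedding (A : PositiveOperator H) : DenseRange (embedding A) := by
  have h : Dense ((LinearMap.range (embedding A).toLinearMap : Submodule ℝ H) : Set H) := by
    rw [Submodule.dense_iff_topologicalClosure_eq_top, Submodule.topologicalClosure_eq_top_iff,
      Submodule.eq_bot_iff]
    intro x hx
    refine eq_zero_of_forall_eigenvector A x fun e l _ he => ?_
    obtain ⟨u, hu, _⟩ := exists_of_mem_sqrtGraph (A.eigenvector_mem_sqrtGraph e he)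
    exact (Submodule.mem_orthogonal' _ x).mp hx _ ⟨u, hu⟩
  exact h

end EnergySpace

end IntermittentDelay

/-! ### The method of steps, and integrated versus distributional equations. -/

namespace IntermittentDelay

open Filter Topology

theorem continuousOn_Iic_glue {E : Type*} [TopologicalSpace E] {f g : ℝ → E} {a b : ℝ} (hab : a ≤ b)
    (hf : ContinuousOn f (Iic a)) (hg : ContinuousOn g (Icc a b)) (h : f a = g a) :
    ContinuousOn (fun t => if t ≤ a then f t else g t) (Iic b) := by
  rw [← Iic_union_Icc_eq_Iic hab]
  refine ContinuousOn.union_of_isClosed (hf.congr fun t ht => if_pos ht)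
    (hg.congr fun t ht => ?_) isClosed_Iic isClosed_Icc
  rcases eq_or_lt_of_le ht.1 with rfl | h'
  · simp [h]
  · simp [not_le.mpr h']

namespace DampedWave

set_option linter.unusedSectionVars false

variable {V H U : Type*} [NormedAddCommGroup V] [InnerProductSpace ℝ V] [CompleteSpace V]
  [NormedAddCommGroup H] [InnerProductSpace ℝ H] [CompleteSpace H]
  [NormedAddCommGroup U] [InnerProductSpace ℝ U] [CompleteSpace U]
  {W : DampedWave V H U} {a b c d τ : ℝ} {f g : ℝ → H} {u x : ℝ → V} {v y : ℝ → H}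
  {K : ℝ → H →L[ℝ] H}

/-- The displacement determines the velocity. -/
theorem IsWeak.eqOn_snd (hcd : c < d) (h₁ : W.IsWeak f c d u v) (h₂ : W.IsWeak g c d x y)
    (hux : EqOn u x (Icc c d)) : EqOn v y (Icc c d) := by
  obtain ⟨p, hpc, hp⟩ := exists_continuous_eqOn_Icc hcd.le h₁.continuousOn_snd
  obtain ⟨q, hqc, hq⟩ := exists_continuous_eqOn_Icc hcd.le h₂.continuousOn_snd
  intro t ht
  rw [← hp ht, ← hq ht]
  refine (uniqueDiffOn_Icc hcd t ht).eq_deriv _ (hasDerivAt_primitive hpc c t).hasDerivWithinAt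
    ((hasDerivAt_primitive hqc c t).hasDerivWithinAt.congr_of_mem (fun s hs => ?_) ht)
  have hsub : uIcc c s ⊆ Icc c d := by rw [uIcc_of_le hs.1]; exact Icc_subset_Icc_right hs.2
  rw [intervalIntegral.integral_congr (g := v) fun r hr => hp (hsub hr),
    intervalIntegral.integral_congr (g := y) fun r hr => hq (hsub hr), ← h₁.displacement s hs,
    ← h₂.displacement s hs, hux hs, hux ⟨le_rfl, hcd.le⟩]

/-- The force exerted by the delayed feedback. -/
def delayed (K : ℝ → H →L[ℝ] H) (τ : ℝ) (v : ℝ → H) (s : ℝ) : H := -(K s (v (s - τ)))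

/-- A velocity known up to time `e` determines the delayed source up to `e + τ`. Freezing the
argument there gives a source continuous on the line, as the existence and uniqueness results
require. -/
theorem exists_continuous_eqOn_delayed {e : ℝ}
    (hv : ContinuousOn v (Iic e)) : ∃ p : ℝ → H, Continuous p ∧
      EqOn (fun s => -(K s (p s))) (delayed K τ v) (Iic (e + τ)) := by
  refine ⟨fun s => v (min s (e + τ) - τ), ?_, fun s hs => ?_⟩
  · exact hv.comp_continuous (by fun_prop) fun s => by
      rw [mem_Iic, sub_le_iff_le_add]; exact min_le_right _ _
  · simp only [delayed]
    rw [min_eq_left hs]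

theorem continuous_delayed_source (hK : Continuous K) {p : ℝ → H} (hp : Continuous p) :
    Continuous fun s => -(K s (p s)) := (hK.clm_apply hp).neg

/-- Agreement of the velocities up to `d` makes the sources equal up to `d + τ`, where uniqueness
without delay applies. Finitely many steps of length `τ` exhaust `[a, b]`. -/
theorem IsWeak.eqOn_delayed (hab : a < b) (hτ : 0 < τ) (hb : ∀ t ∈ Ico a b, 0 < W.coeff t)
    (hK : Continuous K) (hv : ContinuousOn v (Iic b))
    (h₁ : W.IsWeak (delayed K τ v) a b u v) (h₂ : W.IsWeak (delayed K τ y) a b x y)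
    (hux : u a = x a) (hvy : EqOn v y (Iic a)) : EqOn u x (Icc a b) ∧ EqOn v y (Iic b) := by
  have key : ∀ j : ℕ, EqOn u x (Icc a (min (a + j * τ) b)) ∧ EqOn v y (Iic (min (a + j * τ) b)) := by
    intro j
    induction j with
    | zero =>
      simp only [Nat.cast_zero, zero_mul, add_zero, min_eq_left hab.le, Icc_self]
      exact ⟨fun s hs => by rw [mem_singleton_iff.mp hs, hux], hvy⟩
    | succ j ih =>
      set d := min (a + j * τ) b
      set d' := min (a + (j + 1 : ℕ) * τ) b with hd'
      have had' : a < d' := lt_min (by push_cast; nlinarith [(Nat.cast_nonneg j : (0 : ℝ) ≤ j)]) hab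
      have hd'b : d' ≤ b := min_le_right _ _
      have hd'd : d' ≤ d + τ := by
        rw [← min_add_add_right]
        refine min_le_min ?_ (by linarith)
        push_cast
        linarith
      obtain ⟨p, hp, hpe⟩ := exists_continuous_eqOn_delayed (K := K) (τ := τ) (e := d)
        (hv.mono (Iic_subset_Iic.mpr (min_le_right _ _)))
      have w₁ : W.IsWeak (fun s => -(K s (p s))) a d' u v :=
        (h₁.mono hd'b).congr (fun _ _ => rfl) (fun _ _ => rfl) fun s hs => hpe (hs.2.trans hd'd)
      have w₂ : W.IsWeak (fun s => -(K s (p s))) a d' x y :=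
        (h₂.mono hd'b).congr (fun _ _ => rfl) (fun _ _ => rfl) fun s hs => by
          refine (hpe (hs.2.trans hd'd)).trans ?_
          rw [delayed, delayed, ih.2 (show s - τ ∈ Iic d by rw [mem_Iic]; linarith [hs.2])]
      have e1 := IsWeak.eqOn (continuous_delayed_source hK hp)
        (fun t ht => hb t ⟨ht.1, ht.2.trans_le hd'b⟩) had' w₁ w₂ hux
        (hvy (mem_Iic.mpr le_rfl))
      refine ⟨e1, fun s hs => ?_⟩
      rcases le_or_gt s a with h | h
      · exact hvy h
      · exact w₁.eqOn_snd had' w₂ e1 ⟨h.le, hs⟩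
  obtain ⟨j, hj⟩ := exists_nat_gt ((b - a) / τ)
  rw [div_lt_iff₀ hτ] at hj
  have h := key j
  rwa [min_eq_right (by linarith)] at h

/-- Solutions can be continued across an interval on which the equation without delay can be
solved, by the method of steps. -/
theorem exists_isWeak_delayed (hab : a < b) (hτ : 0 < τ) (hb : ∀ t ∈ Ico a b, 0 < W.coeff t)
    (hK : Continuous K)
    (hsolv : ∀ d ∈ Ioc a b, ∀ p : ℝ → H, Continuous p → ∀ x₀ y₀, ∃ x y,
      W.IsWeak (fun s => -(K s (p s))) a d x y ∧ x a = x₀ ∧ y a = y₀)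
    (hu : ContinuousOn u (Iic a)) (hv : ContinuousOn v (Iic a)) :
    ∃ x y, ContinuousOn x (Iic b) ∧ ContinuousOn y (Iic b) ∧ EqOn x u (Iic a) ∧
      EqOn y v (Iic a) ∧ W.IsWeak (delayed K τ y) a b x y := by
  have key : ∀ j : ℕ, ∃ x y, ContinuousOn x (Iic (min (a + j * τ) b)) ∧
      ContinuousOn y (Iic (min (a + j * τ) b)) ∧ EqOn x u (Iic a) ∧ EqOn y v (Iic a) ∧
      W.IsWeak (delayed K τ y) a (min (a + j * τ) b) x y := by
    intro j
    induction j with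
    | zero =>
      refine ⟨u, v, ?_⟩
      simp only [Nat.cast_zero, zero_mul, add_zero, min_eq_left hab.le]
      refine ⟨hu, hv, fun _ _ => rfl, fun _ _ => rfl, ?_⟩
      constructor
      · exact hu.mono Icc_subset_Iic_self
      · exact hv.mono Icc_subset_Iic_self
      · intro t ht
        rw [le_antisymm ht.2 ht.1, sub_self, intervalIntegral.integral_same]
      · intro t ht z
        rw [le_antisymm ht.2 ht.1, sub_self, intervalIntegral.integral_same]
    | succ j ih =>
      obtain ⟨x, y, hx, hy, hxu, hyv, hw⟩ := ih
      set d := min (a + j * τ) b with hd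
      set d' := min (a + (j + 1 : ℕ) * τ) b with hd'
      have had' : a < d' := lt_min (by push_cast; nlinarith [(Nat.cast_nonneg j : (0 : ℝ) ≤ j)]) hab
      have hd'b : d' ≤ b := min_le_right _ _
      have hd'd : d' ≤ d + τ := by
        rw [← min_add_add_right]
        refine min_le_min ?_ (by linarith)
        push_cast
        linarith
      have hdd' : d ≤ d' := min_le_min (by push_cast; linarith) le_rfl
      obtain ⟨p, hp, hpe⟩ := exists_continuous_eqOn_delayed (K := K) (τ := τ) hy
      -- Each stage solves anew from `a` on a longer interval instead of continuing from `d`.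
      -- Uniqueness shows that the new solution agrees with the old one on `[a, d]`, so the source
      -- computed from the old velocity is also the delayed source of the new one.
      obtain ⟨x', y', hw', hx', hy'⟩ := hsolv d' ⟨had', hd'b⟩ p hp (u a) (v a)
      have hxe : EqOn (fun t => if t ≤ a then u t else x' t) x' (Icc a d') := fun t ht => by
        rcases eq_or_lt_of_le ht.1 with rfl | h
        · simp [hx']
        · simp [not_le.mpr h]
      have hye : EqOn (fun t => if t ≤ a then v t else y' t) y' (Icc a d') := fun t ht => by
        rcases eq_or_lt_of_le ht.1 with rfl | h
        · simp [hy']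
        · simp [not_le.mpr h]
      refine ⟨fun t => if t ≤ a then u t else x' t, fun t => if t ≤ a then v t else y' t,
        continuousOn_Iic_glue had'.le hu hw'.continuousOn_fst hx'.symm,
        continuousOn_Iic_glue had'.le hv hw'.continuousOn_snd hy'.symm,
        fun t ht => if_pos ht, fun t ht => if_pos ht, hw'.congr hxe hye fun s hs => ?_⟩
      rw [hpe (hs.2.trans hd'd), delayed, delayed]
      congr 2
      have hsd : s - τ ≤ d := by linarith [hs.2]
      rcases le_or_gt (s - τ) a with h | h
      · rw [if_pos h, hyv h]
      · have had : a < d := h.trans_le hsd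
        have w₁ : W.IsWeak (fun s => -(K s (p s))) a d x y :=
          hw.congr (fun _ _ => rfl) (fun _ _ => rfl) fun s hs => hpe
            (show s ≤ d + τ by linarith [hs.2])
        have w₂ := hw'.mono hdd'
        have e1 := IsWeak.eqOn (continuous_delayed_source hK hp)
          (fun t ht => hb t ⟨ht.1, ht.2.trans_le (hdd'.trans hd'b)⟩) had w₁ w₂
          ((hxu (mem_Iic.mpr le_rfl)).trans hx'.symm)
          ((hyv (mem_Iic.mpr le_rfl)).trans hy'.symm)
        rw [if_neg (not_le.mpr h)]
        exact (w₁.eqOn_snd had w₂ e1 ⟨h.le, hsd⟩).symm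
  obtain ⟨j, hj⟩ := exists_nat_gt ((b - a) / τ)
  rw [div_lt_iff₀ hτ] at hj
  have h := key j
  rwa [min_eq_right (by linarith)] at h

end DampedWave

/-- A function equals a primitive of `g` exactly when its derivative is `g` in the sense of
distributions. -/
theorem sub_eq_integral_iff {m g : ℝ → ℝ} {a b : ℝ} (hab : a < b) (hm : ContinuousOn m (Icc a b))
    (hg : ContinuousOn g (Icc a b)) : (∀ t ∈ Icc a b, m t - m a = ∫ s in a..t, g s) ↔
      ∀ φ, IsTestFunction φ a b → (∫ s in a..b, m s * deriv φ s) + ∫ s in a..b, g s * φ s = 0 := by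
  have hgi : IntervalIntegrable g volume a b := (by rwa [uIcc_of_le hab.le] :
    ContinuousOn g (uIcc a b)).intervalIntegrable
  have hmi : IntervalIntegrable m volume a b := (by rwa [uIcc_of_le hab.le] :
    ContinuousOn m (uIcc a b)).intervalIntegrable
  constructor
  · intro h φ hφ
    have h1 := integral_primitive_mul_deriv hgi hφ
    have h2 : ∫ s in a..b, deriv φ s = 0 := by
      rw [intervalIntegral.integral_eq_sub_of_hasDerivAt (fun s _ => hφ.hasDerivAt s)
        (hφ.continuous_deriv.intervalIntegrable _ _), hφ.eq_zero (by simp), hφ.eq_zero (by simp),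
        sub_zero]
    have h3 : ∫ s in a..b, m s * deriv φ s
        = ∫ s in a..b, (m a * deriv φ s + (∫ r in a..s, g r) * deriv φ s) := by
      refine intervalIntegral.integral_congr fun s hs => ?_
      rw [uIcc_of_le hab.le] at hs
      simp only [← h s hs]
      ring
    rw [h3, intervalIntegral.integral_add, intervalIntegral.integral_const_mul, h2, h1]
    · ring
    · exact (hφ.continuous_deriv.const_mul _).intervalIntegrable _ _
    · refine ContinuousOn.intervalIntegrable ?_
      rw [uIcc_of_le hab.le]
      exact (continuousOn_primitive_Icc hab.le hg).mul hφ.continuous_deriv.continuousOn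
  · intro h
    obtain ⟨C, hC⟩ := HasWeakDeriv.exists_ae_eq_primitive hab hmi hgi fun φ hφ => by
      rw [integral_Ioo_eq_intervalIntegral hab.le, integral_Ioo_eq_intervalIntegral hab.le]
      linarith [h φ hφ]
    have h1 : EqOn m (fun s => C + ∫ r in a..s, g r) (Icc a b) := by
      refine Measure.eqOn_Icc_of_ae_eq volume hab.ne ?_ hm
        (continuousOn_const.add (continuousOn_primitive_Icc hab.le hg))
      rw [EventuallyEq, ae_restrict_iff' measurableSet_Icc]
      filter_upwards [hC, measure_eq_zero_iff_ae_notMem.mp (measure_singleton a),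
        measure_eq_zero_iff_ae_notMem.mp (measure_singleton b)] with s hs hsa hsb hsI
      exact hs ⟨lt_of_le_of_ne hsI.1 fun h => hsa h.symm, lt_of_le_of_ne hsI.2 fun h => hsb h⟩
    intro t ht
    rw [h1 ht, h1 ⟨le_rfl, hab.le⟩]
    simp

end IntermittentDelay

/-! ### Realizing the problem on one interval as an abstract wave equation. -/

namespace IntermittentDelay

open Filter Topology

/-- A function of class `C¹` on a compact interval extends to a function of class `C¹` on the
line. -/
theorem exists_hasDerivAt_eqOn_Icc {E : Type*} [NormedAddCommGroup E] [NormedSpace ℝ E]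
    [CompleteSpace E] {F : ℝ → E} {a b : ℝ} (hab : a < b) (hF : ContDiffOn ℝ 1 F (Icc a b)) :
    ∃ G G' : ℝ → E, (∀ t, HasDerivAt G (G' t) t) ∧ Continuous G' ∧ EqOn G F (Icc a b) := by
  have hc := hF.continuousOn_derivWithin (uniqueDiffOn_Icc hab) le_rfl
  obtain ⟨p, hp, hpe⟩ := exists_continuous_eqOn_Icc hab.le hc
  refine ⟨fun t => F a + ∫ s in a..t, p s, p, fun t => (hasDerivAt_primitive hp a t).const_add _,
    hp, fun t ht => ?_⟩
  have h := intervalIntegral.integral_eq_sub_of_hasDerivAt_of_le ht.1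
    (hF.continuousOn.mono (Icc_subset_Icc_right ht.2)) (f' := p) (fun x hx => ?_)
    (hp.intervalIntegrable _ _)
  · simp only [h, add_sub_cancel]
  · have hxI : x ∈ Icc a b := ⟨hx.1.le, hx.2.le.trans ht.2⟩
    rw [hpe hxI]
    exact ((hF.differentiableOn one_ne_zero x hxI).hasDerivWithinAt).hasDerivAt
      (Icc_mem_nhds hx.1 (hx.2.trans_le ht.2))

section Adjoint

variable {E F : Type*} [NormedAddCommGroup E] [InnerProductSpace ℝ E] [CompleteSpace E]
  [NormedAddCommGroup F] [InnerProductSpace ℝ F] [CompleteSpace F]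

/-- Passing to the adjoint is linear over `ℝ`. -/
noncomputable def adjointCLM : (E →L[ℝ] F) →L[ℝ] (F →L[ℝ] E) :=
  LinearMap.mkContinuous
    { toFun := fun T => T.adjoint
      map_add' := fun S T => map_add _ S T
      map_smul' := fun c T => by simp } 1 fun T => by simp

theorem adjointCLM_apply (T : E →L[ℝ] F) : adjointCLM T = T.adjoint := rfl

end Adjoint

section Problem

variable {H U₁ U₂ : Type*} [NormedAddCommGroup H] [InnerProductSpace ℝ H] [CompleteSpace H]
  [NormedAddCommGroup U₁] [InnerProductSpace ℝ U₁] [CompleteSpace U₁]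
  [NormedAddCommGroup U₂] [InnerProductSpace ℝ U₂] [CompleteSpace U₂]
  {A : PositiveOperator H}

theorem dualAdjoint_eq_of_inner {B : U₁ →L[ℝ] StrongDual ℝ (EnergySpace A)} {v : EnergySpace A}
    {y : U₁} (h : ∀ x, B x v = ⟪y, x⟫_ℝ) : dualAdjoint B v = y :=
  ext_inner_right ℝ fun x => by rw [inner_dualAdjoint, h]

/-- The adjoint `B* : V → U₁` as a continuous linear map. -/
noncomputable def dualAdjointCLM (B : U₁ →L[ℝ] StrongDual ℝ (EnergySpace A)) :
    EnergySpace A →L[ℝ] U₁ :=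
  LinearMap.mkContinuous
    { toFun := dualAdjoint B
      map_add' := fun u v => dualAdjoint_eq_of_inner fun x => by
        rw [map_add, inner_add_left, inner_dualAdjoint, inner_dualAdjoint]
      map_smul' := fun c v => dualAdjoint_eq_of_inner fun x => by
        rw [map_smul, RingHom.id_apply, real_inner_smul_left, inner_dualAdjoint, smul_eq_mul] }
    ‖B.flip‖ fun v => by
      simp only [LinearMap.coe_mk, AddHom.coe_mk, dualAdjoint, LinearIsometryEquiv.norm_map]
      exact B.flip.le_opNorm v

theorem dualAdjointCLM_apply (B : U₁ →L[ℝ] StrongDual ℝ (EnergySpace A)) (v : EnergySpace A) :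
    dualAdjointCLM B v = dualAdjoint B v := rfl

/-- The abstract wave equation `W` with delayed feedback `K` describes the problem on the interval
`[a, b)`, and it can be solved there. -/
structure LocalModel (B₁ : ℝ → U₁ →L[ℝ] StrongDual ℝ (EnergySpace A)) (B₂ : ℝ → U₂ →L[ℝ] H)
    (a b : ℝ) (W : DampedWave (EnergySpace A) H U₁) (K : ℝ → H →L[ℝ] H) : Prop where
  emb_eq : W.emb = EnergySpace.embedding A
  pos : ∀ s ∈ Ico a b, 0 < W.coeff s
  damping_eq : ∀ s ∈ Ico a b, ∀ u z, B₁ s (dualAdjoint (B₁ s) u) z =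
    W.coeff s * ⟪W.obs u, W.obs z⟫_ℝ + ⟪W.pert s (W.emb u), W.emb z⟫_ℝ
  continuous : Continuous K
  delay_eq : ∀ s ∈ Ico a b, ∀ y, B₂ s ((B₂ s).adjoint y) = K s y
  solvable : ∀ d ∈ Ioc a b, ∀ p : ℝ → H, Continuous p → ∀ x₀ y₀, ∃ x y,
      W.IsWeak (fun s => -(K s (p s))) a d x y ∧ x a = x₀ ∧ y a = y₀

/-- The model with damping that is bounded on `H`. -/
noncomputable def boundedModel (U : Type*) [NormedAddCommGroup U] [InnerProductSpace ℝ U]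
    (A : PositiveOperator H) {D D' : ℝ → H →L[ℝ] H}
    (hD : ∀ t, HasDerivAt D (D' t) t) (hD' : Continuous D') :
    DampedWave (EnergySpace A) H U where
  emb := EnergySpace.embedding A
  obs := 0
  -- With `obs = 0` the coefficient has no effect on the equation; the value `1` places the model in
  -- the case of a positive coefficient.
  coeff := fun _ => 1
  coeff' := fun _ => 0
  pert := D
  pert' := D'
  emb_injective := EnergySpace.toH_injective
  emb_dense := EnergySpace.denseRange_embedding A
  coeff_continuous := continuous_const
  coeff_nonneg := fun _ => zero_le_one
  coeff_hasDerivAt := fun t _ => hasDerivAt_const t 1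
  coeff'_continuous := continuous_const
  pert_hasDerivAt := hD
  pert'_continuous := hD'

/-- The model with damping `γ⁺ C C*`, where `C` has values in `V'`. -/
noncomputable def unboundedModel (C : U₁ →L[ℝ] StrongDual ℝ (EnergySpace A)) {γ γ' : ℝ → ℝ}
    (hγ : ∀ t, HasDerivAt γ (γ' t) t) (hγ' : Continuous γ') :
    DampedWave (EnergySpace A) H U₁ where
  emb := EnergySpace.embedding A
  obs := dualAdjointCLM C
  coeff := fun t => max (γ t) 0
  coeff' := γ'
  pert := 0
  pert' := 0
  emb_injective := EnergySpace.toH_injective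
  emb_dense := EnergySpace.denseRange_embedding A
  coeff_continuous := (continuous_iff_continuousAt.mpr fun t => (hγ t).continuousAt).max
    continuous_const
  coeff_nonneg := fun _ => le_max_right _ _
  -- The positive part need not be differentiable at a zero of `γ`, which is why differentiability
  -- is only demanded where the coefficient is positive.
  coeff_hasDerivAt := fun t ht => by
    have h0 : 0 < γ t := by simpa using ht
    refine (hγ t).congr_of_eventuallyEq ?_
    filter_upwards [(hγ t).continuousAt.eventually (lt_mem_nhds h0)] with s hs
    exact max_eq_left hs.le
  coeff'_continuous := hγ'
  pert_hasDerivAt := fun t => hasDerivAt_const t 0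
  pert'_continuous := continuous_const

variable {B₁ : ℝ → U₁ →L[ℝ] StrongDual ℝ (EnergySpace A)} {B₂ : ℝ → U₂ →L[ℝ] H} {a b : ℝ}

theorem exists_localModel_of_B₁_eq_zero (hab : a < b) (h₁ : ∀ s ∈ Ico a b, B₁ s = 0)
    (h₂ : ∃ F : ℝ → U₂ →L[ℝ] H, ContinuousOn F (Icc a b) ∧ EqOn B₂ F (Ico a b)) :
    ∃ W K, LocalModel B₁ B₂ a b W K := by
  obtain ⟨F, hF, hBF⟩ := h₂
  obtain ⟨G, hG, hGF⟩ := exists_continuous_eqOn_Icc hab.le hF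
  have hK : Continuous fun s => G s ∘L (G s).adjoint :=
    hG.clm_comp (adjointCLM.continuous.comp hG)
  refine ⟨boundedModel U₁ A (D := fun _ => 0) (D' := fun _ => 0) (fun t => hasDerivAt_const t 0)
    continuous_const, fun s => G s ∘L (G s).adjoint, ⟨rfl, fun _ _ => zero_lt_one, ?_, hK, ?_, ?_⟩⟩
  · intro s hs u z
    simp [boundedModel, h₁ s hs]
  · intro s hs y
    simp [hBF hs, hGF ⟨hs.1, hs.2.le⟩]
  · intro d hd p hp x₀ y₀
    exact DampedWave.exists_isWeak _ (hK.clm_apply hp).neg hd.1.le (fun _ _ => zero_lt_one) x₀ y₀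

theorem exists_localModel_of_isBoundedDamping (hab : a < b) (h₁ : IsBoundedDamping B₁ a b)
    (h₂ : ∀ s ∈ Ico a b, B₂ s = 0) : ∃ W, LocalModel B₁ B₂ a b W 0 := by
  obtain ⟨F, hF, hBF⟩ := h₁
  obtain ⟨G, G', hG, hG', hGF⟩ := exists_hasDerivAt_eqOn_Icc hab hF
  have hGc : Continuous G := continuous_iff_continuousAt.mpr fun t => (hG t).continuousAt
  have hGa : ∀ t, HasDerivAt (fun s => adjointCLM (G s)) (adjointCLM (G' t)) t := fun t =>
    (adjointCLM (E := U₁) (F := H)).hasFDerivAt.comp_hasDerivAt t (hG t)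
  refine ⟨boundedModel U₁ A (D := fun s => G s ∘L adjointCLM (G s))
    (D' := fun s => G' s ∘L adjointCLM (G s) + G s ∘L adjointCLM (G' s))
    (fun t => (hG t).clm_comp (hGa t))
    ((hG'.clm_comp (adjointCLM.continuous.comp hGc)).add
      (hGc.clm_comp (adjointCLM.continuous.comp hG'))),
    ⟨rfl, fun _ _ => zero_lt_one, ?_, continuous_const, ?_, ?_⟩⟩
  · intro s hs u z
    have h : dualAdjoint (B₁ s) u = (G s).adjoint (EnergySpace.toH u) :=
      dualAdjoint_eq_of_inner fun x => by
        rw [hBF s hs, ← hGF ⟨hs.1, hs.2.le⟩, ContinuousLinearMap.adjoint_inner_left,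
          real_inner_comm]
    rw [h, hBF s hs, ← hGF ⟨hs.1, hs.2.le⟩]
    simp [boundedModel, adjointCLM_apply]
  · intro s hs y
    simp [h₂ s hs]
  · intro d hd p _ x₀ y₀
    simp only [Pi.zero_apply, zero_apply, neg_zero]
    exact DampedWave.exists_isWeak _ continuous_const hd.1.le (fun _ _ => zero_lt_one) x₀ y₀

theorem exists_localModel_of_isUnboundedDamping (hab : a < b) (h₁ : IsUnboundedDamping B₁ a b)
    (h₂ : ∀ s ∈ Ico a b, B₂ s = 0) : ∃ W, LocalModel B₁ B₂ a b W 0 := by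
  obtain ⟨β, C, hβ, hβc, hBC⟩ := h₁
  obtain ⟨γ, γ', L, hL, hβγ, hγ, hγ', hLip⟩ := hβ.exists_extension hab hβc
  have hγc : Continuous γ := continuous_iff_continuousAt.mpr fun t => (hγ t).continuousAt
  have hpos : ∀ s ∈ Ico a b, 0 < γ s := fun s hs => hβγ hs ▸ (hBC s hs).1
  refine ⟨unboundedModel C hγ hγ', ⟨rfl, fun s hs => lt_max_of_lt_left (hpos s hs), ?_,
    continuous_const, ?_, ?_⟩⟩
  · intro s hs u z
    have h0 := hpos s hs
    have h : dualAdjoint (√(γ s) • C) u = √(γ s) • dualAdjoint C u :=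
      dualAdjoint_eq_of_inner fun x => by
        rw [real_inner_smul_left, inner_dualAdjoint]
        rfl
    rw [(hBC s hs).2, hβγ hs, h]
    simp only [unboundedModel, dualAdjointCLM_apply, max_eq_left h0.le, Pi.zero_apply, zero_apply,
      inner_zero_left, add_zero, map_smul, smul_apply, smul_eq_mul]
    rw [← mul_assoc, Real.mul_self_sqrt h0.le, real_inner_comm, inner_dualAdjoint]
  · intro s hs y
    simp [h₂ s hs]
  · intro d hd p _ x₀ y₀
    simp only [Pi.zero_apply, zero_apply, neg_zero]
    -- Inside the interval `γ` is positive, so failure at `d` forces `d = b`, and then `γ b = 0` by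
    -- continuity: the degenerate case, for which only the source-free equation was solved. Here the
    -- feedback is `0`, so this suffices.
    by_cases hdp : 0 < γ d
    · refine DampedWave.exists_isWeak _ continuous_const hd.1.le (fun s hs => ?_) x₀ y₀
      rcases eq_or_lt_of_le hs.2 with rfl | h
      · exact lt_max_of_lt_left hdp
      · exact lt_max_of_lt_left (hpos s ⟨hs.1, h.trans_le hd.2⟩)
    · have hdb : d = b := by
        by_contra h
        exact hdp (hpos d ⟨hd.1.le, lt_of_le_of_ne hd.2 h⟩)
      subst hdb
      have h0 : γ d = 0 := by
        refine le_antisymm (not_lt.mp hdp) ?_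
        have hsub : closure (Ico a d) ⊆ {s | 0 ≤ γ s} :=
          closure_minimal (fun s hs => (hpos s hs).le) (isClosed_le continuous_const hγc)
        rw [closure_Ico hab.ne] at hsub
        exact hsub ⟨hab.le, le_rfl⟩
      obtain ⟨K, hK, hKb⟩ := exists_deriv_sq_le hab hL hγ hγ' hLip hpos h0
      have hm : ∀ t ∈ Ico a d, max (γ t) 0 = γ t := fun t ht => max_eq_left (hpos t ht).le
      have hdeg : (unboundedModel C hγ hγ').Degenerates a d K :=
        { pert_eq_zero := fun _ => rfl
          pert'_eq_zero := fun _ => rfl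
          nonneg := hK
          lt := hab
          pos := fun s hs => lt_max_of_lt_left (hpos s hs)
          le_mul := fun t ht => by
            simpa only [unboundedModel, hm t ht] using (hKb t ht).1
          deriv_sq_le := fun t ht => by
            simpa only [unboundedModel, hm t ht] using (hKb t ht).2 }
      exact hdeg.exists_isWeak x₀ y₀

/-- The alternative `K = 0 ∨ τ ≤ t n` keeps delayed times nonnegative whenever the feedback is
active: an odd interval starts at `t (2m) + T_{2m} ≥ τ`. -/
theorem IntermittentStructure.exists_localModel {τ : ℝ} {t : ℕ → ℝ}
    (hB : IntermittentStructure B₁ B₂ τ t) (n : ℕ) :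
    ∃ W K, LocalModel B₁ B₂ (t n) (t (n + 1)) W K ∧ (K = 0 ∨ τ ≤ t n) := by
  have hlt : t n < t (n + 1) := hB.strictMono n.lt_succ_self
  obtain ⟨m, rfl | rfl⟩ := n.even_or_odd'
  · rcases hB.B₁_regular m with h | h
    · obtain ⟨W, hW⟩ := exists_localModel_of_isBoundedDamping hlt h (hB.B₂_eq_zero m)
      exact ⟨W, 0, hW, Or.inl rfl⟩
    · obtain ⟨W, hW⟩ := exists_localModel_of_isUnboundedDamping hlt h (hB.B₂_eq_zero m)
      exact ⟨W, 0, hW, Or.inl rfl⟩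
  · obtain ⟨W, K, hW⟩ := exists_localModel_of_B₁_eq_zero hlt (hB.B₁_eq_zero m) (hB.B₂_continuous m)
    refine ⟨W, K, hW, Or.inr ?_⟩
    have h1 := hB.strictMono.monotone (Nat.zero_le (2 * m))
    rw [hB.zero] at h1
    linarith [hB.delay_le m]

end Problem

end IntermittentDelay

/-! ### Assembling the intervals. -/

namespace IntermittentDelay

open Filter Topology

/-- Functions on the half-lines `(-∞, t n]` that extend one another have a common extension. -/
theorem exists_eqOn_Iic_of_extensions {X : Type*} {t : ℕ → ℝ} (ht : Monotone t)
    (hunb : ∀ s, ∃ n, s ≤ t n) {f : ℕ → ℝ → X} (h : ∀ n, EqOn (f (n + 1)) (f n) (Iic (t n))) :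
    ∃ g, ∀ n, EqOn g (f n) (Iic (t n)) := by
  have hmn : ∀ m n, m ≤ n → EqOn (f n) (f m) (Iic (t m)) := by
    intro m n hmn
    induction n, hmn using Nat.le_induction with
    | base => exact fun _ _ => rfl
    | succ n hmn ih => exact fun s hs => (h n (le_trans hs (ht hmn))).trans (ih hs)
  choose N hN using hunb
  refine ⟨fun s => f (N s) s, fun n s hs => ?_⟩
  rcases le_total (N s) n with hle | hle
  · exact (hmn _ _ hle (hN s)).symm
  · exact hmn _ _ hle hs

section Problem

set_option linter.unusedSectionVars false

variable {H U₁ U₂ : Type*} [NormedAddCommGroup H] [InnerProductSpace ℝ H] [CompleteSpace H]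
  [NormedAddCommGroup U₁] [InnerProductSpace ℝ U₁] [CompleteSpace U₁]
  [NormedAddCommGroup U₂] [InnerProductSpace ℝ U₂] [CompleteSpace U₂]
  {A : PositiveOperator H} {B₁ : ℝ → U₁ →L[ℝ] StrongDual ℝ (EnergySpace A)}
  {B₂ : ℝ → U₂ →L[ℝ] H} {a b τ : ℝ} {t : ℕ → ℝ}

/-- The product rule with `u` frozen. The part with `φ'` is the damping contribution to the momentum
and the part with `φ` that to the force, which is how the transposed damping term matches the
integrated weak form. -/
theorem LocalModel.deriv_eq {W : DampedWave (EnergySpace A) H U₁} {K : ℝ → H →L[ℝ] H}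
    (M : LocalModel B₁ B₂ a b W K) {φ : ℝ → ℝ} {s φ' : ℝ} (hφ : HasDerivAt φ φ' s)
    (hs : s ∈ Ioo a b) (u z : EnergySpace A) :
    deriv (fun r => φ r * B₁ r (dualAdjoint (B₁ r) u) z) s =
      φ' * (W.coeff s * ⟪W.obs u, W.obs z⟫_ℝ + ⟪W.pert s (W.emb u), W.emb z⟫_ℝ) +
      φ s * (W.coeff' s * ⟪W.obs u, W.obs z⟫_ℝ + ⟪W.pert' s (W.emb u), W.emb z⟫_ℝ) := by
  have h1 := W.coeff_hasDerivAt s (M.pos s ⟨hs.1.le, hs.2⟩)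
  have h2 : HasDerivAt (fun r => ⟪W.pert r (W.emb u), W.emb z⟫_ℝ)
      ⟪W.pert' s (W.emb u), W.emb z⟫_ℝ s := by
    have h3 : HasDerivAt (fun r => W.pert r (W.emb u)) (W.pert' s (W.emb u)) s := by
      simpa using (W.pert_hasDerivAt s).clm_apply (hasDerivAt_const s (W.emb u))
    simpa using h3.inner ℝ (hasDerivAt_const s (W.emb z))
  refine HasDerivAt.deriv ((hφ.mul ((h1.mul_const _).add h2)).congr_of_eventuallyEq ?_)
  filter_upwards [isOpen_Ioo.mem_nhds hs] with r hr
  rw [M.damping_eq r ⟨hr.1.le, hr.2⟩]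
  rfl

/-- The equation in the sense of distributions is equivalent to its integrated form. -/
theorem LocalModel.solvesOn_iff {W : DampedWave (EnergySpace A) H U₁} {K : ℝ → H →L[ℝ] H}
    (M : LocalModel B₁ B₂ a b W K) (ha : 0 ≤ a) (hab : a < b) (hK : K = 0 ∨ τ ≤ a)
    {u : ℝ → EnergySpace A} {v : ℝ → H} (hu : ContinuousOn u (Ici 0)) (hv : Continuous v)
    (huv : EqOn (velocity u) v (Ici 0)) :
    SolvesOn B₁ B₂ τ u a b ↔ ∀ z, ∀ s ∈ Icc a b,
      W.momentum s (u s) (v s) z - W.momentum a (u a) (v a) z =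
        ∫ r in a..s, (W.force r (u r) z + ⟪DampedWave.delayed K τ v r, W.emb z⟫_ℝ) := by
  have hI : Icc a b ⊆ Ici 0 := fun s hs => ha.trans hs.1
  have hu' : ContinuousOn u (Icc a b) := hu.mono hI
  have hdc : Continuous (DampedWave.delayed K τ v) :=
    (M.continuous.clm_apply (hv.comp (continuous_id.sub continuous_const))).neg
  refine forall_congr' fun z => ?_
  rw [sub_eq_integral_iff (m := fun s => W.momentum s (u s) (v s) z)
    (g := fun r => W.force r (u r) z + ⟪DampedWave.delayed K τ v r, W.emb z⟫_ℝ) hab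
    (W.continuousOn_momentum hu' hv.continuousOn z)
    ((W.continuousOn_force hu' z).add (hdc.continuousOn.inner continuousOn_const))]
  refine forall_congr' fun φ => forall_congr' fun hφ => ?_
  have e1 : ∫ s in Ioo a b, ⟪velocity u s, EnergySpace.toH z⟫_ℝ * deriv φ s
      = ∫ s in a..b, ⟪v s, W.emb z⟫_ℝ * deriv φ s := by
    rw [← integral_Ioo_eq_intervalIntegral hab.le]
    refine setIntegral_congr_fun measurableSet_Ioo fun s hs => ?_
    simp only [huv (hI (Ioo_subset_Icc_self hs)), M.emb_eq, EnergySpace.embedding_apply]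
  have e2 := integral_Ioo_eq_intervalIntegral hab.le fun s => ⟪u s, z⟫_ℝ * φ s
  have e3 : dampingPairing B₁ u z φ a b = -∫ s in a..b,
      (deriv φ s * (W.coeff s * ⟪W.obs (u s), W.obs z⟫_ℝ
        + ⟪W.pert s (W.emb (u s)), W.emb z⟫_ℝ)
      + φ s * (W.coeff' s * ⟪W.obs (u s), W.obs z⟫_ℝ
        + ⟪W.pert' s (W.emb (u s)), W.emb z⟫_ℝ)) := by
    rw [← integral_Ioo_eq_intervalIntegral hab.le, dampingPairing]
    congr 1
    exact setIntegral_congr_fun measurableSet_Ioo fun s hs => M.deriv_eq (hφ.hasDerivAt s) hs _ z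
  have e4 : ∫ s in Ioo a b, ⟪B₂ s ((B₂ s).adjoint (velocity u (s - τ))), EnergySpace.toH z⟫_ℝ * φ s
      = ∫ s in a..b, -(⟪DampedWave.delayed K τ v s, W.emb z⟫_ℝ * φ s) := by
    rw [← integral_Ioo_eq_intervalIntegral hab.le]
    refine setIntegral_congr_fun measurableSet_Ioo fun s hs => ?_
    simp only [M.delay_eq s ⟨hs.1.le, hs.2⟩, M.emb_eq, EnergySpace.embedding_apply,
      DampedWave.delayed, inner_neg_left, neg_mul, neg_neg]
    rcases hK with rfl | hK
    · simp
    · rw [huv (show (0 : ℝ) ≤ s - τ by linarith [hs.1])]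
  have j1 : ContinuousOn (fun t => W.obs (u t)) (Icc a b) := W.obs.continuous.comp_continuousOn hu'
  have j2 : ContinuousOn (fun t => W.emb (u t)) (Icc a b) := W.emb.continuous.comp_continuousOn hu'
  have hφc := hφ.continuous.continuousOn (s := Icc a b)
  have hφc' := hφ.continuous_deriv.continuousOn (s := Icc a b)
  have hint : ∀ {f : ℝ → ℝ}, ContinuousOn f (Icc a b) → IntervalIntegrable f volume a b := fun hf =>
    ContinuousOn.intervalIntegrable (by rwa [uIcc_of_le hab.le])
  have i1 : IntervalIntegrable (fun s => ⟪v s, W.emb z⟫_ℝ * deriv φ s) volume a b := hint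
    ((hv.continuousOn.inner (continuousOn_const (c := W.emb z))).mul hφc')
  have i2 : IntervalIntegrable (fun s => ⟪u s, z⟫_ℝ * φ s) volume a b := hint
    ((hu'.inner (continuousOn_const (c := z))).mul hφc)
  have i3 : IntervalIntegrable (fun s => deriv φ s * (W.coeff s * ⟪W.obs (u s), W.obs z⟫_ℝ
        + ⟪W.pert s (W.emb (u s)), W.emb z⟫_ℝ)
      + φ s * (W.coeff' s * ⟪W.obs (u s), W.obs z⟫_ℝ
        + ⟪W.pert' s (W.emb (u s)), W.emb z⟫_ℝ)) volume a b := hint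
    ((hφc'.mul ((W.coeff_continuous.continuousOn.mul
      (j1.inner (continuousOn_const (c := W.obs z)))).add
      ((W.pert_continuous.continuousOn.clm_apply j2).inner (continuousOn_const (c := W.emb z))))).add
    (hφc.mul ((W.coeff'_continuous.continuousOn.mul
      (j1.inner (continuousOn_const (c := W.obs z)))).add
      ((W.pert'_continuous.continuousOn.clm_apply j2).inner (continuousOn_const (c := W.emb z))))))
  have i4 : IntervalIntegrable (fun s => ⟪DampedWave.delayed K τ v s, W.emb z⟫_ℝ * φ s) volume a b := hint
    ((hdc.continuousOn.inner (continuousOn_const (c := W.emb z))).mul hφc)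
  have i5 : IntervalIntegrable (fun s => W.momentum s (u s) (v s) z * deriv φ s) volume a b := hint
    ((W.continuousOn_momentum hu' hv.continuousOn z).mul hφc')
  have i6 : IntervalIntegrable (fun s => (W.force s (u s) z
      + ⟪DampedWave.delayed K τ v s, W.emb z⟫_ℝ) * φ s) volume a b := hint
    (((W.continuousOn_force hu' z).add
    (hdc.continuousOn.inner (continuousOn_const (c := W.emb z)))).mul hφc)
  have e5 : (∫ s in a..b, W.momentum s (u s) (v s) z * deriv φ s)
      + ∫ s in a..b, (W.force s (u s) z + ⟪DampedWave.delayed K τ v s, W.emb z⟫_ℝ) * φ s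
      = (∫ s in a..b, ⟪v s, W.emb z⟫_ℝ * deriv φ s) - (∫ s in a..b, ⟪u s, z⟫_ℝ * φ s)
        + (∫ s in a..b, (deriv φ s * (W.coeff s * ⟪W.obs (u s), W.obs z⟫_ℝ
            + ⟪W.pert s (W.emb (u s)), W.emb z⟫_ℝ)
          + φ s * (W.coeff' s * ⟪W.obs (u s), W.obs z⟫_ℝ
            + ⟪W.pert' s (W.emb (u s)), W.emb z⟫_ℝ)))
        + ∫ s in a..b, ⟪DampedWave.delayed K τ v s, W.emb z⟫_ℝ * φ s := by
    rw [← intervalIntegral.integral_add i5 i6, ← intervalIntegral.integral_sub i1 i2,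
      ← intervalIntegral.integral_add (i1.sub i2) i3,
      ← intervalIntegral.integral_add ((i1.sub i2).add i3) i4]
    refine intervalIntegral.integral_congr fun s _ => ?_
    simp only [DampedWave.momentum, DampedWave.force]
    ring
  rw [e1, e2, e3, e4, e5, intervalIntegral.integral_neg, ← neg_eq_zero]
  refine Eq.congr ?_ rfl
  ring

theorem IntermittentStructure.nonneg (hB : IntermittentStructure B₁ B₂ τ t) (n : ℕ) : 0 ≤ t n := by
  rw [← hB.zero]
  exact hB.strictMono.monotone n.zero_le

/-- Every even interval has length at least `τ`, so `t (2n) ≥ n τ` and the intervals cover the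
half-line. -/
theorem IntermittentStructure.exists_le (hB : IntermittentStructure B₁ B₂ τ t) (s : ℝ) :
    ∃ n, s ≤ t n := by
  have h : ∀ n : ℕ, n * τ ≤ t (2 * n) := by
    intro n
    induction n with
    | zero => simp [hB.zero]
    | succ n ih =>
      have h1 := hB.delay_le n
      have h2 : t (2 * n + 1) ≤ t (2 * (n + 1)) := hB.strictMono.monotone (by omega)
      push_cast
      linarith
  obtain ⟨n, hn⟩ := exists_nat_gt (s / τ)
  rw [div_lt_iff₀ hB.delay_pos] at hn
  exact ⟨2 * n, hn.le.trans (h n)⟩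

theorem continuous_of_forall_continuousOn_Iic {X : Type*} [TopologicalSpace X] {f : ℝ → X}
    (hunb : ∀ s, ∃ n, s ≤ t n) (h : ∀ n, ContinuousOn f (Iic (t n))) : Continuous f :=
  continuous_iff_continuousAt.mpr fun s => by
    obtain ⟨n, hn⟩ := hunb (s + 1)
    exact (h n).continuousAt (Iic_mem_nhds (by linarith))

variable {W : ℕ → DampedWave (EnergySpace A) H U₁} {K : ℕ → ℝ → H →L[ℝ] H}
  {u₀ : EnergySpace A} {u₁ : H}

/-- Existence of a weak solution on all intervals. -/
theorem exists_forall_isWeak (hB : IntermittentStructure B₁ B₂ τ t)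
    (hM : ∀ n, LocalModel B₁ B₂ (t n) (t (n + 1)) (W n) (K n)) (u₀ : EnergySpace A) (u₁ : H) :
    ∃ (u : ℝ → EnergySpace A) (v : ℝ → H), Continuous u ∧ Continuous v ∧ u 0 = u₀ ∧ v 0 = u₁ ∧
      ∀ n, (W n).IsWeak (DampedWave.delayed (K n) τ v) (t n) (t (n + 1)) u v := by
  have hmono := hB.strictMono.monotone
  let S : ℕ → (ℝ → EnergySpace A) × (ℝ → H) → Prop := fun n p =>
    ContinuousOn p.1 (Iic (t n)) ∧ ContinuousOn p.2 (Iic (t n)) ∧ p.1 0 = u₀ ∧ p.2 0 = u₁ ∧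
      ∀ k < n, (W k).IsWeak (DampedWave.delayed (K k) τ p.2) (t k) (t (k + 1)) p.1 p.2
  have step : ∀ n p, S n p → ∃ q, S (n + 1) q ∧ EqOn q.1 p.1 (Iic (t n)) ∧
      EqOn q.2 p.2 (Iic (t n)) := by
    intro n p hp
    obtain ⟨x, y, hx, hy, hxp, hyp, hw⟩ := DampedWave.exists_isWeak_delayed
      (hB.strictMono n.lt_succ_self) hB.delay_pos (hM n).pos (hM n).continuous (hM n).solvable
      hp.1 hp.2.1
    have h0 : (0 : ℝ) ∈ Iic (t n) := hB.nonneg n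
    refine ⟨(x, y), ⟨hx, hy, (hxp h0).trans hp.2.2.1, (hyp h0).trans hp.2.2.2.1,
      fun k hk => ?_⟩, hxp, hyp⟩
    rcases eq_or_lt_of_le (Nat.lt_succ_iff.mp hk) with rfl | hk
    · exact hw
    · have hkn : t (k + 1) ≤ t n := hmono hk
      refine (hp.2.2.2.2 k hk).congr (fun s hs => hxp (hs.2.trans hkn))
        (fun s hs => hyp (hs.2.trans hkn)) fun s hs => ?_
      simp only [DampedWave.delayed]
      rw [hyp (show s - τ ≤ t n by linarith [hs.2, hB.delay_pos])]
  -- The history before time `0` is filled in by constants to make delayed values continuous. It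
  -- does not affect the problem, whose feedback never looks back beyond `0`.
  have hS0 : S 0 (fun _ => u₀, fun _ => u₁) :=
    ⟨continuousOn_const, continuousOn_const, rfl, rfl, fun k hk => absurd hk k.not_lt_zero⟩
  choose g hg using step
  let f : ∀ n, {p // S n p} := fun n => Nat.rec ⟨_, hS0⟩
    (fun n p => ⟨g n p.1 p.2, (hg n p.1 p.2).1⟩) n
  obtain ⟨u, hu⟩ := exists_eqOn_Iic_of_extensions (f := fun n => (f n).1.1) hmono hB.exists_le
    fun n => (hg n (f n).1 (f n).2).2.1
  obtain ⟨v, hv⟩ := exists_eqOn_Iic_of_extensions (f := fun n => (f n).1.2) hmono hB.exists_le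
    fun n => (hg n (f n).1 (f n).2).2.2
  have h0 : (0 : ℝ) ∈ Iic (t 0) := hB.nonneg 0
  refine ⟨u, v, continuous_of_forall_continuousOn_Iic hB.exists_le fun n => (f n).2.1.congr (hu n),
    continuous_of_forall_continuousOn_Iic hB.exists_le fun n => (f n).2.2.1.congr (hv n),
    (hu 0 h0).trans (f 0).2.2.2.1, (hv 0 h0).trans (f 0).2.2.2.2.1, fun n => ?_⟩
  refine ((f (n + 1)).2.2.2.2.2 n n.lt_succ_self).congr (fun s hs => hu (n + 1) hs.2)
    (fun s hs => hv (n + 1) hs.2) fun s hs => ?_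
  simp only [DampedWave.delayed]
  rw [hv (n + 1) (show s - τ ≤ t (n + 1) by linarith [hs.2, hB.delay_pos])]

/-- The displacement identities add up over the intervals, so in `H` the function `u` is a primitive
of the continuous `v` on `[0, ∞)`. Hence it is `C¹` across the points `t n`, with velocity `v`. -/
theorem isSolution_of_forall_isWeak (hB : IntermittentStructure B₁ B₂ τ t)
    (hM : ∀ n, LocalModel B₁ B₂ (t n) (t (n + 1)) (W n) (K n)) (hK : ∀ n, K n = 0 ∨ τ ≤ t n)
    {u : ℝ → EnergySpace A} {v : ℝ → H} (hu : Continuous u) (hv : Continuous v)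
    (hw : ∀ n, (W n).IsWeak (DampedWave.delayed (K n) τ v) (t n) (t (n + 1)) u v) :
    IsSolution B₁ B₂ τ t (u 0) (v 0) u := by
  have hdis : ∀ n, ∀ s ∈ Icc 0 (t n), EnergySpace.toH (u s)
      = EnergySpace.toH (u 0) + ∫ r in (0 : ℝ)..s, v r := by
    intro n
    induction n with
    | zero =>
      intro s hs
      rw [hB.zero] at hs
      rw [le_antisymm hs.2 hs.1]
      simp
    | succ n ih =>
      intro s hs
      rcases le_or_gt s (t n) with h | h
      · exact ih s ⟨hs.1, h⟩
      · have h1 := (hw n).displacement s ⟨h.le, hs.2⟩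
        rw [(hM n).emb_eq, EnergySpace.embedding_apply, EnergySpace.embedding_apply,
          ih (t n) ⟨hB.nonneg n, le_rfl⟩] at h1
        rw [← intervalIntegral.integral_add_adjacent_intervals (hv.intervalIntegrable 0 (t n))
          (hv.intervalIntegrable (t n) s), ← h1]
        abel
  have hE : EqOn (fun s => EnergySpace.toH (u s))
      (fun s => EnergySpace.toH (u 0) + ∫ r in (0 : ℝ)..s, v r) (Ici 0) := fun s hs => by
    obtain ⟨n, hn⟩ := hB.exists_le s
    exact hdis n s ⟨hs, hn⟩
  have hder : ∀ s, HasDerivAt (fun s => EnergySpace.toH (u 0) + ∫ r in (0 : ℝ)..s, v r) (v s) s :=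
    fun s => (hasDerivAt_primitive hv 0 s).const_add _
  have hC1 : ContDiff ℝ 1 (fun s => EnergySpace.toH (u 0) + ∫ r in (0 : ℝ)..s, v r) := by
    rw [contDiff_one_iff_deriv]
    exact ⟨fun s => (hder s).differentiableAt, by rwa [funext fun s => (hder s).deriv]⟩
  have hvel : EqOn (velocity u) v (Ici 0) := fun s hs =>
    ((hder s).hasDerivWithinAt.congr_of_mem hE hs).derivWithin (uniqueDiffOn_Ici 0 s hs)
  exact ⟨hu.continuousOn, hC1.contDiffOn.congr hE, rfl, hvel (mem_Ici.mpr le_rfl), fun n =>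
    ((hM n).solvesOn_iff (hB.nonneg n) (hB.strictMono n.lt_succ_self) (hK n) hu.continuousOn hv
      hvel).mpr fun z s hs => (hw n).balance s hs z⟩

namespace IsSolution

variable {u w : ℝ → EnergySpace A}

theorem continuousOn_velocity (hu : IsSolution B₁ B₂ τ t u₀ u₁ u) :
    ContinuousOn (velocity u) (Ici 0) :=
  hu.contDiffOn.continuousOn_derivWithin (uniqueDiffOn_Ici 0) le_rfl

/-- `velocity` is meaningful on `[0, ∞)` only; continuing it by its value at `0` gives a continuous
function on the line to insert into the delayed source. -/
theorem continuous_velocity_max (hu : IsSolution B₁ B₂ τ t u₀ u₁ u) :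
    Continuous fun s => velocity u (max s 0) :=
  hu.continuousOn_velocity.comp_continuous (by fun_prop) fun s => le_max_right s 0

theorem isWeak (hu : IsSolution B₁ B₂ τ t u₀ u₁ u) (hB : IntermittentStructure B₁ B₂ τ t) {n : ℕ}
    (hM : LocalModel B₁ B₂ (t n) (t (n + 1)) (W n) (K n)) (hK : K n = 0 ∨ τ ≤ t n) :
    (W n).IsWeak (DampedWave.delayed (K n) τ fun s => velocity u (max s 0)) (t n) (t (n + 1)) u
      fun s => velocity u (max s 0) := by
  have hv := hu.continuous_velocity_max
  have hvel : EqOn (velocity u) (fun s => velocity u (max s 0)) (Ici 0) := fun s hs => by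
    simp only [max_eq_left (mem_Ici.mp hs)]
  have h0 := hB.nonneg n
  have hI : Icc (t n) (t (n + 1)) ⊆ Ici 0 := fun s hs => h0.trans hs.1
  refine ⟨hu.continuousOn.mono hI, hv.continuousOn, fun s hs => ?_, fun s hs z =>
    (hM.solvesOn_iff h0 (hB.strictMono n.lt_succ_self) hK hu.continuousOn hv hvel).mp
      (hu.equation n) z s hs⟩
  rw [hM.emb_eq, EnergySpace.embedding_apply, EnergySpace.embedding_apply]
  refine (intervalIntegral.integral_eq_sub_of_hasDerivAt_of_le
    (f := fun s => EnergySpace.toH (u s)) hs.1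
    (hu.contDiffOn.continuousOn.mono fun r hr => h0.trans hr.1) (fun r hr => ?_)
    (hv.intervalIntegrable _ _)).symm
  have hr0 : 0 < r := h0.trans_lt hr.1
  have h1 := (hu.contDiffOn.differentiableOn one_ne_zero r hr0.le).hasDerivWithinAt.hasDerivAt
    (Ici_mem_nhds hr0)
  rw [max_eq_left hr0.le]
  exact h1

/-- Induction over the intervals. The velocities are carried along with the displacements, because
the source on the next interval depends on the past velocity. -/
theorem eqOn (hu : IsSolution B₁ B₂ τ t u₀ u₁ u) (hw : IsSolution B₁ B₂ τ t u₀ u₁ w)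
    (hB : IntermittentStructure B₁ B₂ τ t)
    (hM : ∀ n, LocalModel B₁ B₂ (t n) (t (n + 1)) (W n) (K n)) (hK : ∀ n, K n = 0 ∨ τ ≤ t n) :
    EqOn u w (Ici 0) := by
  have key : ∀ n, EqOn u w (Icc 0 (t n)) ∧
      EqOn (fun s => velocity u (max s 0)) (fun s => velocity w (max s 0)) (Iic (t n)) := by
    intro n
    induction n with
    | zero =>
      rw [hB.zero]
      refine ⟨fun s hs => ?_, fun s hs => ?_⟩
      · rw [le_antisymm hs.2 hs.1, hu.initial, hw.initial]
      · simp only [max_eq_right (mem_Iic.mp hs), hu.initial_velocity, hw.initial_velocity]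
    | succ n ih =>
      obtain ⟨h1, h2⟩ := (hu.isWeak hB (hM n) (hK n)).eqOn_delayed (hB.strictMono n.lt_succ_self)
        hB.delay_pos (hM n).pos (hM n).continuous hu.continuous_velocity_max.continuousOn
        (hw.isWeak hB (hM n) (hK n)) (ih.1 ⟨hB.nonneg n, le_rfl⟩) ih.2
      refine ⟨fun s hs => ?_, h2⟩
      rcases le_or_gt s (t n) with h | h
      · exact ih.1 ⟨hs.1, h⟩
      · exact h1 ⟨h.le, hs.2⟩
  intro s hs
  obtain ⟨n, hn⟩ := hB.exists_le s
  exact (key n).1 ⟨hs, hn⟩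

end IsSolution

end Problem

end IntermittentDelay

theorem theorem2p1 {H U₁ U₂ : Type*}
    [NormedAddCommGroup H] [InnerProductSpace ℝ H] [CompleteSpace H]
    [NormedAddCommGroup U₁] [InnerProductSpace ℝ U₁] [CompleteSpace U₁]
    [NormedAddCommGroup U₂] [InnerProductSpace ℝ U₂] [CompleteSpace U₂]
    (A : IntermittentDelay.PositiveOperator H)
    (B₁ : ℝ → U₁ →L[ℝ] StrongDual ℝ (IntermittentDelay.EnergySpace A))
    (B₂ : ℝ → U₂ →L[ℝ] H) (τ : ℝ) (t : ℕ → ℝ)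
    (hB : IntermittentDelay.IntermittentStructure B₁ B₂ τ t)
    (u₀ : IntermittentDelay.EnergySpace A) (u₁ : H) :
    ∃ u : ℝ → IntermittentDelay.EnergySpace A,
      IntermittentDelay.IsSolution B₁ B₂ τ t u₀ u₁ u ∧
      ∀ w : ℝ → IntermittentDelay.EnergySpace A,
        IntermittentDelay.IsSolution B₁ B₂ τ t u₀ u₁ w → Set.EqOn w u (Set.Ici 0) := by
  choose W K hM hK using hB.exists_localModel
  obtain ⟨u, v, hu, hv, rfl, rfl, hw⟩ :=
    IntermittentDelay.exists_forall_isWeak hB hM u₀ u₁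
  have h := IntermittentDelay.isSolution_of_forall_isWeak hB hM hK hu hv hw
  exact ⟨u, h, fun w hw' => hw'.eqOn h hB hM hK⟩
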